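/- Let $N\in\mathbb N$ and let $X=\{X_t,\ t\ge 0\}$ be a right-continuous Markov chain with left limits on a probability space $(\Omega,\mathcal F,P)$, whose state space is the set of unit vectors $\{e_1,\dots,e_N\}$ of $\mathbb R^N$, with (measurable, time-dependent) rate matrices $A_t$ whose entries are bounded in $t$; here $A_{ji}(t)$, $j\neq i$, is the rate of jumping from $e_i$ to $e_j$. Let $\{\mathcal F_t\}$ be the completed natural filtration of $X$ and $\mathcal P$ the predictable $\sigma$-algebra. Let $M$ be the martingale $M_t=X_t-X_0-\int_0^tA_sX_s\,ds$. Put $$\Psi_t=\mathrm{diag}(A_tX_{t-})-\mathrm{diag}(X_{t-})A_t'-A_t\,\mathrm{diag}(X_{t-}),\qquad \|v\|_{X_t}^2=v'\Psi_tv\quad (v\in\mathbb R^N),$$ where $'$ on a vector or matrix denotes transposition and $X_{0-}=X_0$. Let $T\ge 0$ and $c',c''\ge 0$. There is a constant $C'>0$, depending only on $c'$, $c''$ and $T$, such that the following holds for every such chain $X$. Let $\xi\in L^2(\mathcal F_T)$, and let $f:\Omega\times[0,T]\times\mathbb R\times\mathbb R^N\to\mathbb R$ be $\mathcal P\times\mathcal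 B(\mathbb R^{1+N})$-measurable with $E\big[\int_0^T|f(t,0,0)|^2dt\big]<\infty$ and, almost surely, $$|f(t,y_1,z_1)-f(t,y_2,z_2)|\le c'|y_1-y_2|+c''\|z_1-z_2\|_{X_t}$$ for all $t\in[0,T]$, $y_1,y_2\in\mathbb R$, $z_1,z_2\in\mathbb R^N$. Let $(Y,Z)$ be a solution of the BSDE $$Y_t=\xi+\int_t^Tf(s,Y_s,Z_s)\,ds-\int_t^TZ_s'\,dM_s,\qquad 0\le t\le T,$$ where $Y$ is real-valued, adapted and right-continuous with left limits with $E\big[\int_0^T|Y_s|^2ds\big]<\infty$, and $Z$ is $\mathbb R^N$-valued and predictable with $E\big[\int_0^T\|Z_s\|^2_{X_s}ds\big]<\infty$. Then $$E\Big[\sup_{0\le t\le T}|Y_t|^2\Big]+E\Big[\int_0^T\|Z_t\|_{X_t}^2\,dt\Big]\le C'\,E\Big[|\xi|^2+\Big(\int_0^T|f(s,0,0)|\,ds\Big)^2\Big].$$ -/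

import Mathlib

open MeasureTheory ProbabilityTheory Filter Topology
open scoped NNReal ENNReal Matrix

noncomputable section

namespace MarkovBSDE

/-- Lebesgue measure on the time axis `[0, ∞)`. -/
def timeMeasure : Measure ℝ≥0 :=
  Measure.comap ((↑) : ℝ≥0 → ℝ) volume

/-- `A` is a bounded measurable family of rate matrices. The convention is `dX = A X dt + dM`, so
`A t j i` is the rate of jumping from state `i` to state `j`, and columns sum to zero. -/
structure IsRateMatrix {N : ℕ} (A : ℝ≥0 → Matrix (Fin N) (Fin N) ℝ) : Prop where
  measurable : ∀ i j, Measurable fun t => A t i j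
  bounded : ∃ m : ℝ, ∀ t i j, |A t i j| ≤ m
  nonneg : ∀ t i j, i ≠ j → 0 ≤ A t i j
  col_sum : ∀ t j, ∑ i, A t i j = 0

/-- `Φ s t` (`s ≤ t`) is the transition matrix from time `s` to time `t` generated by `A`:
it solves the forward equation `∂Φ(s,t)/∂t = A_t Φ(s,t)`, `Φ(s,s) = 1`, in integrated form. -/
structure IsTransitionMatrix {N : ℕ} (A : ℝ≥0 → Matrix (Fin N) (Fin N) ℝ)
    (Φ : ℝ≥0 → ℝ≥0 → Matrix (Fin N) (Fin N) ℝ) : Prop where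
  continuousOn : ∀ s, ContinuousOn (Φ s) (Set.Ici s)
  forward : ∀ s t, s ≤ t → ∀ i j,
    Φ s t i j = (1 : Matrix (Fin N) (Fin N) ℝ) i j
      + ∫ u in Set.Ioc s t, (A u * Φ s u) i j ∂timeMeasure

variable {Ω : Type*} [mΩ : MeasurableSpace Ω]

/-- The σ-algebra generated by the null events of `μ`. -/
abbrev nullEvents (μ : Measure Ω) : MeasurableSpace Ω :=
  MeasurableSpace.generateFrom {s | MeasurableSet s ∧ μ s = 0}

theorem nullEvents_le (μ : Measure Ω) : nullEvents μ ≤ mΩ :=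
  MeasurableSpace.generateFrom_le fun _ hs => hs.1

/-- The natural filtration `σ(X_s ; s ≤ t)` of `X`, completed by the null events of `μ` (which are
all the `μ`-null sets if the probability space is complete). -/
def completedFiltration (μ : Measure Ω) {N : ℕ} (X : ℝ≥0 → Ω → (Fin N → ℝ))
    (hX : ∀ t, Measurable (X t)) : Filtration ℝ≥0 mΩ :=
  Filtration.natural X (fun t => (hX t).stronglyMeasurable)
    ⊔ Filtration.const ℝ≥0 (nullEvents μ) (nullEvents_le μ)

/-- `X` is a right-continuous Markov chain with left limits, with rate matrix `A`, whose state
space is the set of unit vectors `e_1, …, e_N` of `ℝ^N`. As `X_t` is a unit vector, its `j`-th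
coordinate is the indicator of `X_t = e_j`, so the field `markov` says that
`P(X_t = e_j | F_s) = (Φ(s,t) X_s)_j`, where `Φ` are the transition matrices generated by `A`. -/
structure IsMarkovChain (μ : Measure Ω) {N : ℕ} (A : ℝ≥0 → Matrix (Fin N) (Fin N) ℝ)
    (X : ℝ≥0 → Ω → (Fin N → ℝ)) (hX : ∀ t, Measurable (X t)) : Prop where
  rate : IsRateMatrix A
  unit : ∀ t ω, ∃ i, X t ω = Pi.single i 1
  right_cont : ∀ ω t, ContinuousWithinAt (fun s => X s ω) (Set.Ici t) t
  left_lim : ∀ ω t, ∃ l, Tendsto (fun s => X s ω) (𝓝[<] t) (𝓝 l)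
  markov : ∃ Φ, IsTransitionMatrix A Φ ∧ ∀ s t, s ≤ t → ∀ j,
    μ[fun ω => X t ω j | completedFiltration μ X hX s] =ᵐ[μ] fun ω => (Φ s t *ᵥ X s ω) j

/-- The left limit `X_{t-}`, with `X_{0-} = X_0`. -/
def leftX {N : ℕ} (X : ℝ≥0 → Ω → (Fin N → ℝ)) (t : ℝ≥0) (ω : Ω) : Fin N → ℝ :=
  Function.leftLim (fun s => X s ω) t

/-- `Ψ_t = diag(A_t X_{t-}) - diag(X_{t-}) A_t' - A_t diag(X_{t-})`. -/
def Psi {N : ℕ} (A : ℝ≥0 → Matrix (Fin N) (Fin N) ℝ) (X : ℝ≥0 → Ω → (Fin N → ℝ))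
    (t : ℝ≥0) (ω : Ω) : Matrix (Fin N) (Fin N) ℝ :=
  Matrix.diagonal (A t *ᵥ leftX X t ω) - Matrix.diagonal (leftX X t ω) * (A t)ᵀ
    - A t * Matrix.diagonal (leftX X t ω)

/-- The squared semi-norm `‖C‖²_{X_t} = C' Ψ_t C`. -/
def normSq {N : ℕ} (A : ℝ≥0 → Matrix (Fin N) (Fin N) ℝ) (X : ℝ≥0 → Ω → (Fin N → ℝ))
    (t : ℝ≥0) (ω : Ω) (C : Fin N → ℝ) : ℝ :=
  C ⬝ᵥ (Psi A X t ω *ᵥ C)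

/-- The semi-norm `‖C‖_{X_t}`. -/
def seminormX {N : ℕ} (A : ℝ≥0 → Matrix (Fin N) (Fin N) ℝ) (X : ℝ≥0 → Ω → (Fin N → ℝ))
    (t : ℝ≥0) (ω : Ω) (C : Fin N → ℝ) : ℝ :=
  Real.sqrt (normSq A X t ω C)

/-- The integral `∫_a^b Z_s' dM_s` over `(a, b]`, where `M_t = X_t - X_0 - ∫_0^t A_s X_s ds`.
The paths of `X` are right-continuous step functions with finitely many jumps on bounded intervals,
so `M` has paths of finite variation, `dM = dX - A X ds`, the jumps of `M` are those of `X`, and the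
stochastic integral against `M` is the pathwise Lebesgue-Stieltjes integral
`∑_{a < s ≤ b} Z_s' ΔX_s - ∫_a^b Z_s' A_s X_s ds`. -/
def integralM {N : ℕ} (A : ℝ≥0 → Matrix (Fin N) (Fin N) ℝ) (X : ℝ≥0 → Ω → (Fin N → ℝ))
    (Z : ℝ≥0 → Ω → (Fin N → ℝ)) (a b : ℝ≥0) (ω : Ω) : ℝ :=
  (∑ᶠ s ∈ Set.Ioc a b, Z s ω ⬝ᵥ (X s ω - leftX X s ω))
    - ∫ s in Set.Ioc a b, Z s ω ⬝ᵥ (A s *ᵥ X s ω) ∂timeMeasure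

/-- The conditions on the driver `f`: it is `𝓟 × B(ℝ^{1+N})`-measurable (`𝓟` the predictable
σ-algebra), Lipschitz on `[0,T]` with constants `c'` and `c''` with respect to `|·|` and
`‖·‖_{X_t}`, and `E ∫_0^T |f(t,0,0)|² dt < ∞`. -/
structure IsDriver (μ : Measure Ω) {N : ℕ} (A : ℝ≥0 → Matrix (Fin N) (Fin N) ℝ)
    (X : ℝ≥0 → Ω → (Fin N → ℝ)) (hX : ∀ t, Measurable (X t)) (c' c'' : ℝ) (T : ℝ≥0)
    (f : ℝ≥0 → Ω → ℝ → (Fin N → ℝ) → ℝ) : Prop where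
  measurable :
    Measurable[(completedFiltration μ X hX).predictable.prod
      (inferInstance : MeasurableSpace (ℝ × (Fin N → ℝ)))]
      (fun p : (ℝ≥0 × Ω) × (ℝ × (Fin N → ℝ)) => f p.1.1 p.1.2 p.2.1 p.2.2)
  lipschitz : ∀ᵐ ω ∂μ, ∀ t ≤ T, ∀ y₁ y₂ z₁ z₂,
    |f t ω y₁ z₁ - f t ω y₂ z₂| ≤ c' * |y₁ - y₂| + c'' * seminormX A X t ω (z₁ - z₂)
  sq_integrable :
    ∫⁻ ω, ∫⁻ t in Set.Icc 0 T, ‖f t ω 0 0‖ₑ ^ 2 ∂timeMeasure ∂μ < ∞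

/-- `(Y, Z)` is a solution of the BSDE
`Y_t = ξ + ∫_t^T f(s, Y_s, Z_s) ds - ∫_t^T Z_s' dM_s`, `0 ≤ t ≤ T`,
with `Y` adapted, right-continuous with left limits and `E ∫_0^T |Y_s|² ds < ∞`, and `Z`
predictable with `E ∫_0^T ‖Z_s‖²_{X_s} ds < ∞`. Only times in `[0,T]` matter. -/
structure IsBSDESolution (μ : Measure Ω) {N : ℕ} (A : ℝ≥0 → Matrix (Fin N) (Fin N) ℝ)
    (X : ℝ≥0 → Ω → (Fin N → ℝ)) (hX : ∀ t, Measurable (X t)) (T : ℝ≥0) (ξ : Ω → ℝ)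
    (f : ℝ≥0 → Ω → ℝ → (Fin N → ℝ) → ℝ)
    (Y : ℝ≥0 → Ω → ℝ) (Z : ℝ≥0 → Ω → (Fin N → ℝ)) : Prop where
  adapted : ∀ t ≤ T, Measurable[completedFiltration μ X hX t] (Y t)
  right_cont : ∀ᵐ ω ∂μ, ∀ t < T, ContinuousWithinAt (fun s => Y s ω) (Set.Ici t) t
  left_lim : ∀ᵐ ω ∂μ, ∀ t ≤ T, ∃ l, Tendsto (fun s => Y s ω) (𝓝[<] t) (𝓝 l)
  sq_integrable :
    ∫⁻ ω, ∫⁻ s in Set.Icc 0 T, ‖Y s ω‖ₑ ^ 2 ∂timeMeasure ∂μ < ∞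
  predictable : IsStronglyPredictable (completedFiltration μ X hX) Z
  normSq_integrable :
    ∫⁻ ω, ∫⁻ s in Set.Icc 0 T, ENNReal.ofReal (normSq A X s ω (Z s ω)) ∂timeMeasure ∂μ < ∞
  equation : ∀ᵐ ω ∂μ, ∀ t ≤ T,
    Y t ω = ξ ω + ∫ s in Set.Ioc t T, f s ω (Y s ω) (Z s ω) ∂timeMeasure
      - integralM A X Z t T ω

end MarkovBSDE

end

/-! On a subinterval [a, b] of [0, T] let S be the mean of a bound for sup |Y|², q the mean of ∫
‖Z‖² ds, G the mean of (∫ |f(s, Y, Z)| ds)², and Φ the mean of (∫ |f(s, 0, 0)| ds)². Conditioning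
the equation on the past removes the stochastic integral, so |Y_t| ≤ E[|Y_b| + ∫_a^b |f| ds | F_t],
and Doob's L² inequality gives S ≤ 8 (E|Y_b|² + G) (`exists_sq_le_of_doob`). Itô's formula for Y²
gives q ≤ E|Y_b|² + S + G (`lintegral_normSq_le`). The Lipschitz condition and Cauchy-Schwarz give G
≤ 4 (Φ + c'²(b-a)² S + c''²(b-a) q) (`sq_lintegral_driver_le`). If b - a is small in terms of c' and
c'', the terms with S and q are absorbed, and S + q ≤ 136 (E|Y_b|² + Φ)
(`exists_estimate_of_short`). Chaining such intervals backward from T multiplies the bound by a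
fixed factor each time. The number of intervals depends only on c', c'' and T, so neither the
dimension nor the size of the rates enters the constant.

The stochastic calculus rests on one identity: for predictable H ≥ 0, the mean of the sum of H over
the jumps into state j is the mean of ∫ H r_j du, with r_j the jump rate
(`lintegral_sum_jumpTimes`). The Markov property yields the expected number of moves into j observed
along a grid. Refining the grid proves the identity for the rectangles that generate the predictable
σ-algebra, and a π-λ argument extends it. A jump from e_i to e_j changes ∫ Z' dX by Z_j - Z_i, and
‖z‖²_X = ∑_j (z_j - z_i)² A_ji when X_- = e_i (`normSq_eq_sum`). Hence the identity applied to these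
marks makes ∫ Z' dM a martingale (`setIntegral_integralM`), and applied to their squares it gives
the isometry (`lintegral_sum_sq_jumps`).

Itô's formula is needed only for paths with a density and finitely many jumps, where it is a
deterministic identity (`jumpPath_sq`). Doob's inequality comes from a pathwise inequality for
running maxima (`sq_partialSups_le`), applied along grids and transferred to continuous time by
right-continuity and Fatou's lemma. -/

noncomputable section

namespace MarkovBSDE

/-! ### Lebesgue measure on the time axis -/

theorem measurableEmbedding_coe : MeasurableEmbedding ((↑) : ℝ≥0 → ℝ) :=
  MeasurableEmbedding.subtype_coe measurableSet_Ici

theorem timeMeasure_apply (s : Set ℝ≥0) :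
    timeMeasure s = volume (((↑) : ℝ≥0 → ℝ) '' s) :=
  measurableEmbedding_coe.comap_apply _ _

theorem timeMeasure_Ioc (a b : ℝ≥0) : timeMeasure (Set.Ioc a b) = ((b - a : ℝ≥0) : ℝ≥0∞) := by
  have : ((↑) : ℝ≥0 → ℝ) '' Set.Ioc a b = Set.Ioc (a : ℝ) b := by
    ext x
    simp only [Set.mem_image, Set.mem_Ioc]
    constructor
    · rintro ⟨y, hy, rfl⟩
      exact_mod_cast hy
    · rintro ⟨h1, h2⟩
      refine ⟨⟨x, a.2.trans h1.le⟩, ⟨?_, ?_⟩, rfl⟩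
      · exact h1
      · exact h2
  rw [timeMeasure_apply, this, Real.volume_Ioc, ENNReal.ofReal, NNReal.sub_def]

instance : NullSingletonClass timeMeasure where
  measure_singleton x := by
    rw [timeMeasure_apply, Set.image_singleton, Real.volume_singleton]

instance : IsFiniteMeasureOnCompacts timeMeasure where
  lt_top_of_isCompact K hK := by
    rw [timeMeasure_apply]
    exact (hK.image NNReal.continuous_coe).measure_lt_top

instance (a b : ℝ≥0) : IsFiniteMeasure (timeMeasure.restrict (Set.Ioc a b)) :=
  ⟨by rw [Measure.restrict_apply_univ, timeMeasure_Ioc]; exact ENNReal.coe_lt_top⟩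

/-! ### Grids and step functions -/

/-- The `k`-th point of the partition of `[a, b]` into `n + 1` intervals of equal length. -/
def grid (a b : ℝ≥0) (n k : ℕ) : ℝ≥0 := a + k * ((b - a) / (n + 1))

theorem grid_zero (a b : ℝ≥0) (n : ℕ) : grid a b n 0 = a := by simp [grid]

theorem grid_last {a b : ℝ≥0} (hab : a ≤ b) (n : ℕ) : grid a b n (n + 1) = b := by
  unfold grid
  push_cast
  rw [mul_div_cancel₀]
  · exact add_tsub_cancel_of_le hab
  · positivity

theorem grid_succ (a b : ℝ≥0) (n k : ℕ) :
    grid a b n (k + 1) = grid a b n k + (b - a) / (n + 1) := by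
  unfold grid; push_cast; ring

theorem grid_mono (a b : ℝ≥0) (n : ℕ) : Monotone (grid a b n) :=
  monotone_nat_of_le_succ fun k => by rw [grid_succ]; exact le_self_add

theorem le_grid (a b : ℝ≥0) (n k : ℕ) : a ≤ grid a b n k := le_self_add

theorem grid_le {a b : ℝ≥0} (hab : a ≤ b) {n k : ℕ} (hk : k ≤ n + 1) : grid a b n k ≤ b :=
  (grid_mono a b n hk).trans (grid_last hab n).le

theorem tendsto_mesh (a b : ℝ≥0) :
    Tendsto (fun n : ℕ => (b - a) / ((n : ℝ≥0) + 1)) atTop (𝓝 0) := by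
  have h := (tendsto_const_nhds (x := b - a)).mul
    (tendsto_one_div_add_atTop_nhds_zero_nat (𝕜 := ℝ≥0))
  simpa [div_eq_mul_inv] using h

theorem exists_cell {a b : ℝ≥0} (n : ℕ) {u : ℝ≥0} (hu : u ∈ Set.Ioc a b) :
    ∃ k < n + 1, u ∈ Set.Ioc (grid a b n k) (grid a b n (k + 1)) := by
  have h := (grid_mono a b n).biUnion_Ico_Ioc_map_succ 0 (n + 1)
  rw [grid_zero, grid_last (hu.1.le.trans hu.2)] at h
  rw [← h] at hu
  simp only [Set.mem_iUnion, Set.mem_Ico, zero_le, true_and, exists_prop] at hu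
  exact hu

theorem cell_unique {a b : ℝ≥0} {n k l : ℕ} {u : ℝ≥0}
    (hk : u ∈ Set.Ioc (grid a b n k) (grid a b n (k + 1)))
    (hl : u ∈ Set.Ioc (grid a b n l) (grid a b n (l + 1))) : k = l := by
  by_contra h
  exact Set.disjoint_left.1 ((grid_mono a b n).pairwise_disjoint_on_Ioc_succ h) hk hl

/-- The step function with value `c k` on the `k`-th interval of the partition of `(a, b]`. -/
def stepFun (a b : ℝ≥0) (n : ℕ) (c : ℕ → ℝ) (u : ℝ≥0) : ℝ :=
  ∑ k ∈ Finset.range (n + 1),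
    (Set.Ioc (grid a b n k) (grid a b n (k + 1))).indicator (fun _ => c k) u

theorem stepFun_of_mem {a b : ℝ≥0} {n k : ℕ} (c : ℕ → ℝ) {u : ℝ≥0} (hk : k < n + 1)
    (hu : u ∈ Set.Ioc (grid a b n k) (grid a b n (k + 1))) : stepFun a b n c u = c k := by
  unfold stepFun
  rw [Finset.sum_eq_single k]
  · simp [Set.indicator_of_mem hu]
  · intro l _ hl
    exact Set.indicator_of_notMem (fun h => hl (cell_unique h hu)) _
  · intro h
    exact absurd (Finset.mem_range.2 hk) h

/-- The left endpoint of the cell of u lies strictly below u and within one mesh of it, so sampling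
there sees only the left limit. This is how left limits become predictable. -/
theorem tendsto_stepFun_left {a b u : ℝ≥0} {V : ℝ≥0 → ℝ} {l : ℝ} (hu : u ∈ Set.Ioc a b)
    (h : Tendsto V (𝓝[<] u) (𝓝 l)) :
    Tendsto (fun n => stepFun a b n (fun k => V (grid a b n k)) u) atTop (𝓝 l) := by
  choose k hk hmem using fun n => exists_cell n hu
  have heq : (fun n => stepFun a b n (fun k => V (grid a b n k)) u)
      = fun n => V (grid a b n (k n)) := by
    ext n; exact stepFun_of_mem _ (hk n) (hmem n)
  rw [heq]
  refine h.comp (tendsto_nhdsWithin_iff.2 ⟨?_, Eventually.of_forall fun n => (hmem n).1⟩)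
  have hlow : Tendsto (fun n : ℕ => u - (b - a) / ((n : ℝ≥0) + 1)) atTop (𝓝 u) := by
    simpa using tendsto_const_nhds.sub (tendsto_mesh a b)
  refine tendsto_of_tendsto_of_tendsto_of_le_of_le hlow tendsto_const_nhds ?_
    fun n => (hmem n).1.le
  intro n
  simp only [tsub_le_iff_right, ← grid_succ]
  exact (hmem n).2

/-- Right endpoints approach u from the right and never exceed b. Continuity within [u, b] is
therefore enough, and nothing is needed about the path after b. -/
theorem tendsto_stepFun_right {a b u : ℝ≥0} {V : ℝ≥0 → ℝ} (hu : u ∈ Set.Ioc a b)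
    (h : ContinuousWithinAt V (Set.Icc u b) u) :
    Tendsto (fun n => stepFun a b n (fun k => V (grid a b n (k + 1))) u) atTop (𝓝 (V u)) := by
  choose k hk hmem using fun n => exists_cell n hu
  have heq : (fun n => stepFun a b n (fun k => V (grid a b n (k + 1))) u)
      = fun n => V (grid a b n (k n + 1)) := by
    ext n; exact stepFun_of_mem _ (hk n) (hmem n)
  rw [heq]
  refine Tendsto.comp h (tendsto_nhdsWithin_iff.2 ⟨?_, Eventually.of_forall fun n =>
    ⟨(hmem n).2, grid_le (hu.1.le.trans hu.2) (hk n)⟩⟩)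
  have hup : Tendsto (fun n : ℕ => u + (b - a) / ((n : ℝ≥0) + 1)) atTop (𝓝 u) := by
    simpa using tendsto_const_nhds.add (tendsto_mesh a b)
  refine tendsto_of_tendsto_of_tendsto_of_le_of_le tendsto_const_nhds hup
    (fun n => (hmem n).2) ?_
  intro n
  simp only [grid_succ]
  gcongr
  exact (hmem n).1.le

theorem measurable_stepFun (a b : ℝ≥0) (n : ℕ) (c : ℕ → ℝ) : Measurable (stepFun a b n c) :=
  Finset.measurable_sum _ fun _ _ => measurable_const.indicator measurableSet_Ioc

theorem measurable_uncurry_stepFun {Ω : Type*} [MeasurableSpace Ω] (a b : ℝ≥0) (n : ℕ)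
    (c : ℕ → Ω → ℝ) (hc : ∀ k < n + 1, Measurable (c k)) :
    Measurable fun p : ℝ≥0 × Ω => stepFun a b n (fun k => c k p.2) p.1 := by
  refine Finset.measurable_sum _ fun k hk => ?_
  have := ((hc k (Finset.mem_range.1 hk)).comp measurable_snd).indicator
    ((measurableSet_Ioc (a := grid a b n k) (b := grid a b n (k + 1))).preimage
      (measurable_fst (α := ℝ≥0) (β := Ω)))
  exact this

/-- The value used on a cell is known at its left endpoint, so each term lives on predictable
rectangles. -/
theorem measurable_predictable_stepFun {Ω : Type*} [mΩ : MeasurableSpace Ω]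
    (𝓕 : Filtration ℝ≥0 mΩ) {a b : ℝ≥0} (hab : a ≤ b) (n : ℕ) (V : ℝ≥0 → Ω → ℝ)
    (hV : ∀ t ≤ b, Measurable[𝓕 t] (V t)) :
    Measurable[𝓕.predictable] fun p : ℝ≥0 × Ω =>
      stepFun a b n (fun k => V (grid a b n k) p.2) p.1 := by
  refine @Finset.measurable_sum _ _ _ _ _ _ 𝓕.predictable _ _ fun k hk => ?_
  have hk : k < n + 1 := Finset.mem_range.1 hk
  have hS := measurableSet_predictable_Ioc_prod (𝓕 := 𝓕) (grid a b n k) (grid a b n (k + 1))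
    (s := Set.univ) MeasurableSet.univ
  have hrw : (fun p : ℝ≥0 × Ω => (Set.Ioc (grid a b n k) (grid a b n (k + 1))).indicator
      (fun _ => V (grid a b n k) p.2) p.1)
      = (Set.Ioc (grid a b n k) (grid a b n (k + 1)) ×ˢ Set.univ).piecewise
        (fun p : ℝ≥0 × Ω => V (grid a b n k) p.2) (fun _ => 0) := by
    ext p
    simp [Set.indicator, Set.piecewise]
  rw [hrw]
  intro s hs
  rw [Set.piecewise_preimage, Set.ite]
  refine MeasurableSet.union ?_ (MeasurableSet.diff ?_ hS)
  · have := measurableSet_predictable_Ioc_prod (𝓕 := 𝓕) (grid a b n k) (grid a b n (k + 1))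
      (hV (grid a b n k) (grid_le hab hk.le) hs)
    convert this using 1
    ext p
    simp [and_comm]
  · exact @measurable_const _ _ _ 𝓕.predictable _ _ hs


/-! ### Upward jumps of a right-continuous path with values in `{0, 1}` -/

/-- A right-continuous path with left limits and values in `{0, 1}`. -/
structure IsZeroOnePath (x : ℝ≥0 → ℝ) : Prop where
  zero_or_one : ∀ t, x t = 0 ∨ x t = 1
  right_cont : ∀ t, ContinuousWithinAt x (Set.Ici t) t
  left_lim : ∀ t, ∃ l, Tendsto x (𝓝[<] t) (𝓝 l)

/-- The times in `(a, b]` at which the path jumps from `0` to `1`. -/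
def upJumps (x : ℝ≥0 → ℝ) (a b : ℝ≥0) : Set ℝ≥0 :=
  {u | u ∈ Set.Ioc a b ∧ Function.leftLim x u = 0 ∧ x u = 1}

theorem neBot_nhdsLT_of_pos {t : ℝ≥0} (ht : 0 < t) : (𝓝[<] t).NeBot :=
  nhdsLT_neBot_of_exists_lt ⟨0, ht⟩

theorem tendsto_leftLim {E : Type*} [TopologicalSpace E] {x : ℝ≥0 → E}
    (h : ∀ t, ∃ l, Tendsto x (𝓝[<] t) (𝓝 l)) (t : ℝ≥0) :
    Tendsto x (𝓝[<] t) (𝓝 (Function.leftLim x t)) :=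
  tendsto_leftLim_of_tendsto (h t)

namespace IsZeroOnePath

variable {x : ℝ≥0 → ℝ} (hx : IsZeroOnePath x)
include hx

/-- Two values at distance less than 1/2 in {0, 1} coincide, so one-sided limits force the path to
be constant on one-sided neighbourhoods. -/
theorem eq_right (u : ℝ≥0) : ∃ q > u, ∀ s ∈ Set.Ico u q, x s = x u := by
  have h := (hx.right_cont u).eventually (Metric.ball_mem_nhds (x u) (by norm_num : (0:ℝ) < 1/2))
  obtain ⟨q, hq, hsub⟩ := (mem_nhdsGE_iff_exists_Ico_subset (a := u)).1 h
  refine ⟨q, hq, fun s hs => ?_⟩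
  have h2 : dist (x s) (x u) < 1/2 := hsub hs
  rw [Real.dist_eq, abs_lt] at h2
  rcases hx.zero_or_one s with h | h <;> rcases hx.zero_or_one u with h' | h' <;>
    rw [h, h'] at h2 ⊢ <;> norm_num at h2

theorem eq_left {u : ℝ≥0} (hu : 0 < u) :
    ∃ p < u, ∀ s ∈ Set.Ioo p u, x s = Function.leftLim x u := by
  have hlim := tendsto_leftLim hx.left_lim u
  have := neBot_nhdsLT_of_pos hu
  have hmem : Function.leftLim x u ∈ ({0, 1} : Set ℝ) :=
    (Set.toFinite ({0, 1} : Set ℝ)).isClosed.mem_of_tendsto hlim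
      (Eventually.of_forall fun s => by simpa using hx.zero_or_one s)
  have h := hlim.eventually (Metric.ball_mem_nhds _ (by norm_num : (0:ℝ) < 1/2))
  obtain ⟨p, hp, hsub⟩ := (mem_nhdsLT_iff_exists_Ioo_subset' (a := u) hu).1 h
  refine ⟨p, hp, fun s hs => ?_⟩
  have h2 : dist (x s) (Function.leftLim x u) < 1/2 := hsub hs
  rw [Real.dist_eq, abs_lt] at h2
  simp only [Set.mem_insert_iff, Set.mem_singleton_iff] at hmem
  rcases hx.zero_or_one s with h | h <;> rcases hmem with h' | h' <;>
    rw [h, h'] at h2 ⊢ <;> norm_num at h2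

omit hx in
theorem leftLim_of_Ioo {p q u : ℝ≥0} {c : ℝ} (h : ∀ s ∈ Set.Ioo p q, x s = c)
    (hu : u ∈ Set.Ioo p q) : Function.leftLim x u = c := by
  have := neBot_nhdsLT_of_pos (pos_of_gt hu.1)
  refine leftLim_eq_of_tendsto (tendsto_const_nhds.congr' ?_)
  filter_upwards [Ioo_mem_nhdsLT hu.1] with s hs
  exact (h s ⟨hs.1, hs.2.trans hu.2⟩).symm

/-- By compactness it suffices that every point has a neighbourhood in which it is the only possible
jump. The path is constant on each side near the point, which leaves no room for another one. -/
theorem upJumps_finite (a b : ℝ≥0) : (upJumps x a b).Finite := by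
  suffices h : (Set.Icc a b ∩ upJumps x a b).Finite by
    refine h.subset fun u hu => ⟨Set.Ioc_subset_Icc_self hu.1, hu⟩
  refine (isCompact_Icc (a := a) (b := b)).induction_on
    (p := fun K => (K ∩ upJumps x a b).Finite) (by simp)
    (fun s t hst ht => ht.subset (Set.inter_subset_inter_left _ hst))
    (fun s t hs ht => by rw [Set.union_inter_distrib_right]; exact hs.union ht) ?_
  intro u _
  obtain ⟨q, hq, hright⟩ := hx.eq_right u
  have hR : Set.Ioo u q ∩ upJumps x a b = ∅ := by
    ext v
    simp only [Set.mem_inter_iff, Set.mem_empty_iff_false, iff_false, not_and]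
    intro hv hD
    have h1 := leftLim_of_Ioo (c := x u) (p := u) (q := q)
      (fun s hs => hright s ⟨hs.1.le, hs.2⟩) hv
    rw [← hright v ⟨hv.1.le, hv.2⟩, hD.2.1, hD.2.2] at h1
    norm_num at h1
  rcases eq_zero_or_pos u with rfl | hu
  · refine ⟨Set.Iio q, mem_nhdsWithin_of_mem_nhds (Iio_mem_nhds hq), ?_⟩
    refine (Set.finite_singleton (0 : ℝ≥0)).subset ?_
    rintro v ⟨hv, hD⟩
    by_contra h0
    have : v ∈ Set.Ioo 0 q ∩ upJumps x a b := ⟨⟨pos_iff_ne_zero.2 h0, hv⟩, hD⟩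
    rw [hR] at this
    exact this
  · obtain ⟨p, hp, hleft⟩ := hx.eq_left hu
    refine ⟨Set.Ioo p q, mem_nhdsWithin_of_mem_nhds (Ioo_mem_nhds hp hq), ?_⟩
    refine (Set.finite_singleton u).subset ?_
    rintro v ⟨hv, hD⟩
    by_contra h0
    rcases lt_or_gt_of_ne h0 with h | h
    · have h1 := leftLim_of_Ioo hleft ⟨hv.1, h⟩
      rw [← hleft v ⟨hv.1, h⟩, hD.2.1, hD.2.2] at h1
      norm_num at h1
    · have : v ∈ Set.Ioo u q ∩ upJumps x a b := ⟨⟨h, hv.2⟩, hD⟩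
      rw [hR] at this
      exact this

/-- The jump occurs at the supremum of the zeros in [v, w]. The path is 1 there, since otherwise
right constancy would produce later zeros. The left limit is 0, since zeros accumulate from the
left. -/
theorem exists_upJump {v w : ℝ≥0} (hvw : v ≤ w) (hv : x v = 0) (hw : x w = 1) :
    ∃ u ∈ Set.Ioc v w, Function.leftLim x u = 0 ∧ x u = 1 := by
  set S : Set ℝ≥0 := {t | t ∈ Set.Icc v w ∧ x t = 0} with hS
  have hne : S.Nonempty := ⟨v, ⟨le_rfl, hvw⟩, hv⟩
  have hbdd : BddAbove S := ⟨w, fun t ht => ht.1.2⟩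
  have hvu : v ≤ sSup S := le_csSup hbdd ⟨⟨le_rfl, hvw⟩, hv⟩
  have huw : sSup S ≤ w := csSup_le hne fun t ht => ht.1.2
  have hu1 : x (sSup S) = 1 := by
    rcases hx.zero_or_one (sSup S) with h | h
    · exfalso
      have hlt : sSup S < w := lt_of_le_of_ne huw fun he => by rw [he, hw] at h; norm_num at h
      obtain ⟨q, hq, hright⟩ := hx.eq_right (sSup S)
      obtain ⟨t, ht1, ht2⟩ := exists_between (lt_min hq hlt)
      have : t ∈ S := ⟨⟨hvu.trans ht1.le, (ht2.trans_le (min_le_right _ _)).le⟩, by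
        rw [hright t ⟨ht1.le, ht2.trans_le (min_le_left _ _)⟩, h]⟩
      exact absurd (le_csSup hbdd this) (not_le.2 ht1)
    · exact h
  have hvu' : v < sSup S := lt_of_le_of_ne hvu fun he => by
    rw [← he, hv] at hu1; norm_num at hu1
  refine ⟨sSup S, ⟨hvu', huw⟩, ?_, hu1⟩
  obtain ⟨p, hp, hleft⟩ := hx.eq_left (pos_of_gt hvu')
  obtain ⟨t, htS, hpt⟩ := exists_lt_of_lt_csSup hne hp
  have htu : t < sSup S := lt_of_le_of_ne (le_csSup hbdd htS) fun he => by
    rw [← he, htS.2] at hu1; norm_num at hu1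
  rw [← hleft t ⟨hpt, htu⟩, htS.2]

omit hx in
theorem sum_upcrossings_eq_card (h01 : ∀ t, x t = 0 ∨ x t = 1) (g : ℕ → ℝ≥0) (n : ℕ) :
    ∑ k ∈ Finset.range n, ENNReal.ofReal ((1 - x (g k)) * x (g (k + 1)))
      = ((Finset.range n).filter fun k => x (g k) = 0 ∧ x (g (k + 1)) = 1).card := by
  rw [Finset.card_filter]
  push_cast
  refine Finset.sum_congr rfl fun k _ => ?_
  rcases h01 (g k) with h | h <;> rcases h01 (g (k + 1)) with h' | h' <;> simp [h, h']

/-- Every cell that is crossed upward contains an upward jump, and distinct cells are disjoint. -/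
theorem sum_upcrossings_le {a b : ℝ≥0} (hab : a ≤ b) (n : ℕ) :
    ∑ k ∈ Finset.range (n + 1),
        ENNReal.ofReal ((1 - x (grid a b n k)) * x (grid a b n (k + 1)))
      ≤ (upJumps x a b).ncard := by
  rw [sum_upcrossings_eq_card hx.zero_or_one]
  norm_cast
  rw [Set.ncard_eq_toFinset_card _ (hx.upJumps_finite a b)]
  have hex : ∀ k ∈ (Finset.range (n + 1)).filter
      (fun k => x (grid a b n k) = 0 ∧ x (grid a b n (k + 1)) = 1),
      ∃ u ∈ Set.Ioc (grid a b n k) (grid a b n (k + 1)), Function.leftLim x u = 0 ∧ x u = 1 := by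
    intro k hk
    have := (Finset.mem_filter.1 hk).2
    exact hx.exists_upJump (grid_mono a b n k.le_succ) this.1 this.2
  choose! u hu hu' using hex
  refine Finset.card_le_card_of_injOn u ?_ ?_
  · intro k hk
    simp only [Set.Finite.coe_toFinset]
    have hk' := Finset.mem_range.1 (Finset.mem_filter.1 hk).1
    exact ⟨⟨(le_grid a b n k).trans_lt (hu k hk).1,
      (hu k hk).2.trans (grid_le hab (Nat.succ_le_of_lt hk'))⟩, hu' k hk⟩
  · intro k hk l hl hkl
    exact cell_unique (hu k hk) (hkl ▸ hu l hl)

/-- Once the mesh is smaller than the intervals of constancy around the finitely many jumps, each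
jump makes its own cell an upcrossing. Two jumps cannot share a cell, because the path is 0 on the
part of the cell before the later jump and 1 at the earlier one. -/
theorem eventually_le_sum_upcrossings (a b : ℝ≥0) :
    ∀ᶠ n in atTop, ((upJumps x a b).ncard : ℝ≥0∞) ≤ ∑ k ∈ Finset.range (n + 1),
        ENNReal.ofReal ((1 - x (grid a b n k)) * x (grid a b n (k + 1))) := by
  have hfin := hx.upJumps_finite a b
  have hev : ∀ u ∈ upJumps x a b, ∀ᶠ n in atTop, ∀ k,
      u ∈ Set.Ioc (grid a b n k) (grid a b n (k + 1)) →
        x (grid a b n (k + 1)) = 1 ∧ ∀ v ∈ Set.Ico (grid a b n k) u, x v = 0 := by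
    intro u hu
    obtain ⟨q, hq, hright⟩ := hx.eq_right u
    obtain ⟨p, hp, hleft⟩ := hx.eq_left (pos_of_gt hu.1.1)
    rw [hu.2.1] at hleft
    rw [hu.2.2] at hright
    have h1 := (tendsto_mesh a b).eventually (Iio_mem_nhds (tsub_pos_of_lt hq))
    have h2 := (tendsto_mesh a b).eventually (Iio_mem_nhds (tsub_pos_of_lt hp))
    filter_upwards [h1, h2] with n h1 h2 k hk
    have hs := grid_succ a b n k
    have h1' : (b - a) / ((n : ℝ≥0) + 1) < q - u := h1
    have h2' : (b - a) / ((n : ℝ≥0) + 1) < u - p := h2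
    rw [lt_tsub_iff_left] at h1' h2'
    have hpk : p < grid a b n k := by
      have := h2'.trans_le hk.2
      rw [hs] at this
      exact lt_of_add_lt_add_right this
    refine ⟨hright _ ⟨hk.2, ?_⟩, fun v hv => hleft v ⟨hpk.trans_le hv.1, hv.2⟩⟩
    rw [hs]
    exact (add_le_add_left hk.1.le _).trans_lt h1'
  filter_upwards [(Filter.eventually_all_finite hfin).2 hev] with n hn
  rw [sum_upcrossings_eq_card hx.zero_or_one]
  norm_cast
  rw [Set.ncard_eq_toFinset_card _ hfin]
  have hcell : ∀ u ∈ upJumps x a b, ∃ k < n + 1,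
      u ∈ Set.Ioc (grid a b n k) (grid a b n (k + 1)) := fun u hu => exists_cell n hu.1
  choose! k hk hmem using hcell
  refine Finset.card_le_card_of_injOn k ?_ ?_
  · intro u hu
    have hu : u ∈ upJumps x a b := by simpa using hu
    simp only [Finset.coe_filter, Finset.mem_range, Set.mem_ofPred_eq]
    exact ⟨hk u hu, (hn u hu _ (hmem u hu)).2 _ ⟨le_rfl, (hmem u hu).1⟩,
      (hn u hu _ (hmem u hu)).1⟩
  · intro u hu v hv huv
    have hu : u ∈ upJumps x a b := by simpa using hu
    have hv : v ∈ upJumps x a b := by simpa using hv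
    by_contra hne
    rcases lt_or_gt_of_ne hne with h | h
    · have := (hn v hv _ (hmem v hv)).2 u ⟨huv ▸ (hmem u hu).1.le, h⟩
      rw [hu.2.2] at this; norm_num at this
    · have := (hn u hu _ (hmem u hu)).2 v ⟨huv ▸ (hmem v hv).1.le, h⟩
      rw [hv.2.2] at this; norm_num at this

theorem tendsto_sum_upcrossings {a b : ℝ≥0} (hab : a ≤ b) :
    Tendsto (fun n => ∑ k ∈ Finset.range (n + 1),
        ENNReal.ofReal ((1 - x (grid a b n k)) * x (grid a b n (k + 1)))) atTop
      (𝓝 (upJumps x a b).ncard) := by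
  refine tendsto_const_nhds.congr' ?_
  filter_upwards [hx.eventually_le_sum_upcrossings a b] with n hn
  exact le_antisymm hn (hx.sum_upcrossings_le hab n)

end IsZeroOnePath


/-! ### Jointly measurable and predictable versions of processes -/

/-- Sampling at lattice points to the right of t gives jointly measurable approximations, which
converge along every right-continuous path. -/
theorem exists_measurable_uncurry {Ω : Type*} [MeasurableSpace Ω] (V : ℝ≥0 → Ω → ℝ)
    (hV : ∀ t, Measurable (V t)) :
    ∃ g : ℝ≥0 × Ω → ℝ, Measurable g ∧
      ∀ ω, (∀ t, ContinuousWithinAt (fun s => V s ω) (Set.Ici t) t) → ∀ t, g (t, ω) = V t ω := by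
  -- The first point of the lattice of mesh 1/(n+1) strictly to the right of t; it takes countably
  -- many values.
  let q : ℕ → ℝ≥0 → ℝ≥0 := fun n t => ((⌊((n : ℝ≥0) + 1) * t⌋₊ : ℝ≥0) + 1) / ((n : ℝ≥0) + 1)
  have hmeas : ∀ n, Measurable fun p : ℝ≥0 × Ω => V (q n p.1) p.2 := by
    intro n
    have h1 : Measurable fun r : ℕ × Ω => V (((r.1 : ℝ≥0) + 1) / ((n : ℝ≥0) + 1)) r.2 :=
      measurable_from_prod_countable_right fun k => hV (((k : ℝ≥0) + 1) / ((n : ℝ≥0) + 1))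
    have h2 : Measurable fun p : ℝ≥0 × Ω => (⌊((n : ℝ≥0) + 1) * p.1⌋₊, p.2) :=
      (Nat.measurable_floor.comp (measurable_const.mul measurable_fst)).prodMk measurable_snd
    have h3 := h1.comp h2
    simp only [Function.comp_def] at h3
    exact h3
  -- `limUnder` is measurable even where the limit fails to exist, so no exceptional set of paths
  -- has to be removed.
  refine ⟨fun p => limUnder atTop fun n => V (q n p.1) p.2,
    (StronglyMeasurable.limUnder fun n => (hmeas n).stronglyMeasurable).measurable,
    fun ω hω t => ?_⟩
  refine Tendsto.limUnder_eq ((hω t).tendsto.comp (tendsto_nhdsWithin_iff.2 ⟨?_, ?_⟩))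
  · have hup : Tendsto (fun n : ℕ => t + 1 / ((n : ℝ≥0) + 1)) atTop (𝓝 t) := by
      simpa using tendsto_const_nhds.add
        (tendsto_one_div_add_atTop_nhds_zero_nat (𝕜 := ℝ≥0))
    refine tendsto_of_tendsto_of_tendsto_of_le_of_le tendsto_const_nhds hup
      (fun n => ?_) fun n => ?_
    · simp only [q]
      rw [le_div_iff₀ (by positivity), mul_comm]
      exact (Nat.lt_floor_add_one _).le
    · simp only [q]
      rw [div_le_iff₀ (by positivity), add_mul t, one_div,
        inv_mul_cancel₀ (by positivity : (n : ℝ≥0) + 1 ≠ 0), mul_comm t]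
      gcongr
      exact Nat.floor_le (by positivity)
  · refine Eventually.of_forall fun n => ?_
    simp only [q, Set.mem_Ici]
    rw [le_div_iff₀ (by positivity), mul_comm]
    exact (Nat.lt_floor_add_one _).le

theorem exists_predictable_leftLim {Ω : Type*} [mΩ : MeasurableSpace Ω]
    (𝓕 : Filtration ℝ≥0 mΩ) {a b : ℝ≥0} (hab : a ≤ b) (V : ℝ≥0 → Ω → ℝ)
    (hV : ∀ t ≤ b, Measurable[𝓕 t] (V t)) :
    ∃ g : ℝ≥0 × Ω → ℝ, Measurable[𝓕.predictable] g ∧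
      ∀ ω, ∀ u ∈ Set.Ioc a b, ∀ l, Tendsto (fun s => V s ω) (𝓝[<] u) (𝓝 l) → g (u, ω) = l := by
  refine ⟨fun p => limUnder atTop fun n =>
      stepFun a b n (fun k => V (grid a b n k) p.2) p.1, ?_, fun ω u hu l hl =>
      (tendsto_stepFun_left hu hl).limUnder_eq⟩
  exact (@StronglyMeasurable.limUnder _ _ _ 𝓕.predictable _ _ _ _ _ _ _ fun n =>
    (measurable_predictable_stepFun 𝓕 hab n V hV).stronglyMeasurable).measurable

theorem predictable_le {Ω : Type*} [mΩ : MeasurableSpace Ω] (𝓕 : Filtration ℝ≥0 mΩ) :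
    𝓕.predictable ≤ (inferInstance : MeasurableSpace (ℝ≥0 × Ω)) :=
  measurableSpace_le_predictable_of_measurableSet
    (fun _ hA => (measurableSet_singleton _).prod (𝓕.le _ _ hA))
    (fun i _ hA => measurableSet_Ioi.prod (𝓕.le i _ hA))

/-! ### Paths of the chain -/

/-- The rate at which the chain jumps into state `j`. -/
def jumpRate {Ω : Type*} {N : ℕ} (A : ℝ≥0 → Matrix (Fin N) (Fin N) ℝ)
    (X : ℝ≥0 → Ω → (Fin N → ℝ)) (j : Fin N) (t : ℝ≥0) (ω : Ω) : ℝ :=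
  (1 - X t ω j) * (A t *ᵥ X t ω) j

variable {Ω : Type*} [mΩ : MeasurableSpace Ω] {μ : Measure Ω} {N : ℕ}
  {A : ℝ≥0 → Matrix (Fin N) (Fin N) ℝ} {X : ℝ≥0 → Ω → (Fin N → ℝ)} {hX : ∀ t, Measurable (X t)}

theorem measurable_completedFiltration {t u : ℝ≥0} (h : t ≤ u) (j : Fin N) :
    Measurable[completedFiltration μ X hX u] fun ω => X t ω j := by
  have h1 : Measurable[Filtration.natural X (fun t => (hX t).stronglyMeasurable) u] (X t) :=
    ((Filtration.stronglyAdapted_natural fun t => (hX t).stronglyMeasurable) t).measurable.mono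
      ((Filtration.natural X _).mono h) le_rfl
  have h2 : Measurable[completedFiltration μ X hX u] (X t) :=
    h1.mono (le_sup_left (a := Filtration.natural X fun t => (hX t).stronglyMeasurable)
      (b := Filtration.const ℝ≥0 (nullEvents μ) (nullEvents_le μ)) u) le_rfl
  exact (measurable_pi_apply j).comp h2

namespace IsMarkovChain

section
variable (h : IsMarkovChain μ A X hX)
include h

theorem isZeroOnePath (j : Fin N) (ω : Ω) : IsZeroOnePath fun t => X t ω j where
  zero_or_one t := by
    obtain ⟨i, hi⟩ := h.unit t ω
    rw [hi]
    by_cases hij : j = i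
    · subst hij; simp
    · simp [hij]
  right_cont t := (continuous_apply j).continuousAt.comp_continuousWithinAt (h.right_cont ω t)
  left_lim t := by
    obtain ⟨l, hl⟩ := h.left_lim ω t
    exact ⟨l j, (tendsto_pi_nhds.1 hl) j⟩

theorem tendsto_leftX (ω : Ω) (t : ℝ≥0) :
    Tendsto (fun s => X s ω) (𝓝[<] t) (𝓝 (leftX X t ω)) :=
  tendsto_leftLim (h.left_lim ω) t

theorem tendsto_leftX_apply (ω : Ω) (t : ℝ≥0) (j : Fin N) :
    Tendsto (fun s => X s ω j) (𝓝[<] t) (𝓝 (leftX X t ω j)) :=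
  tendsto_pi_nhds.1 (h.tendsto_leftX ω t) j

theorem leftX_apply {t : ℝ≥0} (ht : 0 < t) (ω : Ω) (j : Fin N) :
    leftX X t ω j = Function.leftLim (fun s => X s ω j) t := by
  have := neBot_nhdsLT_of_pos ht
  exact (leftLim_eq_of_tendsto (h.tendsto_leftX_apply ω t j)).symm

theorem leftX_unit {t : ℝ≥0} (ht : 0 < t) (ω : Ω) : ∃ i, leftX X t ω = Pi.single i 1 := by
  have := neBot_nhdsLT_of_pos ht
  have hc : IsClosed (Set.range fun i : Fin N => (Pi.single i 1 : Fin N → ℝ)) :=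
    (Set.finite_range _).isClosed
  obtain ⟨i, hi⟩ := hc.mem_of_tendsto (h.tendsto_leftX ω t)
    (Eventually.of_forall fun s => by
      obtain ⟨i, hi⟩ := h.unit s ω
      exact ⟨i, hi.symm⟩)
  exact ⟨i, hi.symm⟩

/-- A jump of the chain is an upward jump of one of its coordinates. -/
theorem exists_mem_upJumps {a b u : ℝ≥0} {ω : Ω} (hu : u ∈ Set.Ioc a b)
    (hne : leftX X u ω ≠ X u ω) : ∃ j, u ∈ upJumps (fun t => X t ω j) a b := by
  have hpos := pos_of_gt hu.1
  obtain ⟨i, hi⟩ := h.leftX_unit hpos ω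
  obtain ⟨j, hj⟩ := h.unit u ω
  refine ⟨j, hu, ?_, by simp [hj]⟩
  rw [← h.leftX_apply hpos, hi]
  have : j ≠ i := fun he => hne (by rw [hi, hj, he])
  simp [this]

theorem finite_jumps (a b : ℝ≥0) (ω : Ω) : {u ∈ Set.Ioc a b | leftX X u ω ≠ X u ω}.Finite := by
  refine (Set.finite_iUnion fun j => (h.isZeroOnePath j ω).upJumps_finite a b).subset ?_
  rintro u ⟨hu, hne⟩
  exact Set.mem_iUnion.2 (h.exists_mem_upJumps hu hne)

/-- Finitely many jump times form a Lebesgue null set. This permits exchanging X_- and X in every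
time integral, while sums over jumps must keep X_-. -/
theorem ae_leftX_eq (a b : ℝ≥0) (ω : Ω) :
    ∀ᵐ u ∂timeMeasure.restrict (Set.Ioc a b), leftX X u ω = X u ω := by
  rw [ae_restrict_iff' measurableSet_Ioc]
  have := (h.finite_jumps a b ω).measure_zero timeMeasure
  filter_upwards [measure_eq_zero_iff_ae_notMem.1 this] with u hu huab
  by_contra hne
  exact hu ⟨huab, hne⟩

theorem measurable_uncurry (j : Fin N) : Measurable fun p : ℝ≥0 × Ω => X p.1 p.2 j := by
  obtain ⟨g, hg, hgX⟩ := exists_measurable_uncurry (fun t ω => X t ω j)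
    fun t => (measurable_pi_apply j).comp (hX t)
  convert hg using 1
  ext p
  exact (hgX p.2 (h.isZeroOnePath j p.2).right_cont p.1).symm

theorem measurable_mulVec (j : Fin N) :
    Measurable fun p : ℝ≥0 × Ω => (A p.1 *ᵥ X p.1 p.2) j := by
  simp only [Matrix.mulVec, dotProduct]
  exact Finset.measurable_sum _ fun k _ =>
    ((h.rate.measurable j k).comp measurable_fst).mul (h.measurable_uncurry k)

theorem measurable_jumpRate (j : Fin N) :
    Measurable fun p : ℝ≥0 × Ω => jumpRate A X j p.1 p.2 :=
  (measurable_const.sub (h.measurable_uncurry j)).mul (h.measurable_mulVec j)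

theorem exists_bound : ∃ m : ℝ, 0 ≤ m ∧ (∀ t i j, |A t i j| ≤ m) ∧
    (∀ t ω j, |(A t *ᵥ X t ω) j| ≤ m) ∧ ∀ t ω j, |jumpRate A X j t ω| ≤ m := by
  obtain ⟨m, hm⟩ := h.rate.bounded
  have h1 : ∀ t i j, |A t i j| ≤ |m| := fun t i j => (hm t i j).trans (le_abs_self m)
  have h2 : ∀ t ω j, |(A t *ᵥ X t ω) j| ≤ |m| := by
    intro t ω j
    obtain ⟨i, hi⟩ := h.unit t ω
    rw [hi, Matrix.mulVec_single_one]
    exact h1 t j i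
  refine ⟨|m|, abs_nonneg m, h1, h2, fun t ω j => ?_⟩
  unfold jumpRate
  rcases (h.isZeroOnePath j ω).zero_or_one t with h0 | h0 <;> rw [h0]
  · simpa using h2 t ω j
  · simp

/-- The factor 1 - X_j removes the diagonal rate, the only one that may be negative. -/
theorem jumpRate_nonneg (j : Fin N) (t : ℝ≥0) (ω : Ω) : 0 ≤ jumpRate A X j t ω := by
  unfold jumpRate
  obtain ⟨i, hi⟩ := h.unit t ω
  rw [hi, Matrix.mulVec_single_one]
  by_cases hij : j = i
  · subst hij; simp
  · simpa [hij] using h.rate.nonneg t j i hij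

end

/-! ### The Markov property in integrated form -/

section
variable [IsProbabilityMeasure μ] (h : IsMarkovChain μ A X hX)
include h

theorem integrable_apply (t : ℝ≥0) (j : Fin N) : Integrable (fun ω => X t ω j) μ := by
  refine Integrable.of_bound ((measurable_pi_apply j).comp (hX t)).aestronglyMeasurable 1
    (Eventually.of_forall fun ω => ?_)
  rcases (h.isZeroOnePath j ω).zero_or_one t with h0 | h0 <;> simp [h0]

/-- This is the martingale property of M tested on B. By the Markov property the vector E[X_u; B]
equals Φ(v, u) E[X_v; B], so the forward equation for Φ turns into the claim after Fubini. -/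
theorem setIntegral_eq {v w : ℝ≥0} (hvw : v ≤ w) (j : Fin N) {B : Set Ω}
    (hB : MeasurableSet[completedFiltration μ X hX v] B) :
    ∫ ω in B, X w ω j ∂μ = ∫ ω in B, X v ω j ∂μ
      + ∫ ω in B, ∫ u in Set.Ioc v w, (A u *ᵥ X u ω) j ∂timeMeasure ∂μ := by
  obtain ⟨Φ, hΦ, hmarkov⟩ := h.markov
  obtain ⟨m, hm0, hm, hmX, -⟩ := h.exists_bound
  have hle : completedFiltration μ X hX v ≤ mΩ := (completedFiltration μ X hX).le v
  set p : Fin N → ℝ := fun i => ∫ ω in B, X v ω i ∂μ with hp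
  have hstep : ∀ u, v ≤ u → ∀ k, ∫ ω in B, X u ω k ∂μ = ∑ i, Φ v u k i * p i := by
    intro u hu k
    rw [← setIntegral_condExp hle (h.integrable_apply u k) hB,
      setIntegral_congr_ae (g := fun ω => (Φ v u *ᵥ X v ω) k) (hle _ hB)
        ((hmarkov v u hu k).mono fun ω hω _ => hω)]
    simp only [Matrix.mulVec, dotProduct]
    rw [integral_finsetSum _ fun i _ => ((h.integrable_apply v i).integrableOn).const_mul _]
    simp only [integral_const_mul, hp]
  have hΦint : ∀ k i, IntegrableOn (fun u => Φ v u k i) (Set.Ioc v w) timeMeasure := by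
    intro k i
    have hc : ContinuousOn (fun u => Φ v u k i) (Set.Icc v w) :=
      (continuous_apply_apply k i).comp_continuousOn
        ((hΦ.continuousOn v).mono Set.Icc_subset_Ici_self)
    exact (hc.integrableOn_compact isCompact_Icc).mono_set Set.Ioc_subset_Icc_self
  have hAΦ : ∀ j k i, IntegrableOn (fun u => A u j k * Φ v u k i) (Set.Ioc v w) timeMeasure :=
    fun j k i => (hΦint k i).bdd_mul (h.rate.measurable j k).aestronglyMeasurable
      (Eventually.of_forall fun u => by rw [Real.norm_eq_abs]; exact hm u j k)
  rw [hstep w hvw j]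
  have h1 : ∀ i, Φ v w j i = (1 : Matrix (Fin N) (Fin N) ℝ) j i
      + ∫ u in Set.Ioc v w, (A u * Φ v u) j i ∂timeMeasure := fun i => hΦ.forward v w hvw j i
  simp only [h1, add_mul, Finset.sum_add_distrib]
  congr 1
  · simp [Matrix.one_apply, hp]
  · rw [integral_integral_swap]
    · have h2 : ∀ u ∈ Set.Ioc v w, ∫ ω in B, (A u *ᵥ X u ω) j ∂μ
          = ∑ i, (A u * Φ v u) j i * p i := by
        intro u hu
        simp only [Matrix.mulVec, dotProduct, Matrix.mul_apply]
        rw [integral_finsetSum _ fun i _ => ((h.integrable_apply u i).integrableOn).const_mul _]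
        simp only [integral_const_mul, hstep u hu.1.le, Finset.mul_sum, Finset.sum_mul]
        rw [Finset.sum_comm]
        simp only [mul_assoc]
      rw [setIntegral_congr_fun measurableSet_Ioc h2, integral_finsetSum]
      · simp only [integral_mul_const]
      · intro i _
        refine Integrable.mul_const ?_ _
        simp only [Matrix.mul_apply]
        exact integrable_finsetSum _ fun k _ => hAΦ j k i
    · refine Integrable.of_bound ?_ m (Eventually.of_forall fun q => ?_)
      · exact ((h.measurable_mulVec j).comp measurable_swap).aestronglyMeasurable
      · rw [Real.norm_eq_abs]; exact hmX _ _ _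

omit [IsProbabilityMeasure μ] in
theorem measurable_ncard_upJumps {s T : ℝ≥0} (hsT : s ≤ T) (j : Fin N) :
    Measurable fun ω => ((upJumps (fun t => X t ω j) s T).ncard : ℝ≥0∞) := by
  refine measurable_of_tendsto_metrizable (f := fun n ω => ∑ k ∈ Finset.range (n + 1),
    ENNReal.ofReal ((1 - X (grid s T n k) ω j) * X (grid s T n (k + 1)) ω j)) ?_
    (tendsto_pi_nhds.2 fun ω => (h.isZeroOnePath j ω).tendsto_sum_upcrossings hsT)
  intro n
  refine Finset.measurable_sum _ fun k _ => ENNReal.measurable_ofReal.comp ?_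
  exact (measurable_const.sub ((measurable_pi_apply j).comp (hX _))).mul
    ((measurable_pi_apply j).comp (hX _))

/-- The factor 1 - X_v^j is the indicator of an event known at time v, so it can be absorbed into B.
On the smaller event the initial value X_v^j is 0 and only the drift remains. -/
theorem setIntegral_one_sub_mul {v w : ℝ≥0} (hvw : v ≤ w) (j : Fin N) {B : Set Ω}
    (hB : MeasurableSet[completedFiltration μ X hX v] B) :
    ∫ ω in B, (1 - X v ω j) * X w ω j ∂μ
      = ∫ ω in B, (1 - X v ω j) * ∫ u in Set.Ioc v w, (A u *ᵥ X u ω) j ∂timeMeasure ∂μ := by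
  have hS : MeasurableSet[completedFiltration μ X hX v] {ω | X v ω j = 0} :=
    measurable_completedFiltration le_rfl j (measurableSet_singleton 0)
  have hSm : MeasurableSet {ω | X v ω j = 0} := (completedFiltration μ X hX).le v _ hS
  have key : ∀ φ : Ω → ℝ, ∫ ω in B, (1 - X v ω j) * φ ω ∂μ
      = ∫ ω in B ∩ {ω | X v ω j = 0}, φ ω ∂μ := by
    intro φ
    rw [← setIntegral_indicator hSm]
    congr 1
    ext ω
    rcases (h.isZeroOnePath j ω).zero_or_one v with h0 | h0 <;>
      simp [Set.indicator, h0]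
  rw [key, key, h.setIntegral_eq hvw j (hB.inter hS)]
  rw [setIntegral_eq_zero_of_forall_eq_zero fun ω hω => hω.2, zero_add]

omit h [IsProbabilityMeasure μ] in
theorem _root_.MarkovBSDE.setIntegral_stepFun_mul {a b : ℝ≥0} (hab : a ≤ b) (n : ℕ) (c : ℕ → ℝ)
    {φ : ℝ≥0 → ℝ} (hφ : IntegrableOn φ (Set.Ioc a b) timeMeasure) :
    ∫ u in Set.Ioc a b, stepFun a b n c u * φ u ∂timeMeasure
      = ∑ k ∈ Finset.range (n + 1),
        c k * ∫ u in Set.Ioc (grid a b n k) (grid a b n (k + 1)), φ u ∂timeMeasure := by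
  have hrw : ∀ u, stepFun a b n c u * φ u = ∑ k ∈ Finset.range (n + 1),
      (Set.Ioc (grid a b n k) (grid a b n (k + 1))).indicator (fun u => c k * φ u) u := by
    intro u
    rw [stepFun, Finset.sum_mul]
    refine Finset.sum_congr rfl fun k _ => ?_
    by_cases hu : u ∈ Set.Ioc (grid a b n k) (grid a b n (k + 1)) <;>
      simp only [hu, Set.indicator_of_mem, Set.indicator_of_notMem, not_false_eq_true, zero_mul]
  simp only [hrw]
  rw [integral_finsetSum]
  · refine Finset.sum_congr rfl fun k hk => ?_
    rw [setIntegral_indicator measurableSet_Ioc, integral_const_mul, Set.inter_eq_right.2]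
    exact Set.Ioc_subset_Ioc (le_grid a b n k)
      (grid_le hab (Nat.succ_le_of_lt (Finset.mem_range.1 hk)))
  · exact fun k _ => (hφ.const_mul _).indicator measurableSet_Ioc

omit [IsProbabilityMeasure μ] in
theorem integrableOn_mulVec (s T : ℝ≥0) (j : Fin N) (ω : Ω) :
    IntegrableOn (fun u => (A u *ᵥ X u ω) j) (Set.Ioc s T) timeMeasure := by
  obtain ⟨m, hm0, hm, hmX, -⟩ := h.exists_bound
  refine Integrable.of_bound ?_ m (Eventually.of_forall fun u => ?_)
  · exact ((h.measurable_mulVec j).comp measurable_prodMk_right).aestronglyMeasurable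
  · rw [Real.norm_eq_abs]; exact hmX _ _ _

theorem integrable_integral_mulVec (s T : ℝ≥0) (j : Fin N) :
    Integrable (fun ω => ∫ u in Set.Ioc s T, (A u *ᵥ X u ω) j ∂timeMeasure) μ := by
  obtain ⟨m, hm0, hm, hmX, -⟩ := h.exists_bound
  refine Integrable.integral_prod_left (f := fun p : Ω × ℝ≥0 => (A p.2 *ᵥ X p.2 p.1) j) ?_
  refine Integrable.of_bound ?_ m (Eventually.of_forall fun u => ?_)
  · exact ((h.measurable_mulVec j).comp measurable_swap).aestronglyMeasurable
  · rw [Real.norm_eq_abs]; exact hmX _ _ _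

/-- Each cell starts after s, so B is still in the past and `setIntegral_one_sub_mul` applies cell
by cell. The drifts assemble into an integral whose weight 1 - X^j is frozen at left endpoints. -/
theorem setLIntegral_sum_upcrossings {s T : ℝ≥0} (hsT : s ≤ T) (j : Fin N) {B : Set Ω}
    (hB : MeasurableSet[completedFiltration μ X hX s] B) (n : ℕ) :
    ∫⁻ ω in B, ∑ k ∈ Finset.range (n + 1),
        ENNReal.ofReal ((1 - X (grid s T n k) ω j) * X (grid s T n (k + 1)) ω j) ∂μ
      = ENNReal.ofReal (∫ ω in B, ∫ u in Set.Ioc s T,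
          stepFun s T n (fun k => 1 - X (grid s T n k) ω j) u * (A u *ᵥ X u ω) j
            ∂timeMeasure ∂μ) := by
  have hm : ∀ t, Measurable fun ω => X t ω j := fun t => (measurable_pi_apply j).comp (hX t)
  have hb : ∀ t ω, ‖1 - X t ω j‖ ≤ 1 := by
    intro t ω
    rcases (h.isZeroOnePath j ω).zero_or_one t with h0 | h0 <;> simp [h0]
  have h0 : ∀ k ω, 0 ≤ (1 - X (grid s T n k) ω j) * X (grid s T n (k + 1)) ω j := by
    intro k ω
    rcases (h.isZeroOnePath j ω).zero_or_one (grid s T n k) with h0 | h0 <;>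
    rcases (h.isZeroOnePath j ω).zero_or_one (grid s T n (k + 1)) with h1 | h1 <;> simp [h0, h1]
  rw [lintegral_finsetSum (f := fun k ω =>
      ENNReal.ofReal ((1 - X (grid s T n k) ω j) * X (grid s T n (k + 1)) ω j)) _ fun k _ =>
    ENNReal.measurable_ofReal.comp ((measurable_const.sub (hm _)).mul (hm _))]
  have h1 : ∀ k ∈ Finset.range (n + 1), ∫⁻ ω in B,
      ENNReal.ofReal ((1 - X (grid s T n k) ω j) * X (grid s T n (k + 1)) ω j) ∂μ
      = ENNReal.ofReal (∫ ω in B, (1 - X (grid s T n k) ω j) * X (grid s T n (k + 1)) ω j ∂μ) := by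
    intro k _
    rw [ofReal_integral_eq_lintegral_ofReal]
    · exact ((h.integrable_apply _ j).integrableOn).bdd_mul
        (measurable_const.sub (hm _)).aestronglyMeasurable (Eventually.of_forall (hb _))
    · exact Eventually.of_forall (h0 k)
  rw [Finset.sum_congr rfl h1, ← ENNReal.ofReal_sum_of_nonneg fun k _ => integral_nonneg (h0 k)]
  congr 1
  have h2 : ∀ ω, ∫ u in Set.Ioc s T,
      stepFun s T n (fun k => 1 - X (grid s T n k) ω j) u * (A u *ᵥ X u ω) j ∂timeMeasure
      = ∑ k ∈ Finset.range (n + 1), (1 - X (grid s T n k) ω j)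
        * ∫ u in Set.Ioc (grid s T n k) (grid s T n (k + 1)), (A u *ᵥ X u ω) j ∂timeMeasure :=
    fun ω => setIntegral_stepFun_mul hsT n _ (h.integrableOn_mulVec s T j ω)
  simp only [h2]
  rw [integral_finsetSum]
  · refine Finset.sum_congr rfl fun k _ => ?_
    exact h.setIntegral_one_sub_mul (grid_mono s T n k.le_succ) j
      ((completedFiltration μ X hX).mono (le_grid s T n k) _ hB)
  · exact fun k _ => ((h.integrable_integral_mulVec _ _ j).integrableOn).bdd_mul
      (measurable_const.sub (hm _)).aestronglyMeasurable (Eventually.of_forall (hb _))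

omit [IsProbabilityMeasure μ] in
-- The frozen weights converge to 1 - X_-^j, which equals 1 - X^j for almost every time, and the
-- integrands are dominated by the bound on the rates.
theorem tendsto_integral_stepFun_mul (s T : ℝ≥0) (j : Fin N) (ω : Ω) :
    Tendsto (fun n => ∫ u in Set.Ioc s T,
        stepFun s T n (fun k => 1 - X (grid s T n k) ω j) u * (A u *ᵥ X u ω) j ∂timeMeasure)
      atTop (𝓝 (∫ u in Set.Ioc s T, jumpRate A X j u ω ∂timeMeasure)) := by
  obtain ⟨m, hm0, hm, hmX, -⟩ := h.exists_bound
  refine tendsto_integral_of_dominated_convergence (fun _ => m) ?_ (integrable_const m) ?_ ?_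
  · exact fun n => ((measurable_stepFun s T n _).mul
      ((h.measurable_mulVec j).comp measurable_prodMk_right)).aestronglyMeasurable
  · intro n
    filter_upwards [ae_restrict_mem measurableSet_Ioc] with u hu
    obtain ⟨k, hk, hmem⟩ := exists_cell n hu
    rw [stepFun_of_mem _ hk hmem, norm_mul]
    rcases (h.isZeroOnePath j ω).zero_or_one (grid s T n k) with h0 | h0 <;>
      simp [h0, hmX, hm0]
  · filter_upwards [ae_restrict_mem measurableSet_Ioc, h.ae_leftX_eq s T ω] with u hu hleft
    refine Tendsto.mul_const _ ?_
    rw [← hleft]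
    exact tendsto_stepFun_left (V := fun t => 1 - X t ω j) hu
      (tendsto_const_nhds.sub (h.tendsto_leftX_apply ω u j))

/-- No integrable bound for the number of jumps is known in advance, so the two inequalities have
different sources. Fatou's lemma bounds the expected number of jumps by the limit of the expected
upcrossings. Conversely, upcrossings never outnumber jumps. -/
theorem setLIntegral_ncard_upJumps {s T : ℝ≥0} (hsT : s ≤ T) (j : Fin N) {B : Set Ω}
    (hB : MeasurableSet[completedFiltration μ X hX s] B) :
    ∫⁻ ω in B, (upJumps (fun t => X t ω j) s T).ncard ∂μ
      = ∫⁻ ω in B, ∫⁻ u in Set.Ioc s T, ENNReal.ofReal (jumpRate A X j u ω) ∂timeMeasure ∂μ := by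
  obtain ⟨m, hm0, hm, hmX, hmr⟩ := h.exists_bound
  set S : ℕ → Ω → ℝ≥0∞ := fun n ω => ∑ k ∈ Finset.range (n + 1),
    ENNReal.ofReal ((1 - X (grid s T n k) ω j) * X (grid s T n (k + 1)) ω j) with hS
  set I : ℕ → Ω → ℝ := fun n ω => ∫ u in Set.Ioc s T,
    stepFun s T n (fun k => 1 - X (grid s T n k) ω j) u * (A u *ᵥ X u ω) j ∂timeMeasure with hI
  have hXm : ∀ t, Measurable fun ω => X t ω j := fun t => (measurable_pi_apply j).comp (hX t)
  have hStend : ∀ ω, Tendsto (fun n => S n ω) atTop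
      (𝓝 ((upJumps (fun t => X t ω j) s T).ncard : ℝ≥0∞)) :=
    fun ω => (h.isZeroOnePath j ω).tendsto_sum_upcrossings hsT
  have hSm : ∀ n, Measurable (S n) := fun n => Finset.measurable_sum _ fun k _ =>
    ENNReal.measurable_ofReal.comp ((measurable_const.sub (hXm _)).mul (hXm _))
  have hIlim : Tendsto (fun n => ∫ ω in B, I n ω ∂μ) atTop
      (𝓝 (∫ ω in B, ∫ u in Set.Ioc s T, jumpRate A X j u ω ∂timeMeasure ∂μ)) := by
    refine tendsto_integral_of_dominated_convergence
      (fun _ => m * timeMeasure.real (Set.Ioc s T)) (fun n => ?_) (integrable_const _)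
      (fun n => Eventually.of_forall fun ω => ?_)
      (Eventually.of_forall fun ω => h.tendsto_integral_stepFun_mul s T j ω)
    · refine (StronglyMeasurable.integral_prod_right (f := fun (ω : Ω) (u : ℝ≥0) =>
        stepFun s T n (fun k => 1 - X (grid s T n k) ω j) u * (A u *ᵥ X u ω) j)
        ?_).aestronglyMeasurable
      exact (((measurable_uncurry_stepFun s T n _ fun k _ =>
        measurable_const.sub (hXm (grid s T n k))).comp measurable_swap).mul
        ((h.measurable_mulVec j).comp measurable_swap)).stronglyMeasurable
    · refine norm_setIntegral_le_of_norm_le_const ?_ fun u hu => ?_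
      · rw [timeMeasure_Ioc]; exact ENNReal.coe_lt_top
      · obtain ⟨k, hk, hmem⟩ := exists_cell n hu
        rw [stepFun_of_mem _ hk hmem, norm_mul]
        rcases (h.isZeroOnePath j ω).zero_or_one (grid s T n k) with h0 | h0 <;> simp [h0, hmX, hm0]
  have hlim : Tendsto (fun n => ∫⁻ ω in B, S n ω ∂μ) atTop
      (𝓝 (ENNReal.ofReal (∫ ω in B, ∫ u in Set.Ioc s T, jumpRate A X j u ω ∂timeMeasure ∂μ))) := by
    refine ((ENNReal.continuous_ofReal.tendsto _).comp hIlim).congr fun n => ?_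
    exact (h.setLIntegral_sum_upcrossings hsT j hB n).symm
  have hrint : ∀ ω, IntegrableOn (fun u => jumpRate A X j u ω) (Set.Ioc s T) timeMeasure :=
    fun ω => Integrable.of_bound
      ((h.measurable_jumpRate j).comp measurable_prodMk_right).aestronglyMeasurable m
      (Eventually.of_forall fun u => by rw [Real.norm_eq_abs]; exact hmr _ _ _)
  have hout : ENNReal.ofReal (∫ ω in B, ∫ u in Set.Ioc s T, jumpRate A X j u ω ∂timeMeasure ∂μ)
      = ∫⁻ ω in B, ∫⁻ u in Set.Ioc s T, ENNReal.ofReal (jumpRate A X j u ω) ∂timeMeasure ∂μ := by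
    rw [ofReal_integral_eq_lintegral_ofReal]
    · refine lintegral_congr fun ω => ?_
      exact ofReal_integral_eq_lintegral_ofReal (hrint ω)
        (Eventually.of_forall fun u => h.jumpRate_nonneg j u ω)
    · refine (Integrable.integral_prod_left (f := fun p : Ω × ℝ≥0 => jumpRate A X j p.2 p.1)
        ?_).integrableOn
      refine Integrable.of_bound ?_ m (Eventually.of_forall fun u => ?_)
      · exact ((h.measurable_jumpRate j).comp measurable_swap).aestronglyMeasurable
      · rw [Real.norm_eq_abs]; exact hmr _ _ _
    · exact Eventually.of_forall fun ω => integral_nonneg fun u => h.jumpRate_nonneg j u ω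
  rw [← hout]
  refine le_antisymm ?_ ?_
  · calc ∫⁻ ω in B, (upJumps (fun t => X t ω j) s T).ncard ∂μ
        = ∫⁻ ω in B, liminf (fun n => S n ω) atTop ∂μ :=
          lintegral_congr fun ω => (hStend ω).liminf_eq.symm
      _ ≤ liminf (fun n => ∫⁻ ω in B, S n ω ∂μ) atTop := lintegral_liminf_le hSm
      _ = _ := hlim.liminf_eq
  · exact le_of_tendsto hlim (Eventually.of_forall fun n => lintegral_mono fun ω =>
      (h.isZeroOnePath j ω).sum_upcrossings_le hsT n)

end

end IsMarkovChain


/-! ### Random finite sets of times -/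

section RandomFinset

variable {Ω : Type*} [mΩ : MeasurableSpace Ω]

/-- The counting measure on the graph of a random finite set of times. -/
def graphCount (D : Ω → Finset ℝ≥0) (ω : Ω) : Measure (ℝ≥0 × Ω) :=
  (Measure.count.restrict (D ω : Set ℝ≥0)).map fun u => (u, ω)

theorem count_restrict_apply (D : Finset ℝ≥0) {s : Set ℝ≥0} (hs : MeasurableSet s) :
    Measure.count.restrict (D : Set ℝ≥0) s = ((s ∩ D).ncard : ℝ≥0∞) := by
  have hfin : (s ∩ D).Finite := D.finite_toSet.subset Set.inter_subset_right
  rw [Measure.restrict_apply hs, Measure.count_apply_finite _ hfin,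
    Set.ncard_eq_toFinset_card _ hfin]

instance (D : Finset ℝ≥0) : IsFiniteMeasure (Measure.count.restrict (D : Set ℝ≥0)) :=
  ⟨by rw [count_restrict_apply D MeasurableSet.univ]; exact ENNReal.natCast_lt_top _⟩

instance (D : Ω → Finset ℝ≥0) (ω : Ω) : IsFiniteMeasure (graphCount D ω) :=
  inferInstanceAs (IsFiniteMeasure (Measure.map _ _))

theorem lintegral_graphCount (D : Ω → Finset ℝ≥0) (ω : Ω) {H : ℝ≥0 × Ω → ℝ≥0∞}
    (hH : Measurable H) : ∫⁻ p, H p ∂graphCount D ω = ∑ u ∈ D ω, H (u, ω) := by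
  rw [graphCount, lintegral_map hH measurable_prodMk_right, lintegral_finset]
  simp

/-- Counts on half-lines together with the total count determine a finite measure on the time axis
measurably, and rectangles then handle the product; both are π-systems. -/
theorem measurable_graphCount {D : Ω → Finset ℝ≥0}
    (hD : ∀ s, Measurable fun ω => ((Set.Ioi s ∩ (D ω : Set ℝ≥0)).ncard : ℝ≥0∞))
    (hD' : Measurable fun ω => ((D ω).card : ℝ≥0∞)) : Measurable (graphCount D) := by
  have h1 : Measurable fun ω => Measure.count.restrict (D ω : Set ℝ≥0) := by
    refine Measurable.measure_of_isPiSystem (S := Set.range Set.Ioi)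
      (by rw [← borel_eq_generateFrom_Ioi]; exact BorelSpace.measurable_eq) isPiSystem_Ioi ?_ ?_
    · rintro _ ⟨s, rfl⟩
      simp only [count_restrict_apply _ measurableSet_Ioi]
      exact hD s
    · simp only [count_restrict_apply _ MeasurableSet.univ, Set.univ_inter,
        Set.ncard_coe_finset]
      exact hD'
  refine Measurable.measure_of_isPiSystem generateFrom_prod.symm isPiSystem_prod ?_ ?_
  · rintro _ ⟨s, hs, B, hB, rfl⟩
    have hs : MeasurableSet s := hs
    have hB : MeasurableSet B := hB
    have : (fun ω => graphCount D ω (s ×ˢ B))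
        = B.indicator fun ω => Measure.count.restrict (D ω : Set ℝ≥0) s := by
      ext ω
      rw [graphCount, Measure.map_apply measurable_prodMk_right (hs.prod hB)]
      by_cases hω : ω ∈ B
      · simp [hω, Set.mk_preimage_prod_left]
      · simp [hω]
    rw [this]
    exact ((Measure.measurable_coe hs).comp h1).indicator hB
  · have : (fun ω => graphCount D ω Set.univ)
        = fun ω => Measure.count.restrict (D ω : Set ℝ≥0) Set.univ := by
      ext ω
      rw [graphCount, Measure.map_apply measurable_prodMk_right MeasurableSet.univ,
        Set.preimage_univ]
    rw [this]
    exact (Measure.measurable_coe MeasurableSet.univ).comp h1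

theorem measurable_sum_finset {D : Ω → Finset ℝ≥0} (hD : Measurable (graphCount D))
    {H : ℝ≥0 × Ω → ℝ≥0∞} (hH : Measurable H) : Measurable fun ω => ∑ u ∈ D ω, H (u, ω) := by
  simp only [← lintegral_graphCount D _ hH]
  exact (Measure.measurable_lintegral hH).comp hD

end RandomFinset

/-! ### The compensation formula for the jumps of the chain -/

namespace IsMarkovChain

variable {Ω : Type*} [mΩ : MeasurableSpace Ω] {μ : Measure Ω} {N : ℕ}
  {A : ℝ≥0 → Matrix (Fin N) (Fin N) ℝ} {X : ℝ≥0 → Ω → (Fin N → ℝ)} {hX : ∀ t, Measurable (X t)}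

/-- The times in `(0, T]` at which the chain jumps into state `j`. -/
def jumpTimes (h : IsMarkovChain μ A X hX) (T : ℝ≥0) (j : Fin N) (ω : Ω) : Finset ℝ≥0 :=
  ((h.isZeroOnePath j ω).upJumps_finite 0 T).toFinset

section

variable (h : IsMarkovChain μ A X hX) (T : ℝ≥0) (j : Fin N)

theorem coe_jumpTimes (ω : Ω) :
    (h.jumpTimes T j ω : Set ℝ≥0) = upJumps (fun t => X t ω j) 0 T := by
  simp [jumpTimes]

theorem mem_jumpTimes {ω : Ω} {u : ℝ≥0} :
    u ∈ h.jumpTimes T j ω ↔ u ∈ upJumps (fun t => X t ω j) 0 T := by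
  simp [jumpTimes]

theorem Ioi_inter_upJumps (x : ℝ≥0 → ℝ) (s : ℝ≥0) :
    Set.Ioi s ∩ upJumps x 0 T = upJumps x s T := by
  ext u
  constructor
  · rintro ⟨hs, hu, h'⟩
    exact ⟨⟨hs, hu.2⟩, h'⟩
  · rintro ⟨hu, h'⟩
    exact ⟨hu.1, ⟨pos_of_gt hu.1, hu.2⟩, h'⟩

theorem upJumps_of_lt (x : ℝ≥0 → ℝ) {s : ℝ≥0} (hs : T < s) : upJumps x s T = ∅ := by
  ext u
  simp only [Set.mem_empty_iff_false, iff_false]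
  rintro ⟨hu, -⟩
  exact absurd (hu.1.trans_le hu.2) hs.not_gt

theorem measurable_graphCount_jumpTimes : Measurable (graphCount (h.jumpTimes T j)) := by
  have h1 : ∀ s, Measurable fun ω => ((Set.Ioi s ∩ (h.jumpTimes T j ω : Set ℝ≥0)).ncard : ℝ≥0∞) := by
    intro s
    simp only [coe_jumpTimes, Ioi_inter_upJumps]
    rcases le_or_gt s T with hs | hs
    · exact h.measurable_ncard_upJumps hs j
    · simp only [upJumps_of_lt T _ hs, Set.ncard_empty]
      exact measurable_const
  refine measurable_graphCount h1 ?_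
  simp only [← Set.ncard_coe_finset, coe_jumpTimes]
  exact h.measurable_ncard_upJumps zero_le j

variable [IsProbabilityMeasure μ]

/-- The jump measure of the chain and its compensator agree on predictable processes. -/
theorem lintegral_sum_jumpTimes {H : ℝ≥0 × Ω → ℝ≥0∞}
    (hH : Measurable[(completedFiltration μ X hX).predictable] H) :
    ∫⁻ ω, ∑ u ∈ h.jumpTimes T j ω, H (u, ω) ∂μ
      = ∫⁻ ω, ∫⁻ u in Set.Ioc 0 T, H (u, ω) * ENNReal.ofReal (jumpRate A X j u ω)
          ∂timeMeasure ∂μ := by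
  obtain ⟨m, hm0, -, -, hmr⟩ := h.exists_bound
  have hle : (completedFiltration μ X hX).predictable
      ≤ (inferInstance : MeasurableSpace (ℝ≥0 × Ω)) := predictable_le _
  have hr : Measurable fun p : ℝ≥0 × Ω => ENNReal.ofReal (jumpRate A X j p.1 p.2) :=
    ENNReal.measurable_ofReal.comp (h.measurable_jumpRate j)
  -- ν is the expected counting measure of the jumps into j and ρ its candidate compensator. They
  -- are compared only on the predictable σ-algebra.
  set ν : Measure (ℝ≥0 × Ω) := μ.bind (graphCount (h.jumpTimes T j)) with hν
  set ρ : Measure (ℝ≥0 × Ω) := ((timeMeasure.restrict (Set.Ioc 0 T)).prod μ).withDensity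
    fun p => ENNReal.ofReal (jumpRate A X j p.1 p.2) with hρ
  have hνint : ∀ {G : ℝ≥0 × Ω → ℝ≥0∞}, Measurable G →
      ∫⁻ p, G p ∂ν = ∫⁻ ω, ∑ u ∈ h.jumpTimes T j ω, G (u, ω) ∂μ := by
    intro G hG
    rw [hν, Measure.lintegral_bind (h.measurable_graphCount_jumpTimes T j).aemeasurable
      hG.aemeasurable]
    simp only [lintegral_graphCount _ _ hG]
  have hρint : ∀ {G : ℝ≥0 × Ω → ℝ≥0∞}, Measurable G →
      ∫⁻ p, G p ∂ρ = ∫⁻ ω, ∫⁻ u in Set.Ioc 0 T, G (u, ω) * ENNReal.ofReal (jumpRate A X j u ω)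
          ∂timeMeasure ∂μ := by
    intro G hG
    rw [hρ, lintegral_withDensity_eq_lintegral_mul _ hr hG, lintegral_prod_symm' _ (hr.mul hG)]
    simp only [Pi.mul_apply, mul_comm]
  have hIoi : ∀ (s : ℝ≥0) (B : Set Ω), MeasurableSet[completedFiltration μ X hX s] B →
      ν (Set.Ioi s ×ˢ B) = ρ (Set.Ioi s ×ˢ B) := by
    intro s B hB
    have hBm : MeasurableSet B := (completedFiltration μ X hX).le s _ hB
    have hS : MeasurableSet (Set.Ioi s ×ˢ B) := measurableSet_Ioi.prod hBm
    rw [← lintegral_indicator_one hS, ← lintegral_indicator_one hS,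
      hνint (measurable_one.indicator hS), hρint (measurable_one.indicator hS)]
    have e1 : ∀ ω, ∑ u ∈ h.jumpTimes T j ω, (Set.Ioi s ×ˢ B).indicator (1 : ℝ≥0 × Ω → ℝ≥0∞) (u, ω)
        = B.indicator (fun ω => ((upJumps (fun t => X t ω j) s T).ncard : ℝ≥0∞)) ω := by
      intro ω
      by_cases hω : ω ∈ B
      · rw [Set.indicator_of_mem hω, ← Ioi_inter_upJumps, ← h.coe_jumpTimes,
          ← count_restrict_apply _ measurableSet_Ioi, ← lintegral_indicator_one measurableSet_Ioi,
          lintegral_finset]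
        refine Finset.sum_congr rfl fun u _ => ?_
        by_cases hu : s < u <;> simp [Set.indicator, hω, hu]
      · rw [Set.indicator_of_notMem hω]
        exact Finset.sum_eq_zero fun u _ => by simp [Set.indicator, hω]
    have e2 : ∀ ω, ∫⁻ u in Set.Ioc 0 T, (Set.Ioi s ×ˢ B).indicator (1 : ℝ≥0 × Ω → ℝ≥0∞) (u, ω)
          * ENNReal.ofReal (jumpRate A X j u ω) ∂timeMeasure
        = B.indicator (fun ω => ∫⁻ u in Set.Ioc s T, ENNReal.ofReal (jumpRate A X j u ω)
          ∂timeMeasure) ω := by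
      intro ω
      by_cases hω : ω ∈ B
      · rw [Set.indicator_of_mem hω]
        have : Set.Ioc s T = Set.Ioi s ∩ Set.Ioc 0 T := by
          ext u
          simp only [Set.mem_Ioc, Set.mem_inter_iff, Set.mem_Ioi]
          exact ⟨fun hu => ⟨hu.1, pos_of_gt hu.1, hu.2⟩, fun hu => ⟨hu.1, hu.2.2⟩⟩
        rw [this, ← Measure.restrict_restrict measurableSet_Ioi,
          ← lintegral_indicator measurableSet_Ioi]
        refine lintegral_congr fun u => ?_
        by_cases hu : s < u <;> simp [Set.indicator, hω, hu]
      · rw [Set.indicator_of_notMem hω]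
        simp [Set.indicator, hω]
    simp only [e1, e2]
    rw [lintegral_indicator hBm, lintegral_indicator hBm]
    rcases le_or_gt s T with hs | hs
    · exact h.setLIntegral_ncard_upJumps hs j hB
    · simp [upJumps_of_lt T _ hs, Set.Ioc_eq_empty hs.not_gt]
  -- The remaining generators sit at time 0, where neither measure has mass: both only see times in
  -- (0, T].
  have hbot : ∀ B : Set Ω, MeasurableSet B →
      ν ({⊥} ×ˢ B) = 0 ∧ ρ ({⊥} ×ˢ B) = 0 := by
    intro B hB
    have hS : MeasurableSet (({⊥} : Set ℝ≥0) ×ˢ B) := (measurableSet_singleton _).prod hB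
    rw [← lintegral_indicator_one hS, ← lintegral_indicator_one hS,
      hνint (measurable_one.indicator hS), hρint (measurable_one.indicator hS)]
    constructor
    · refine (lintegral_congr fun ω => Finset.sum_eq_zero fun u hu => ?_).trans lintegral_zero
      have hu0 : u ≠ 0 := (pos_of_gt ((h.mem_jumpTimes T j).1 hu).1.1).ne'
      simp [Set.indicator, hu0]
    · refine (lintegral_congr fun ω => ?_).trans lintegral_zero
      rw [← lintegral_zero (μ := timeMeasure.restrict (Set.Ioc 0 T))]
      refine setLIntegral_congr_fun measurableSet_Ioc fun u hu => ?_
      simp [Set.indicator, hu.1.ne']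
  have huniv : (Set.univ : Set (ℝ≥0 × Ω)) = {⊥} ×ˢ Set.univ ∪ Set.Ioi ⊥ ×ˢ Set.univ := by
    ext p
    simp [← Set.union_prod]
  have hdisj : Disjoint (({⊥} : Set ℝ≥0) ×ˢ (Set.univ : Set Ω)) (Set.Ioi ⊥ ×ˢ Set.univ) := by
    rw [Set.disjoint_left]
    rintro p ⟨hp, -⟩ ⟨hp', -⟩
    rw [Set.mem_singleton_iff] at hp
    exact absurd hp' (by simp [hp])
  have hU : ν Set.univ = ρ Set.univ := by
    rw [huniv, measure_union hdisj (measurableSet_Ioi.prod MeasurableSet.univ),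
      measure_union hdisj (measurableSet_Ioi.prod MeasurableSet.univ),
      (hbot _ MeasurableSet.univ).1, (hbot _ MeasurableSet.univ).2,
      hIoi _ _ MeasurableSet.univ]
  have hfin : ρ Set.univ < ∞ := by
    rw [hρ, withDensity_apply _ MeasurableSet.univ, Measure.restrict_univ]
    calc _ ≤ ∫⁻ _, ENNReal.ofReal m ∂((timeMeasure.restrict (Set.Ioc 0 T)).prod μ) :=
          lintegral_mono fun p => ENNReal.ofReal_le_ofReal ((le_abs_self _).trans (hmr _ _ _))
      _ < ∞ := by
          rw [lintegral_const]
          exact ENNReal.mul_lt_top ENNReal.ofReal_lt_top (measure_lt_top _ _)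
  -- The generators form a π-system and the total masses agree and are finite, since the rates are
  -- bounded. Hence the traces on the predictable σ-algebra coincide.
  have htrim : ν.trim hle = ρ.trim hle := by
    have : IsFiniteMeasure (ν.trim hle) :=
      ⟨by rw [trim_measurableSet_eq hle MeasurableSet.univ, hU]; exact hfin⟩
    refine @ext_of_generate_finite _ (completedFiltration μ X hX).predictable (ν.trim hle) (ρ.trim hle)
      ({s | ∃ B, MeasurableSet[completedFiltration μ X hX ⊥] B ∧ s = {⊥} ×ˢ B} ∪
       {s | ∃ i B, MeasurableSet[completedFiltration μ X hX i] B ∧ s = Set.Ioi i ×ˢ B})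
      rfl ?_ this ?_ ?_
    · rintro _ (⟨B, hB, rfl⟩ | ⟨i, B, hB, rfl⟩) _ (⟨B', hB', rfl⟩ | ⟨i', B', hB', rfl⟩) hne
      · exact Or.inl ⟨B ∩ B', hB.inter hB', by rw [Set.prod_inter_prod, Set.inter_self]⟩
      · obtain ⟨p, ⟨hp, -⟩, hp', -⟩ := hne
        rw [Set.mem_singleton_iff] at hp
        exact absurd hp' (by simp [hp])
      · obtain ⟨p, ⟨hp', -⟩, hp, -⟩ := hne
        rw [Set.mem_singleton_iff] at hp
        exact absurd hp' (by simp [hp])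
      · refine Or.inr ⟨i ⊔ i', B ∩ B', ?_, by rw [Set.prod_inter_prod, Set.Ioi_inter_Ioi]⟩
        exact ((completedFiltration μ X hX).mono le_sup_left _ hB).inter
          ((completedFiltration μ X hX).mono le_sup_right _ hB')
    · rintro _ (⟨B, hB, rfl⟩ | ⟨i, B, hB, rfl⟩)
      · have hBm := (completedFiltration μ X hX).le _ _ hB
        rw [trim_measurableSet_eq hle (measurableSet_predictable_singleton_bot_prod hB),
          trim_measurableSet_eq hle (measurableSet_predictable_singleton_bot_prod hB),
          (hbot B hBm).1, (hbot B hBm).2]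
      · rw [trim_measurableSet_eq hle (measurableSet_predictable_Ioi_prod hB),
          trim_measurableSet_eq hle (measurableSet_predictable_Ioi_prod hB), hIoi i B hB]
    · rw [trim_measurableSet_eq hle MeasurableSet.univ,
        trim_measurableSet_eq hle MeasurableSet.univ, hU]
  rw [← hνint (hH.mono hle le_rfl), ← hρint (hH.mono hle le_rfl), ← lintegral_trim hle hH, htrim,
    lintegral_trim hle hH]

/-- Compensated sums over the jumps into `j` of an integrable predictable process have mean zero. -/
theorem integral_compensated_jumpTimes {H : ℝ≥0 × Ω → ℝ}
    (hH : Measurable[(completedFiltration μ X hX).predictable] H)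
    (hfin : ∫⁻ ω, ∫⁻ u in Set.Ioc 0 T, ENNReal.ofReal |H (u, ω)| *
      ENNReal.ofReal (jumpRate A X j u ω) ∂timeMeasure ∂μ < ∞) :
    (∀ᵐ ω ∂μ, IntegrableOn (fun u => H (u, ω) * jumpRate A X j u ω) (Set.Ioc 0 T) timeMeasure) ∧
    Integrable (fun ω => ∑ u ∈ h.jumpTimes T j ω, H (u, ω)
      - ∫ u in Set.Ioc 0 T, H (u, ω) * jumpRate A X j u ω ∂timeMeasure) μ ∧
    ∫ ω, (∑ u ∈ h.jumpTimes T j ω, H (u, ω)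
      - ∫ u in Set.Ioc 0 T, H (u, ω) * jumpRate A X j u ω ∂timeMeasure) ∂μ = 0 := by
  have hle : (completedFiltration μ X hX).predictable
      ≤ (inferInstance : MeasurableSpace (ℝ≥0 × Ω)) := predictable_le _
  have hHm : Measurable H := hH.mono hle le_rfl
  have hrm := h.measurable_jumpRate j
  have hr0 := h.jumpRate_nonneg j
  have hof : ∀ a u ω, ENNReal.ofReal a * ENNReal.ofReal (jumpRate A X j u ω)
      = ENNReal.ofReal (a * jumpRate A X j u ω) := fun a u ω =>
    (ENNReal.ofReal_mul' (hr0 u ω)).symm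
  -- Since `ENNReal.ofReal` truncates at 0, taking K = H and K = -H produces the positive and
  -- negative parts of H. The choice K = |H| gives integrability in time.
  set G : (ℝ≥0 × Ω → ℝ) → Ω → ℝ≥0∞ := fun K ω =>
    ∑ u ∈ h.jumpTimes T j ω, ENNReal.ofReal (K (u, ω)) with hG
  set R : (ℝ≥0 × Ω → ℝ) → Ω → ℝ≥0∞ := fun K ω => ∫⁻ u in Set.Ioc 0 T,
    ENNReal.ofReal (K (u, ω)) * ENNReal.ofReal (jumpRate A X j u ω) ∂timeMeasure with hR
  have hGR : ∀ K : ℝ≥0 × Ω → ℝ, Measurable[(completedFiltration μ X hX).predictable] K →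
      (∀ p, K p ≤ |H p|) → Measurable (G K) ∧ Measurable (R K) ∧
        ∫⁻ ω, G K ω ∂μ = ∫⁻ ω, R K ω ∂μ ∧ ∫⁻ ω, R K ω ∂μ ≠ ∞ := by
    intro K hK hKH
    have hKo : Measurable[(completedFiltration μ X hX).predictable]
      fun p => ENNReal.ofReal (K p) := ENNReal.measurable_ofReal.comp hK
    refine ⟨measurable_sum_finset (h.measurable_graphCount_jumpTimes T j) (hKo.mono hle le_rfl),
      ?_, h.lintegral_sum_jumpTimes T j hKo, ?_⟩
    · refine Measurable.lintegral_prod_right (f := fun (ω : Ω) (u : ℝ≥0) =>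
        ENNReal.ofReal (K (u, ω)) * ENNReal.ofReal (jumpRate A X j u ω)) ?_
      exact ((hKo.mono hle le_rfl).comp measurable_swap).mul
        ((ENNReal.measurable_ofReal.comp hrm).comp measurable_swap)
    · refine ne_top_of_le_ne_top hfin.ne (lintegral_mono fun ω => lintegral_mono fun u => ?_)
      gcongr
      exact hKH _
  obtain ⟨hGp, hRp, hep, hfp⟩ := hGR H hH fun p => le_abs_self _
  obtain ⟨hGn, hRn, hen, hfn⟩ := hGR (fun p => -H p) hH.neg fun p => neg_le_abs _
  obtain ⟨-, hRa, -, hfa⟩ := hGR (fun p => |H p|) (measurable_norm.comp hH) fun p => le_rfl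
  have hint : ∀ᵐ ω ∂μ, IntegrableOn (fun u => H (u, ω) * jumpRate A X j u ω)
      (Set.Ioc 0 T) timeMeasure := by
    filter_upwards [ae_lt_top hRa hfa] with ω hω
    refine ⟨((hHm.comp measurable_prodMk_right).mul
      (hrm.comp measurable_prodMk_right)).aestronglyMeasurable, ?_⟩
    rw [hasFiniteIntegral_iff_norm]
    refine lt_of_eq_of_lt (lintegral_congr fun u => ?_) hω
    rw [norm_mul, Real.norm_eq_abs, Real.norm_eq_abs, abs_of_nonneg (hr0 u ω), hof]
  have hsum : ∀ ω, ∑ u ∈ h.jumpTimes T j ω, H (u, ω)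
      = (G H ω).toReal - (G (fun p => -H p) ω).toReal := by
    intro ω
    simp only [hG]
    rw [ENNReal.toReal_sum fun _ _ => ENNReal.ofReal_ne_top,
      ENNReal.toReal_sum fun _ _ => ENNReal.ofReal_ne_top, ← Finset.sum_sub_distrib]
    refine Finset.sum_congr rfl fun u _ => ?_
    simp only [ENNReal.toReal_ofReal', max_zero_sub_max_neg_zero_eq_self]
  have hdiff : (fun ω => ∑ u ∈ h.jumpTimes T j ω, H (u, ω)
      - ∫ u in Set.Ioc 0 T, H (u, ω) * jumpRate A X j u ω ∂timeMeasure)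
      =ᵐ[μ] fun ω => ((G H ω).toReal - (G (fun p => -H p) ω).toReal)
        - ((R H ω).toReal - (R (fun p => -H p) ω).toReal) := by
    filter_upwards [hint] with ω hω
    rw [hsum, integral_eq_lintegral_pos_part_sub_lintegral_neg_part hω]
    simp only [hR, hof, neg_mul]
  have iGp := integrable_toReal_of_lintegral_ne_top hGp.aemeasurable (hep ▸ hfp)
  have iGn := integrable_toReal_of_lintegral_ne_top hGn.aemeasurable (hen ▸ hfn)
  have iRp := integrable_toReal_of_lintegral_ne_top hRp.aemeasurable hfp
  have iRn := integrable_toReal_of_lintegral_ne_top hRn.aemeasurable hfn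
  refine ⟨hint, ((iGp.sub iGn).sub (iRp.sub iRn)).congr hdiff.symm, ?_⟩
  have e1 := integral_sub (iGp.sub iGn) (iRp.sub iRn)
  simp only [Pi.sub_apply] at e1
  rw [integral_congr_ae hdiff, e1, integral_sub iGp iGn, integral_sub iRp iRn, integral_toReal hGp.aemeasurable (ae_lt_top hGp (hep ▸ hfp)),
    integral_toReal hGn.aemeasurable (ae_lt_top hGn (hen ▸ hfn)),
    integral_toReal hRp.aemeasurable (ae_lt_top hRp hfp),
    integral_toReal hRn.aemeasurable (ae_lt_top hRn hfn), hep, hen, sub_self]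

end

end IsMarkovChain


namespace IsMarkovChain

variable {Ω : Type*} [mΩ : MeasurableSpace Ω] {μ : Measure Ω} {N : ℕ}
  {A : ℝ≥0 → Matrix (Fin N) (Fin N) ℝ} {X : ℝ≥0 → Ω → (Fin N → ℝ)} {hX : ∀ t, Measurable (X t)}

/-! ### Integrands seen by the individual jumps -/

/-- The jump of `∫ z' dX` at time `t` if the chain jumps into state `j`. -/
def jumpMark (X : ℝ≥0 → Ω → (Fin N → ℝ)) (j : Fin N) (t : ℝ≥0) (ω : Ω) (z : Fin N → ℝ) : ℝ :=
  z j - z ⬝ᵥ leftX X t ω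

/-- All jump times of the chain in `(a, b]`. -/
def allJumps (h : IsMarkovChain μ A X hX) (a b : ℝ≥0) (ω : Ω) : Finset ℝ≥0 :=
  (Finset.univ.biUnion fun j => h.jumpTimes b j ω).filter fun u => a < u

variable (h : IsMarkovChain μ A X hX)
include h

omit h in
-- The term of the current state vanishes on both sides: on the left by the factor 1 - 1, on the
-- right because φ 0 = 0.
theorem sum_mul_of_single (t : ℝ≥0) (i : Fin N) (z : Fin N → ℝ) (φ : ℝ → ℝ) (hφ : φ 0 = 0) :
    ∑ j, φ (z j - z ⬝ᵥ Pi.single i 1) * ((1 - (Pi.single i 1 : Fin N → ℝ) j)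
      * (A t *ᵥ (Pi.single i 1 : Fin N → ℝ)) j) = ∑ j, φ (z j - z i) * A t j i := by
  refine Finset.sum_congr rfl fun j _ => ?_
  rw [dotProduct_single_one, Matrix.mulVec_single_one]
  by_cases hij : j = i
  · subst hij; simp [hφ]
  · simp [hij]

/-- With X_- = e_i the quadratic form is ∑_j z_j² A_ji - 2 z_i ∑_j z_j A_ji. Because the column sums
to zero, z_i² ∑_j A_ji may be added to complete the squares. This exhibits ‖z‖² as the rate of the
squared jumps of ∫ z' dX. -/
theorem normSq_eq_sum {t : ℝ≥0} {ω : Ω} (ht : 0 < t) (hl : leftX X t ω = X t ω) (z : Fin N → ℝ) :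
    normSq A X t ω z = ∑ j, jumpMark X j t ω z ^ 2 * jumpRate A X j t ω := by
  obtain ⟨i, hi⟩ := h.leftX_unit ht ω
  simp only [jumpMark, jumpRate, ← hl, hi]
  rw [sum_mul_of_single t i z (fun x => x ^ 2) (by norm_num)]
  unfold normSq Psi
  rw [hi]
  have hcol := h.rate.col_sum t i
  simp only [Matrix.sub_mulVec, dotProduct_sub, ← Matrix.mulVec_mulVec, Matrix.mulVec_single_one]
  have e1 : z ⬝ᵥ Matrix.diagonal ((A t).col i) *ᵥ z = ∑ j, z j ^ 2 * A t j i := by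
    simp only [dotProduct, Matrix.mulVec_diagonal, Matrix.col_apply]
    exact Finset.sum_congr rfl fun j _ => by ring
  have hdiag : ∀ w : Fin N → ℝ, Matrix.diagonal (Pi.single i 1 : Fin N → ℝ) *ᵥ w
      = Pi.single i (w i) := by
    intro w
    ext k
    rw [Matrix.mulVec_diagonal]
    by_cases hk : k = i
    · subst hk; simp
    · simp [hk]
  have e2 : z ⬝ᵥ Matrix.diagonal (Pi.single i 1 : Fin N → ℝ) *ᵥ (A t)ᵀ *ᵥ z
      = z i * ∑ j, z j * A t j i := by
    rw [hdiag, dotProduct_single]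
    simp [Matrix.mulVec, dotProduct, mul_comm]
  have e3 : z ⬝ᵥ A t *ᵥ Matrix.diagonal (Pi.single i 1 : Fin N → ℝ) *ᵥ z
      = z i * ∑ j, z j * A t j i := by
    rw [hdiag, Matrix.mulVec_single]
    simp only [dotProduct, Finset.mul_sum]
    exact Finset.sum_congr rfl fun j _ => by simp [Matrix.col_apply]; ring
  rw [e1, e2, e3]
  have : ∀ j, (z j - z i) ^ 2 * A t j i
      = z j ^ 2 * A t j i - 2 * z i * (z j * A t j i) + z i ^ 2 * A t j i := fun j => by ring
  simp only [this, Finset.sum_add_distrib, Finset.sum_sub_distrib, ← Finset.mul_sum, hcol]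
  ring

/-- Again the zero column sum allows z_j to be replaced by z_j - z_i: the drift of ∫ z' dX is the
rate of its jumps. -/
theorem dotProduct_mulVec_eq_sum {t : ℝ≥0} {ω : Ω} (ht : 0 < t) (hl : leftX X t ω = X t ω)
    (z : Fin N → ℝ) :
    z ⬝ᵥ (A t *ᵥ X t ω) = ∑ j, jumpMark X j t ω z * jumpRate A X j t ω := by
  obtain ⟨i, hi⟩ := h.leftX_unit ht ω
  simp only [jumpMark, jumpRate, ← hl, hi]
  rw [sum_mul_of_single t i z (fun x => x) rfl, Matrix.mulVec_single_one]
  have hcol := h.rate.col_sum t i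
  simp only [sub_mul, Finset.sum_sub_distrib, ← Finset.mul_sum, hcol]
  simp [dotProduct]

theorem mem_allJumps {a b u : ℝ≥0} {ω : Ω} :
    u ∈ h.allJumps a b ω ↔ u ∈ Set.Ioc a b ∧ leftX X u ω ≠ X u ω := by
  simp only [allJumps, Finset.mem_filter, Finset.mem_biUnion, Finset.mem_univ, true_and,
    mem_jumpTimes]
  constructor
  · rintro ⟨⟨j, hu, hl, hr⟩, hau⟩
    refine ⟨⟨hau, hu.2⟩, fun he => ?_⟩
    beta_reduce at hr
    rw [← h.leftX_apply hu.1, he, hr] at hl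
    exact one_ne_zero hl
  · rintro ⟨hu, hne⟩
    exact ⟨h.exists_mem_upJumps ⟨pos_of_gt hu.1, hu.2⟩ hne, hu.1⟩

/-- A function of the jump of `∫ z' dX` splits over the target states. -/
theorem apply_jump_eq_sum {M : Type*} [AddCommMonoid M] (φ : ℝ → M) (hφ : φ 0 = 0) {b u : ℝ≥0}
    {ω : Ω} (hu : u ∈ Set.Ioc 0 b) (z : Fin N → ℝ) :
    φ (z ⬝ᵥ (X u ω - leftX X u ω))
      = ∑ j, if u ∈ h.jumpTimes b j ω then φ (jumpMark X j u ω z) else 0 := by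
  obtain ⟨i, hi⟩ := h.leftX_unit hu.1 ω
  obtain ⟨k, hk⟩ := h.unit u ω
  have hmem : ∀ j, u ∈ h.jumpTimes b j ω ↔ j ≠ i ∧ j = k := by
    intro j
    rw [mem_jumpTimes]
    simp only [upJumps, Set.mem_ofPred_eq, ← h.leftX_apply hu.1, hi, hk, hu, true_and]
    by_cases h1 : j = i <;> by_cases h2 : j = k <;> simp [h1, h2, Pi.single_apply]
  simp only [hmem, jumpMark, hi, hk, dotProduct_sub, dotProduct_single_one]
  by_cases hik : k = i
  · subst hik
    rw [sub_self, hφ]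
    exact (Finset.sum_eq_zero fun j _ => if_neg fun hj => hj.1 hj.2).symm
  · rw [Finset.sum_eq_single k]
    · simp [hik]
    · intro j _ hj
      simp [hj]
    · simp

theorem sum_allJumps {M : Type*} [AddCommMonoid M] (φ : ℝ → M) (hφ : φ 0 = 0) (a b : ℝ≥0) (ω : Ω)
    (z : ℝ≥0 → Fin N → ℝ) :
    ∑ u ∈ h.allJumps a b ω, φ (z u ⬝ᵥ (X u ω - leftX X u ω))
      = ∑ j, ∑ u ∈ h.jumpTimes b j ω,
        (Set.Ioc a b).indicator (fun u => φ (jumpMark X j u ω (z u))) u := by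
  have h1 : ∀ u ∈ h.allJumps a b ω, φ (z u ⬝ᵥ (X u ω - leftX X u ω))
      = ∑ j, if u ∈ h.jumpTimes b j ω then φ (jumpMark X j u ω (z u)) else 0 := fun u hu =>
    h.apply_jump_eq_sum φ hφ
      ⟨pos_of_gt (h.mem_allJumps.1 hu).1.1, (h.mem_allJumps.1 hu).1.2⟩ (z u)
  rw [Finset.sum_congr rfl h1, Finset.sum_comm]
  refine Finset.sum_congr rfl fun j _ => ?_
  classical
  simp only [Set.indicator_apply]
  rw [← Finset.sum_filter, ← Finset.sum_filter]
  refine Finset.sum_congr ?_ fun _ _ => rfl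
  ext u
  simp only [allJumps, Finset.mem_filter, Finset.mem_biUnion, Finset.mem_univ, true_and]
  constructor
  · rintro ⟨⟨-, hau⟩, hu⟩
    exact ⟨hu, hau, ((h.mem_jumpTimes b j).1 hu).1.2⟩
  · rintro ⟨hu, hab⟩
    exact ⟨⟨⟨j, hu⟩, hab.1⟩, hu⟩

theorem finsum_jumps_eq (a b : ℝ≥0) (ω : Ω) (z : ℝ≥0 → Fin N → ℝ) :
    ∑ᶠ s ∈ Set.Ioc a b, z s ⬝ᵥ (X s ω - leftX X s ω)
      = ∑ u ∈ h.allJumps a b ω, z u ⬝ᵥ (X u ω - leftX X u ω) := by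
  refine finsum_mem_eq_sum_of_inter_support_eq _ ?_
  ext u
  simp only [Set.mem_inter_iff, Function.mem_support, Finset.mem_coe, h.mem_allJumps]
  constructor
  · rintro ⟨hu, hne⟩
    refine ⟨⟨hu, fun he => hne ?_⟩, hne⟩
    rw [he, sub_self, dotProduct_zero]
  · rintro ⟨⟨hu, -⟩, hne⟩
    exact ⟨hu, hne⟩

/-- Both the jumps and the drift split over the target states, so the stochastic integral is a
finite sum of compensated sums as in `integral_compensated_jumpTimes`. -/
theorem integralM_eq {a b : ℝ≥0} {Z : ℝ≥0 → Ω → (Fin N → ℝ)} {ω : Ω}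
    (hint : ∀ j, IntegrableOn (fun u => jumpMark X j u ω (Z u ω) * jumpRate A X j u ω)
      (Set.Ioc a b) timeMeasure) :
    integralM A X Z a b ω = ∑ j, (∑ u ∈ h.jumpTimes b j ω,
        (Set.Ioc a b).indicator (fun u => jumpMark X j u ω (Z u ω)) u
      - ∫ u in Set.Ioc a b, jumpMark X j u ω (Z u ω) * jumpRate A X j u ω ∂timeMeasure) := by
  unfold integralM
  rw [h.finsum_jumps_eq a b ω fun u => Z u ω,
    h.sum_allJumps (fun x => x) rfl a b ω fun u => Z u ω, Finset.sum_sub_distrib,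
    ← integral_finsetSum _ fun j _ => hint j]
  congr 1
  refine integral_congr_ae ?_
  filter_upwards [h.ae_leftX_eq a b ω, ae_restrict_mem measurableSet_Ioc] with u hl hu
  exact h.dotProduct_mulVec_eq_sum (pos_of_gt hu.1) hl _

/-- A predictable version of the marks. -/
theorem exists_predictable_jumpMark (b : ℝ≥0) (j : Fin N) {Z : ℝ≥0 → Ω → (Fin N → ℝ)}
    (hZ : IsStronglyPredictable (completedFiltration μ X hX) Z) :
    ∃ g : ℝ≥0 × Ω → ℝ, Measurable[(completedFiltration μ X hX).predictable] g ∧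
      ∀ ω, ∀ u ∈ Set.Ioc 0 b, g (u, ω) = jumpMark X j u ω (Z u ω) := by
  have hex : ∀ k : Fin N, _ := fun k => exists_predictable_leftLim (completedFiltration μ X hX)
    (zero_le : 0 ≤ b) (fun t ω => X t ω k) fun t _ => measurable_completedFiltration le_rfl k
  choose g hg hgX using hex
  have hZk : ∀ k, Measurable[(completedFiltration μ X hX).predictable]
      fun p : ℝ≥0 × Ω => Z p.1 p.2 k := fun k => (measurable_pi_apply k).comp hZ.measurable
  refine ⟨fun p => Z p.1 p.2 j - ∑ k, Z p.1 p.2 k * g k p, ?_, fun ω u hu => ?_⟩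
  · exact (hZk j).sub (Finset.measurable_sum _ fun k _ => (hZk k).mul (hg k))
  · simp only [jumpMark, dotProduct]
    congr 1
    refine Finset.sum_congr rfl fun k _ => ?_
    rw [hgX k ω u hu _ (h.tendsto_leftX_apply ω u k)]

variable [IsProbabilityMeasure μ]

/-- The stochastic integral of an integrable predictable process is a martingale. -/
theorem setIntegral_integralM {a b : ℝ≥0} {Z : ℝ≥0 → Ω → (Fin N → ℝ)}
    (hZ : IsStronglyPredictable (completedFiltration μ X hX) Z)
    (hfin : ∀ j, ∫⁻ ω, ∫⁻ u in Set.Ioc a b, ENNReal.ofReal |jumpMark X j u ω (Z u ω)| *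
      ENNReal.ofReal (jumpRate A X j u ω) ∂timeMeasure ∂μ < ∞) {B : Set Ω}
    (hB : MeasurableSet[completedFiltration μ X hX a] B) :
    (∀ᵐ ω ∂μ, ∀ j, IntegrableOn (fun u => jumpMark X j u ω (Z u ω) * jumpRate A X j u ω)
      (Set.Ioc a b) timeMeasure) ∧
    Integrable (fun ω => integralM A X Z a b ω) μ ∧ ∫ ω in B, integralM A X Z a b ω ∂μ = 0 := by
  have hex : ∀ j, _ := fun j => h.exists_predictable_jumpMark b j hZ
  choose g hg hgX using hex
  set I : Fin N → Ω → ℝ := fun j ω => ∑ u ∈ h.jumpTimes b j ω,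
      (Set.Ioc a b).indicator (fun u => jumpMark X j u ω (Z u ω)) u
    - ∫ u in Set.Ioc a b, jumpMark X j u ω (Z u ω) * jumpRate A X j u ω ∂timeMeasure with hI
  have hsub : Set.Ioc a b ⊆ Set.Ioc 0 b := Set.Ioc_subset_Ioc_left zero_le
  -- Multiplying by the indicator of (a, b] × C keeps the integrand predictable because C is known
  -- at time a. The choice C = Ω gives integrability, and C = B the vanishing integral.
  have key : ∀ j (C : Set Ω), MeasurableSet[completedFiltration μ X hX a] C →
      (∀ᵐ ω ∂μ, ω ∈ C → IntegrableOn (fun u => jumpMark X j u ω (Z u ω) * jumpRate A X j u ω)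
        (Set.Ioc a b) timeMeasure) ∧
      Integrable (C.indicator (I j)) μ ∧ ∫ ω, C.indicator (I j) ω ∂μ = 0 := by
    intro j C hC
    have hH : Measurable[(completedFiltration μ X hX).predictable]
        ((Set.Ioc a b ×ˢ C).indicator (g j)) :=
      (hg j).indicator (measurableSet_predictable_Ioc_prod a b hC)
    have hval : ∀ ω ∈ C, ∀ u ∈ Set.Ioc 0 b, (Set.Ioc a b ×ˢ C).indicator (g j) (u, ω)
        = (Set.Ioc a b).indicator (fun u => jumpMark X j u ω (Z u ω)) u := by
      intro ω hω u hu
      by_cases hu' : u ∈ Set.Ioc a b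
      · rw [Set.indicator_of_mem (Set.mk_mem_prod hu' hω), Set.indicator_of_mem hu', hgX j ω u hu]
      · rw [Set.indicator_of_notMem fun hp => hu' hp.1, Set.indicator_of_notMem hu']
    have hval0 : ∀ ω ∉ C, ∀ u, (Set.Ioc a b ×ˢ C).indicator (g j) (u, ω) = 0 :=
      fun ω hω u => Set.indicator_of_notMem (fun hp => hω hp.2) _
    have hfin' : ∫⁻ ω, ∫⁻ u in Set.Ioc 0 b,
        ENNReal.ofReal |(Set.Ioc a b ×ˢ C).indicator (g j) (u, ω)| *
        ENNReal.ofReal (jumpRate A X j u ω) ∂timeMeasure ∂μ < ∞ := by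
      refine lt_of_le_of_lt (lintegral_mono fun ω => ?_) (hfin j)
      rw [← Set.inter_eq_left.2 hsub, ← setLIntegral_indicator measurableSet_Ioc]
      refine setLIntegral_mono' measurableSet_Ioc fun u hu => ?_
      by_cases hω : ω ∈ C
      · rw [Set.inter_eq_left.2 hsub, hval ω hω u hu]
        by_cases hu' : u ∈ Set.Ioc a b <;> simp [Set.indicator, hu']
      · rw [Set.inter_eq_left.2 hsub, hval0 ω hω, abs_zero, ENNReal.ofReal_zero, zero_mul]
        exact zero_le
    obtain ⟨h1, h2, h3⟩ := h.integral_compensated_jumpTimes b j hH hfin'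
    have heq : (fun ω => ∑ u ∈ h.jumpTimes b j ω, (Set.Ioc a b ×ˢ C).indicator (g j) (u, ω)
        - ∫ u in Set.Ioc 0 b, (Set.Ioc a b ×ˢ C).indicator (g j) (u, ω) * jumpRate A X j u ω
          ∂timeMeasure) = C.indicator (I j) := by
      ext ω
      by_cases hω : ω ∈ C
      · rw [Set.indicator_of_mem hω]
        simp only [hI]
        congr 1
        · exact Finset.sum_congr rfl fun u hu => hval ω hω u ((h.mem_jumpTimes b j).1 hu).1
        · rw [setIntegral_congr_fun (g := (Set.Ioc a b).indicator fun u =>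
            jumpMark X j u ω (Z u ω) * jumpRate A X j u ω) measurableSet_Ioc,
            setIntegral_indicator measurableSet_Ioc, Set.inter_eq_right.2 hsub]
          intro u hu
          simp only [hval ω hω u hu]
          by_cases hu' : u ∈ Set.Ioc a b <;> simp [Set.indicator, hu']
      · simp [hω]
    rw [heq] at h2 h3
    refine ⟨?_, h2, h3⟩
    filter_upwards [h1] with ω hω hωC
    refine (hω.mono_set hsub).congr_fun (fun u hu => ?_) measurableSet_Ioc
    simp only [hval ω hωC u (hsub hu), Set.indicator_of_mem hu]
  have hBm : MeasurableSet B := (completedFiltration μ X hX).le a _ hB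
  have hint : ∀ᵐ ω ∂μ, ∀ j, IntegrableOn (fun u => jumpMark X j u ω (Z u ω) * jumpRate A X j u ω)
      (Set.Ioc a b) timeMeasure := by
    rw [ae_all_iff]
    intro j
    filter_upwards [(key j Set.univ MeasurableSet.univ).1] with ω hω
    exact hω (Set.mem_univ _)
  have hIint : ∀ j, Integrable (I j) μ := by
    intro j
    have := (key j Set.univ MeasurableSet.univ).2.1
    rwa [Set.indicator_univ] at this
  have hM : (fun ω => integralM A X Z a b ω) =ᵐ[μ] fun ω => ∑ j, I j ω := by
    filter_upwards [hint] with ω hω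
    exact h.integralM_eq hω
  refine ⟨hint, (integrable_finsetSum _ fun j _ => hIint j).congr hM.symm, ?_⟩
  rw [integral_congr_ae (ae_restrict_of_ae hM), integral_finsetSum _ fun j _ =>
    (hIint j).integrableOn]
  refine Finset.sum_eq_zero fun j _ => ?_
  rw [← integral_indicator hBm]
  exact (key j B hB).2.2

/-- The isometry, in terms of the sum of the squared jumps. -/
theorem lintegral_sum_sq_jumps (a b : ℝ≥0) {Z : ℝ≥0 → Ω → (Fin N → ℝ)}
    (hZ : IsStronglyPredictable (completedFiltration μ X hX) Z) :
    ∫⁻ ω, ∑ u ∈ h.allJumps a b ω,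
        ENNReal.ofReal ((Z u ω ⬝ᵥ (X u ω - leftX X u ω)) ^ 2) ∂μ
      = ∫⁻ ω, ∫⁻ u in Set.Ioc a b, ENNReal.ofReal (normSq A X u ω (Z u ω)) ∂timeMeasure ∂μ := by
  have hex : ∀ j, _ := fun j => h.exists_predictable_jumpMark b j hZ
  choose g hg hgX using hex
  have hsub : Set.Ioc a b ⊆ Set.Ioc 0 b := Set.Ioc_subset_Ioc_left zero_le
  set H : Fin N → ℝ≥0 × Ω → ℝ≥0∞ := fun j =>
    (Set.Ioc a b ×ˢ Set.univ).indicator fun p => ENNReal.ofReal (g j p ^ 2) with hH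
  have hHm : ∀ j, Measurable[(completedFiltration μ X hX).predictable] (H j) := fun j =>
    (ENNReal.measurable_ofReal.comp ((hg j).pow_const 2)).indicator
      (measurableSet_predictable_Ioc_prod a b MeasurableSet.univ)
  have hval : ∀ j ω, ∀ u ∈ Set.Ioc 0 b, H j (u, ω) = (Set.Ioc a b).indicator
      (fun u => ENNReal.ofReal (jumpMark X j u ω (Z u ω) ^ 2)) u := by
    intro j ω u hu
    by_cases hu' : u ∈ Set.Ioc a b
    · simp only [hH]
      rw [Set.indicator_of_mem (Set.mk_mem_prod hu' (Set.mem_univ _)), Set.indicator_of_mem hu',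
        hgX j ω u hu]
    · simp only [hH]
      rw [Set.indicator_of_notMem fun hp => hu' hp.1, Set.indicator_of_notMem hu']
  have hle := predictable_le (completedFiltration μ X hX)
  have hL : ∀ ω, ∑ u ∈ h.allJumps a b ω,
      ENNReal.ofReal ((Z u ω ⬝ᵥ (X u ω - leftX X u ω)) ^ 2)
      = ∑ j, ∑ u ∈ h.jumpTimes b j ω, H j (u, ω) := by
    intro ω
    rw [h.sum_allJumps (fun x => ENNReal.ofReal (x ^ 2)) (by simp) a b ω fun u => Z u ω]
    exact Finset.sum_congr rfl fun j _ => Finset.sum_congr rfl fun u hu =>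
      (hval j ω u ((h.mem_jumpTimes b j).1 hu).1).symm
  have hR : ∀ ω, ∫⁻ u in Set.Ioc a b, ENNReal.ofReal (normSq A X u ω (Z u ω)) ∂timeMeasure
      = ∑ j, ∫⁻ u in Set.Ioc 0 b, H j (u, ω) * ENNReal.ofReal (jumpRate A X j u ω)
        ∂timeMeasure := by
    intro ω
    rw [← lintegral_finsetSum]
    · rw [← Set.inter_eq_left.2 hsub, ← setLIntegral_indicator measurableSet_Ioc]
      refine lintegral_congr_ae ?_
      filter_upwards [h.ae_leftX_eq 0 b ω, ae_restrict_mem measurableSet_Ioc] with u hl hu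
      simp only [hval _ ω u hu]
      by_cases hu' : u ∈ Set.Ioc a b
      · simp only [Set.indicator_of_mem hu']
        rw [h.normSq_eq_sum hu.1 hl, ENNReal.ofReal_sum_of_nonneg fun j _ =>
          mul_nonneg (sq_nonneg _) (h.jumpRate_nonneg j u ω)]
        exact Finset.sum_congr rfl fun j _ => ENNReal.ofReal_mul (sq_nonneg _)
      · simp only [Set.indicator_of_notMem hu', zero_mul, Finset.sum_const_zero]
    · intro j _
      exact (((hHm j).mono hle le_rfl).comp measurable_prodMk_right).mul
        (ENNReal.measurable_ofReal.comp ((h.measurable_jumpRate j).comp measurable_prodMk_right))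
  simp only [hL, hR]
  rw [lintegral_finsetSum, lintegral_finsetSum]
  · exact Finset.sum_congr rfl fun j _ => h.lintegral_sum_jumpTimes b j (hHm j)
  · intro j _
    refine Measurable.lintegral_prod_right (f := fun (ω : Ω) (u : ℝ≥0) =>
        H j (u, ω) * ENNReal.ofReal (jumpRate A X j u ω)) ?_
    exact (((hHm j).mono hle le_rfl).comp measurable_swap).mul
      ((ENNReal.measurable_ofReal.comp (h.measurable_jumpRate j)).comp measurable_swap)
  · exact fun j _ => measurable_sum_finset (h.measurable_graphCount_jumpTimes b j)
      ((hHm j).mono hle le_rfl)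

end IsMarkovChain


/-! ### Doob's maximal inequality in `L²` -/

/-- If the running maximum m does not change, the step is an identity plus the induction hypothesis.
If s reaches a new maximum, the excess is the square (s - m)². No sign of s is needed. -/
theorem sq_partialSups_add_le (s : ℕ → ℝ) (n : ℕ) :
    partialSups s n ^ 2 + 2 * ∑ k ∈ Finset.range n, partialSups s k * (s (k + 1) - s k)
      ≤ 2 * partialSups s n * s n := by
  induction n with
  | zero => simp only [partialSups_zero, Finset.range_zero, Finset.sum_empty]; nlinarith
  | succ n ih =>
    rw [Finset.sum_range_succ, partialSups_add_one]
    rcases le_total (s (n + 1)) (partialSups s n) with hle | hle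
    · rw [sup_eq_left.2 hle]; linarith
    · rw [sup_eq_right.2 hle]; nlinarith [sq_nonneg (s (n + 1) - partialSups s n)]

/-- Doubling the previous inequality and using 4ms ≤ m² + 4s² gives a pathwise form of Doob's
inequality: the sum is a martingale transform when s is a martingale. -/
theorem sq_partialSups_le (s : ℕ → ℝ) (n : ℕ) :
    partialSups s n ^ 2 + 4 * ∑ k ∈ Finset.range n, partialSups s k * (s (k + 1) - s k)
      ≤ 4 * s n ^ 2 := by
  nlinarith [sq_partialSups_add_le s n, sq_nonneg (partialSups s n - 2 * s n)]

section Doob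

variable {Ω : Type*} [mΩ : MeasurableSpace Ω] {μ : Measure Ω}

theorem memLp_partialSups {U : ℕ → Ω → ℝ} (hU : ∀ k, MemLp (U k) 2 μ) (n : ℕ) :
    MemLp (partialSups U n) 2 μ := by
  induction n with
  | zero => simpa using hU 0
  | succ n ih => rw [partialSups_add_one]; exact ih.sup (hU _)

theorem stronglyMeasurable_partialSups {G : Filtration ℕ mΩ} {U : ℕ → Ω → ℝ}
    (hU : ∀ k, StronglyMeasurable[G k] (U k)) (n : ℕ) :
    StronglyMeasurable[G n] (partialSups U n) := by
  induction n with
  | zero => simpa using hU 0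
  | succ n ih =>
    rw [partialSups_add_one]
    have := ih.mono (G.mono n.le_succ)
    exact @StronglyMeasurable.sup Ω ℝ _ _ (G (n + 1)) _ _ _ this (hU (n + 1))

theorem integral_mul_condExp [IsProbabilityMeasure μ] {m : MeasurableSpace Ω} (hm : m ≤ mΩ) {V ζ : Ω → ℝ}
    (hV : StronglyMeasurable[m] V) (hV2 : MemLp V 2 μ) (hζ : MemLp ζ 2 μ) :
    ∫ ω, V ω * (μ[ζ|m]) ω ∂μ = ∫ ω, V ω * ζ ω ∂μ := by
  rw [← integral_condExp hm (f := fun ω => V ω * ζ ω)]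
  exact integral_congr_ae (condExp_mul_of_stronglyMeasurable_left hV (hV2.integrable_mul hζ)
    (hζ.integrable one_le_two)).symm

/-- In the pathwise inequality the running maximum at time k is known at time k, so the increments
of the martingale paired with it have mean zero. -/
theorem integral_sq_partialSups_le [IsProbabilityMeasure μ] (G : Filtration ℕ mΩ) {ζ : Ω → ℝ} (hζ : MemLp ζ 2 μ) (n : ℕ) :
    ∫ ω, partialSups (fun k => μ[ζ|G k]) n ω ^ 2 ∂μ ≤ 4 * ∫ ω, (μ[ζ|G n]) ω ^ 2 ∂μ := by
  set U : ℕ → Ω → ℝ := fun k => μ[ζ|G k] with hU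
  have hU2 : ∀ k, MemLp (U k) 2 μ := fun k => hζ.condExp one_le_two
  have hm2 := memLp_partialSups hU2
  have hmm := stronglyMeasurable_partialSups (G := G) (U := U) fun k => stronglyMeasurable_condExp
  have hpath : ∀ ω, partialSups U n ω ^ 2
      + 4 * ∑ k ∈ Finset.range n, partialSups U k ω * (U (k + 1) ω - U k ω) ≤ 4 * U n ω ^ 2 := by
    intro ω
    have := sq_partialSups_le (fun k => U k ω) n
    simpa only [← Pi.partialSups_apply] using this
  have hterm : ∀ k, Integrable (fun ω => partialSups U k ω * (U (k + 1) ω - U k ω)) μ :=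
    fun k => (hm2 k).integrable_mul ((hU2 (k + 1)).sub (hU2 k))
  have hzero : ∀ k, ∫ ω, partialSups U k ω * (U (k + 1) ω - U k ω) ∂μ = 0 := by
    intro k
    simp only [mul_sub]
    have e := integral_sub ((hm2 k).integrable_mul (hU2 (k + 1))) ((hm2 k).integrable_mul (hU2 k))
    simp only [Pi.mul_apply] at e
    rw [e, integral_mul_condExp (G.le _) ((hmm k).mono (G.mono k.le_succ)) (hm2 k) hζ,
      integral_mul_condExp (G.le _) (hmm k) (hm2 k) hζ, sub_self]
  have h1 := integral_mono (((hm2 n).integrable_sq).add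
    ((integrable_finsetSum (Finset.range n) fun k _ => hterm k).const_mul 4))
    ((hU2 n).integrable_sq.const_mul 4) hpath
  simp only [Pi.add_apply] at h1
  rw [integral_add (hm2 n).integrable_sq
    ((integrable_finsetSum (Finset.range n) fun k _ => hterm k).const_mul 4),
    integral_const_mul, integral_finsetSum _ fun k _ => hterm k,
    Finset.sum_eq_zero fun k _ => hzero k, mul_zero, add_zero, integral_const_mul] at h1
  exact h1

theorem lintegral_enorm_sq_eq (ζ : Ω → ℝ) : ∫⁻ ω, ‖ζ ω‖ₑ ^ 2 ∂μ = eLpNorm ζ 2 μ ^ 2 := by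
  have := eLpNorm_nnreal_pow_eq_lintegral (f := ζ) (μ := μ) (p := 2) two_ne_zero
  simp only [NNReal.coe_ofNat, ENNReal.rpow_ofNat, ENNReal.coe_ofNat] at this
  exact this.symm

theorem ofReal_integral_sq {ζ : Ω → ℝ} (hζ : MemLp ζ 2 μ) :
    ENNReal.ofReal (∫ ω, ζ ω ^ 2 ∂μ) = ∫⁻ ω, ‖ζ ω‖ₑ ^ 2 ∂μ := by
  rw [ofReal_integral_eq_lintegral_ofReal hζ.integrable_sq (Eventually.of_forall fun ω =>
    sq_nonneg _)]
  refine lintegral_congr fun ω => ?_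
  rw [← sq_abs, ENNReal.ofReal_pow (abs_nonneg _), Real.enorm_eq_ofReal_abs]

/-- A finite family dominated by the conditional expectations of `ζ`. -/
theorem lintegral_iSup_sq_le_of_le_condExp [IsProbabilityMeasure μ] (G : Filtration ℕ mΩ) {ζ : Ω → ℝ} (hζ : MemLp ζ 2 μ)
    (n : ℕ) (y : ℕ → Ω → ℝ) (hy : ∀ k ≤ n, ∀ᵐ ω ∂μ, |y k ω| ≤ (μ[ζ|G k]) ω) :
    ∫⁻ ω, ⨆ k : ℕ, ⨆ _ : k ≤ n, ‖y k ω‖ₑ ^ 2 ∂μ ≤ 4 * ∫⁻ ω, ‖ζ ω‖ₑ ^ 2 ∂μ := by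
  have hU2 : ∀ k, MemLp (μ[ζ|G k]) 2 μ := fun k => hζ.condExp one_le_two
  have hae : ∀ᵐ ω ∂μ, ∀ k, k ≤ n → |y k ω| ≤ (μ[ζ|G k]) ω :=
    ae_all_iff.2 fun k => by
      by_cases hk : k ≤ n
      · filter_upwards [hy k hk] with ω hω _ using hω
      · exact Eventually.of_forall fun ω h => absurd h hk
  calc ∫⁻ ω, ⨆ k : ℕ, ⨆ _ : k ≤ n, ‖y k ω‖ₑ ^ 2 ∂μ
      ≤ ∫⁻ ω, ‖partialSups (fun k => μ[ζ|G k]) n ω‖ₑ ^ 2 ∂μ := by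
        refine lintegral_mono_ae ?_
        filter_upwards [hae] with ω hω
        refine iSup₂_le fun k hk => ?_
        gcongr
        rw [enorm_le_iff_norm_le]
        refine (hω k hk).trans ((le_trans ?_ (le_abs_self _)))
        exact le_partialSups_of_le (fun k => μ[ζ|G k]) hk ω
    _ = ENNReal.ofReal (∫ ω, partialSups (fun k => μ[ζ|G k]) n ω ^ 2 ∂μ) :=
        (ofReal_integral_sq (memLp_partialSups hU2 n)).symm
    _ ≤ ENNReal.ofReal (4 * ∫ ω, (μ[ζ|G n]) ω ^ 2 ∂μ) :=
        ENNReal.ofReal_le_ofReal (integral_sq_partialSups_le G hζ n)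
    _ = 4 * ∫⁻ ω, ‖(μ[ζ|G n]) ω‖ₑ ^ 2 ∂μ := by
        rw [ENNReal.ofReal_mul (by norm_num), ofReal_integral_sq (hU2 n)]
        norm_num
    _ ≤ 4 * ∫⁻ ω, ‖ζ ω‖ₑ ^ 2 ∂μ := by
        rw [lintegral_enorm_sq_eq, lintegral_enorm_sq_eq]
        gcongr
        exact eLpNorm_condExp_le_eLpNorm _ one_le_two

end Doob

/-! ### The chain rule for the square of a path with finitely many jumps -/

theorem setIntegral_Ioc_add {a t b : ℝ≥0} {g : ℝ≥0 → ℝ} (hat : a ≤ t) (htb : t ≤ b)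
    (hg : IntegrableOn g (Set.Ioc a b) timeMeasure) :
    ∫ s in Set.Ioc a b, g s ∂timeMeasure
      = ∫ s in Set.Ioc a t, g s ∂timeMeasure + ∫ s in Set.Ioc t b, g s ∂timeMeasure := by
  rw [← Set.Ioc_union_Ioc_eq_Ioc hat htb, setIntegral_union (Set.Ioc_disjoint_Ioc_of_le le_rfl)
    measurableSet_Ioc (hg.mono_set (Set.Ioc_subset_Ioc_right htb))
    (hg.mono_set (Set.Ioc_subset_Ioc_left hat))]

/-- The square of the integral is a double integral over a square. Cutting it along the diagonal
leaves two triangles with equal integrals, and the diagonal itself is null. -/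
theorem integrableOn_primitive_mul {a b : ℝ≥0} {g : ℝ≥0 → ℝ}
    (hg : IntegrableOn g (Set.Ioc a b) timeMeasure) :
    IntegrableOn (fun t => (∫ s in Set.Ioc a t, g s ∂timeMeasure) * g t) (Set.Ioc a b) timeMeasure
    ∧ (∫ s in Set.Ioc a b, g s ∂timeMeasure) ^ 2
      = 2 * ∫ t in Set.Ioc a b, (∫ s in Set.Ioc a t, g s ∂timeMeasure) * g t ∂timeMeasure := by
  set ν := timeMeasure.restrict (Set.Ioc a b) with hν
  have hprod : Integrable (fun p : ℝ≥0 × ℝ≥0 => g p.1 * g p.2) (ν.prod ν) := hg.mul_prod hg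
  have hF : Integrable ({p : ℝ≥0 × ℝ≥0 | p.2 ≤ p.1}.indicator fun p => g p.1 * g p.2)
      (ν.prod ν) := hprod.indicator (measurableSet_le measurable_snd measurable_fst)
  have hF' : Integrable ({p : ℝ≥0 × ℝ≥0 | p.1 < p.2}.indicator fun p => g p.1 * g p.2)
      (ν.prod ν) := hprod.indicator (measurableSet_lt measurable_fst measurable_snd)
  have e1 : ∀ t ∈ Set.Ioc a b, ∫ s, ({p : ℝ≥0 × ℝ≥0 | p.2 ≤ p.1}.indicator
      fun p => g p.1 * g p.2) (t, s) ∂ν = (∫ s in Set.Ioc a t, g s ∂timeMeasure) * g t := by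
    intro t ht
    have : ∀ s, ({p : ℝ≥0 × ℝ≥0 | p.2 ≤ p.1}.indicator fun p => g p.1 * g p.2) (t, s)
        = (Set.Iic t).indicator (fun s => g t * g s) s := fun s => by
      by_cases hs : s ≤ t <;> simp [Set.indicator, hs]
    simp only [this]
    rw [hν, setIntegral_indicator measurableSet_Iic, integral_const_mul, mul_comm,
      Set.Ioc_inter_Iic, min_eq_right ht.2]
  have e2 : ∀ t ∈ Set.Ioc a b, ∫ s, ({p : ℝ≥0 × ℝ≥0 | p.1 < p.2}.indicator
      fun p => g p.1 * g p.2) (s, t) ∂ν = (∫ s in Set.Ioc a t, g s ∂timeMeasure) * g t := by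
    intro t ht
    have : ∀ s, ({p : ℝ≥0 × ℝ≥0 | p.1 < p.2}.indicator fun p => g p.1 * g p.2) (s, t)
        = (Set.Iio t).indicator (fun s => g s * g t) s := fun s => by
      by_cases hs : s < t <;> simp [Set.indicator, hs]
    simp only [this]
    have hset : Set.Ioc a b ∩ Set.Iio t = Set.Ioo a t := by
      ext s
      simp only [Set.mem_inter_iff, Set.mem_Ioc, Set.mem_Iio, Set.mem_Ioo]
      exact ⟨fun h => ⟨h.1.1, h.2⟩, fun h => ⟨⟨h.1, h.2.le.trans ht.2⟩, h.2⟩⟩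
    rw [hν, setIntegral_indicator measurableSet_Iio, integral_mul_const, hset,
      integral_Ioc_eq_integral_Ioo]
  refine ⟨?_, ?_⟩
  · exact hF.integral_prod_left.congr ((ae_restrict_mem measurableSet_Ioc).mono e1)
  · have hsum : ∀ p : ℝ≥0 × ℝ≥0, g p.1 * g p.2
        = ({p : ℝ≥0 × ℝ≥0 | p.2 ≤ p.1}.indicator fun p => g p.1 * g p.2) p
          + ({p : ℝ≥0 × ℝ≥0 | p.1 < p.2}.indicator fun p => g p.1 * g p.2) p := by
      intro p
      rcases le_or_gt p.2 p.1 with hp | hp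
      · simp [Set.indicator, hp, hp.not_gt]
      · simp [Set.indicator, hp, hp.not_ge]
    have h1 : (∫ s, g s ∂ν) ^ 2 = ∫ p, g p.1 * g p.2 ∂ν.prod ν := by
      rw [integral_prod_mul, sq]
    rw [h1]
    rw [integral_congr_ae (Eventually.of_forall hsum), integral_add hF hF', integral_prod _ hF, integral_prod_symm _ hF',
      integral_congr_ae ((ae_restrict_mem measurableSet_Ioc).mono e1),
      integral_congr_ae ((ae_restrict_mem measurableSet_Ioc).mono e2), two_mul]

/-- The path which starts at time `a` in `c`, has density `g`, and jumps by `J u` at `u ∈ S`. -/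
def jumpPath (a : ℝ≥0) (c : ℝ) (g J : ℝ≥0 → ℝ) (S : Finset ℝ≥0) (t : ℝ≥0) : ℝ :=
  c + ∫ s in Set.Ioc a t, g s ∂timeMeasure + ∑ u ∈ S, if u ≤ t then J u else 0

theorem jumpPath_insert (a : ℝ≥0) (c : ℝ) (g J : ℝ≥0 → ℝ) {S : Finset ℝ≥0} {τ : ℝ≥0} (hτ : τ ∉ S)
    (t : ℝ≥0) : jumpPath a c g J (insert τ S) t
      = jumpPath a c g J S t + if τ ≤ t then J τ else 0 := by
  unfold jumpPath
  rw [Finset.sum_insert hτ]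
  ring

theorem integrableOn_jumpPath_mul {a b : ℝ≥0} (c : ℝ) {g : ℝ≥0 → ℝ} (J : ℝ≥0 → ℝ)
    (S : Finset ℝ≥0) (hg : IntegrableOn g (Set.Ioc a b) timeMeasure) :
    IntegrableOn (fun t => jumpPath a c g J S t * g t) (Set.Ioc a b) timeMeasure := by
  unfold jumpPath
  simp only [add_mul, Finset.sum_mul]
  refine ((hg.const_mul c).add (integrableOn_primitive_mul hg).1).add
    (integrable_finsetSum _ fun u _ => ?_)
  have : (fun t => (if u ≤ t then J u else 0) * g t)
      = (Set.Ici u).indicator fun t => J u * g t := by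
    ext t
    by_cases ht : u ≤ t <;> simp [Set.indicator, ht]
  rw [this]
  exact (hg.const_mul _).indicator measurableSet_Ici

/-- Itô's formula P² = c² + 2 ∫ P_- dP + ∑ (ΔP)², with P u - J u as the left limit at a jump.
Induction removes the latest jump τ: its presence shifts the path by J τ from τ onward, so earlier
terms are unaffected and the time integral changes by J τ times the continuous increment over (τ,
b]. -/
theorem jumpPath_sq {a b : ℝ≥0} (c : ℝ) {g : ℝ≥0 → ℝ} (J : ℝ≥0 → ℝ)
    (S : Finset ℝ≥0) (hS : ∀ u ∈ S, u ∈ Set.Ioc a b)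
    (hg : IntegrableOn g (Set.Ioc a b) timeMeasure) :
    jumpPath a c g J S b ^ 2 = c ^ 2
      + 2 * ∫ t in Set.Ioc a b, jumpPath a c g J S t * g t ∂timeMeasure
      + ∑ u ∈ S, (2 * ((jumpPath a c g J S u - J u) * J u) + J u ^ 2) := by
  induction S using Finset.induction_on_max with
  | empty =>
    have h2 := integrableOn_primitive_mul hg
    simp only [jumpPath, Finset.sum_empty, add_zero, add_mul]
    rw [integral_add (hg.const_mul c) h2.1, integral_const_mul]
    linear_combination h2.2
  | insert τ S hlt ih =>
    have hτ : τ ∉ S := fun h => lt_irrefl _ (hlt τ h)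
    have hτm := hS τ (Finset.mem_insert_self τ S)
    have ih := ih fun u hu => hS u (Finset.mem_insert_of_mem hu)
    have hSsum : ∑ u ∈ S, (2 * ((jumpPath a c g J (insert τ S) u - J u) * J u) + J u ^ 2)
        = ∑ u ∈ S, (2 * ((jumpPath a c g J S u - J u) * J u) + J u ^ 2) := by
      refine Finset.sum_congr rfl fun u hu => ?_
      rw [jumpPath_insert _ _ _ _ hτ, if_neg (hlt u hu).not_ge, add_zero]
    have hint : ∫ t in Set.Ioc a b, jumpPath a c g J (insert τ S) t * g t ∂timeMeasure
        = ∫ t in Set.Ioc a b, jumpPath a c g J S t * g t ∂timeMeasure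
          + J τ * ∫ t in Set.Ioc τ b, g t ∂timeMeasure := by
      have hset : Set.Ioc a b ∩ Set.Ici τ = Set.Icc τ b := by
        ext t
        simp only [Set.mem_inter_iff, Set.mem_Ioc, Set.mem_Ici, Set.mem_Icc]
        exact ⟨fun h => ⟨h.2, h.1.2⟩, fun h => ⟨⟨hτm.1.trans_le h.1, h.2⟩, h.1⟩⟩
      have : ∀ t, jumpPath a c g J (insert τ S) t * g t = jumpPath a c g J S t * g t
          + (Set.Ici τ).indicator (fun t => J τ * g t) t := by
        intro t
        rw [jumpPath_insert _ _ _ _ hτ, add_mul]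
        by_cases ht : τ ≤ t <;> simp [Set.indicator, ht]
      simp only [this]
      rw [integral_add (integrableOn_jumpPath_mul c J S hg)
        ((hg.const_mul _).indicator measurableSet_Ici), setIntegral_indicator measurableSet_Ici,
        integral_const_mul, hset, integral_Icc_eq_integral_Ioc]
    have hinc : jumpPath a c g J S b - jumpPath a c g J S τ
        = ∫ t in Set.Ioc τ b, g t ∂timeMeasure := by
      unfold jumpPath
      rw [setIntegral_Ioc_add hτm.1.le hτm.2 hg]
      have : ∑ u ∈ S, (if u ≤ b then J u else 0) = ∑ u ∈ S, if u ≤ τ then J u else 0 :=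
        Finset.sum_congr rfl fun u hu => by
          rw [if_pos (hlt u hu).le, if_pos ((hlt u hu).le.trans hτm.2)]
      rw [this]
      ring
    rw [Finset.sum_insert hτ, hSsum, hint, jumpPath_insert _ _ _ _ hτ b, if_pos hτm.2,
      jumpPath_insert _ _ _ _ hτ τ, if_pos le_rfl, ← hinc]
    linear_combination ih


/-! ### Elementary inequalities -/

theorem two_mul_mul_le_sq_add_sq (x y : ℝ≥0∞) : 2 * (x * y) ≤ x ^ 2 + y ^ 2 := by
  rcases eq_or_ne x ∞ with rfl | hx
  · simp
  rcases eq_or_ne y ∞ with rfl | hy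
  · simp
  lift x to ℝ≥0 using hx
  lift y to ℝ≥0 using hy
  norm_cast
  have := two_mul_le_add_sq x y
  linarith

theorem add_sq_le_two_mul (x y : ℝ≥0∞) : (x + y) ^ 2 ≤ 2 * (x ^ 2 + y ^ 2) := by
  calc (x + y) ^ 2 = x ^ 2 + y ^ 2 + 2 * (x * y) := by ring
    _ ≤ x ^ 2 + y ^ 2 + (x ^ 2 + y ^ 2) := by gcongr; exact two_mul_mul_le_sq_add_sq x y
    _ = 2 * (x ^ 2 + y ^ 2) := by ring

/-- The Cauchy-Schwarz inequality against a constant. -/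
theorem sq_lintegral_le {α : Type*} [MeasurableSpace α] (ν : Measure α) {φ : α → ℝ≥0∞}
    (hφ : AEMeasurable φ ν) : (∫⁻ x, φ x ∂ν) ^ 2 ≤ ν Set.univ * ∫⁻ x, φ x ^ 2 ∂ν := by
  have h1 := ENNReal.lintegral_mul_le_Lp_mul_Lq ν Real.HolderConjugate.two_two hφ
    (aemeasurable_const (b := (1 : ℝ≥0∞)))
  simp only [Pi.mul_apply, mul_one, lintegral_const, ENNReal.rpow_ofNat, one_pow, one_mul] at h1
  calc (∫⁻ x, φ x ∂ν) ^ 2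
      ≤ ((∫⁻ x, φ x ^ 2 ∂ν) ^ (1 / 2 : ℝ) * ν Set.univ ^ (1 / 2 : ℝ)) ^ 2 := by gcongr
    _ = ν Set.univ * ∫⁻ x, φ x ^ 2 ∂ν := by
        rw [mul_pow, ← ENNReal.rpow_natCast, ← ENNReal.rpow_natCast, ← ENNReal.rpow_mul,
          ← ENNReal.rpow_mul]
        norm_num [mul_comm]

/-- Left limits of a path with finitely many jumps. -/
theorem tendsto_jumpPath_left {a b : ℝ≥0} (c : ℝ) {g : ℝ≥0 → ℝ} (J : ℝ≥0 → ℝ) (S : Finset ℝ≥0)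
    (hg : IntegrableOn g (Set.Ioc a b) timeMeasure) {u : ℝ≥0} (hu : u ∈ Set.Ioc a b) :
    Tendsto (jumpPath a c g J S) (𝓝[<] u)
      (𝓝 (jumpPath a c g J S u - if u ∈ S then J u else 0)) := by
  have hint : Tendsto (fun t => ∫ s in Set.Ioc a t, g s ∂timeMeasure) (𝓝[<] u)
      (𝓝 (∫ s in Set.Ioc a u, g s ∂timeMeasure)) := by
    have hlim : Tendsto (fun t => ∫ s in Set.Ioc a b, (Set.Iic t).indicator g s ∂timeMeasure)
        (𝓝[<] u) (𝓝 (∫ s in Set.Ioc a b, (Set.Iio u).indicator g s ∂timeMeasure)) := by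
      refine tendsto_integral_filter_of_dominated_convergence (fun s => ‖g s‖) ?_ ?_ hg.norm ?_
      · exact Eventually.of_forall fun t =>
          hg.aestronglyMeasurable.indicator measurableSet_Iic
      · exact Eventually.of_forall fun t => Eventually.of_forall fun s =>
          norm_indicator_le_norm_self _ _
      · refine Eventually.of_forall fun s => ?_
        rcases lt_or_ge s u with hs | hs
        · refine tendsto_const_nhds.congr' ?_
          filter_upwards [Ioo_mem_nhdsLT hs] with t ht
          rw [Set.indicator_of_mem (Set.mem_Iio.2 hs), Set.indicator_of_mem (Set.mem_Iic.2 ht.1.le)]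
        · refine tendsto_const_nhds.congr' ?_
          filter_upwards [self_mem_nhdsWithin] with t ht
          rw [Set.indicator_of_notMem (s := Set.Iio u) (fun h => absurd h (not_lt.2 hs)),
            Set.indicator_of_notMem (s := Set.Iic t) (fun h => absurd (lt_of_le_of_lt h ht) (not_lt.2 hs))]
    rw [setIntegral_indicator measurableSet_Iio] at hlim
    have hset : Set.Ioc a b ∩ Set.Iio u = Set.Ioo a u := by
      ext s
      simp only [Set.mem_inter_iff, Set.mem_Ioc, Set.mem_Iio, Set.mem_Ioo]
      exact ⟨fun h => ⟨h.1.1, h.2⟩, fun h => ⟨⟨h.1, h.2.le.trans hu.2⟩, h.2⟩⟩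
    rw [hset, ← integral_Ioc_eq_integral_Ioo] at hlim
    refine hlim.congr' ?_
    filter_upwards [self_mem_nhdsWithin] with t ht
    rw [setIntegral_indicator measurableSet_Iic, Set.Ioc_inter_Iic,
      min_eq_right (le_of_lt (lt_of_lt_of_le ht hu.2))]
  have hsum : Tendsto (fun t => ∑ v ∈ S, if v ≤ t then J v else 0) (𝓝[<] u)
      (𝓝 (∑ v ∈ S, if v < u then J v else 0)) := by
    refine tendsto_finsetSum _ fun v _ => ?_
    refine tendsto_const_nhds.congr' ?_
    rcases lt_or_ge v u with hv | hv
    · filter_upwards [Ioo_mem_nhdsLT hv] with t ht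
      rw [if_pos hv, if_pos ht.1.le]
    · filter_upwards [self_mem_nhdsWithin] with t ht
      rw [if_neg hv.not_gt, if_neg (lt_of_lt_of_le ht hv).not_ge]
  have hval : ∑ v ∈ S, (if v < u then J v else 0)
      = ∑ v ∈ S, (if v ≤ u then J v else 0) - if u ∈ S then J u else 0 := by
    rw [← Finset.sum_ite_eq S u J, ← Finset.sum_sub_distrib]
    refine Finset.sum_congr rfl fun v _ => ?_
    rcases lt_trichotomy v u with hv | rfl | hv
    · simp [hv, hv.le, hv.ne']
    · simp
    · simp [hv.not_gt, hv.not_ge, hv.ne]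
  have := (hint.const_add c).add hsum
  rw [hval] at this
  unfold jumpPath
  convert this using 2
  ring

/-! ### Measurability, additivity and integrability of stochastic integrals -/

namespace IsMarkovChain

variable {Ω : Type*} [mΩ : MeasurableSpace Ω] {μ : Measure Ω} {N : ℕ}
  {A : ℝ≥0 → Matrix (Fin N) (Fin N) ℝ} {X : ℝ≥0 → Ω → (Fin N → ℝ)} {hX : ∀ t, Measurable (X t)}

section
variable (h : IsMarkovChain μ A X hX)
include h

theorem normSq_nonneg {t : ℝ≥0} {ω : Ω} (ht : 0 < t) (hl : leftX X t ω = X t ω) (z : Fin N → ℝ) :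
    0 ≤ normSq A X t ω z := by
  rw [h.normSq_eq_sum ht hl]
  exact Finset.sum_nonneg fun j _ => mul_nonneg (sq_nonneg _) (h.jumpRate_nonneg j t ω)

/-- A jointly measurable version of `‖Z‖²_X`. -/
theorem exists_measurable_normSq (b : ℝ≥0) {Z : ℝ≥0 → Ω → (Fin N → ℝ)}
    (hZ : IsStronglyPredictable (completedFiltration μ X hX) Z) :
    ∃ Q : ℝ≥0 × Ω → ℝ, Measurable Q ∧
      ∀ ω, ∀ᵐ u ∂timeMeasure.restrict (Set.Ioc 0 b), Q (u, ω) = normSq A X u ω (Z u ω) := by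
  have hex : ∀ j, _ := fun j => h.exists_predictable_jumpMark b j hZ
  choose g hg hgX using hex
  refine ⟨fun p => ∑ j, g j p ^ 2 * jumpRate A X j p.1 p.2, ?_, fun ω => ?_⟩
  · exact Finset.measurable_sum _ fun j _ => (((hg j).mono (predictable_le _) le_rfl).pow_const 2).mul
      (h.measurable_jumpRate j)
  · filter_upwards [h.ae_leftX_eq 0 b ω, ae_restrict_mem measurableSet_Ioc] with u hl hu
    rw [h.normSq_eq_sum hu.1 hl]
    exact Finset.sum_congr rfl fun j _ => by rw [hgX j ω u hu]

theorem finite_inter_support (a b : ℝ≥0) (ω : Ω) (z : ℝ≥0 → Fin N → ℝ) :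
    (Set.Ioc a b ∩ Function.support fun s => z s ⬝ᵥ (X s ω - leftX X s ω)).Finite := by
  refine (h.finite_jumps a b ω).subset ?_
  rintro u ⟨hu, hne⟩
  refine ⟨hu, fun he => hne ?_⟩
  simp [he]

theorem integralM_add {a t b : ℝ≥0} (hat : a ≤ t) (htb : t ≤ b) {Z : ℝ≥0 → Ω → (Fin N → ℝ)} {ω : Ω}
    (hint : IntegrableOn (fun s => Z s ω ⬝ᵥ (A s *ᵥ X s ω)) (Set.Ioc a b) timeMeasure) :
    integralM A X Z a b ω = integralM A X Z a t ω + integralM A X Z t b ω := by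
  unfold integralM
  rw [setIntegral_Ioc_add hat htb hint, ← Set.Ioc_union_Ioc_eq_Ioc hat htb,
    finsum_mem_union' (Set.Ioc_disjoint_Ioc_of_le le_rfl)
      (h.finite_inter_support a t ω fun s => Z s ω) (h.finite_inter_support t b ω fun s => Z s ω)]
  ring

theorem integrableOn_dotProduct {a b : ℝ≥0} {Z : ℝ≥0 → Ω → (Fin N → ℝ)} {ω : Ω}
    (hint : ∀ j, IntegrableOn (fun u => jumpMark X j u ω (Z u ω) * jumpRate A X j u ω)
      (Set.Ioc a b) timeMeasure) :
    IntegrableOn (fun s => Z s ω ⬝ᵥ (A s *ᵥ X s ω)) (Set.Ioc a b) timeMeasure := by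
  refine Integrable.congr (integrable_finsetSum Finset.univ fun j _ => hint j) ?_
  filter_upwards [h.ae_leftX_eq a b ω, ae_restrict_mem measurableSet_Ioc] with u hl hu
  exact (h.dotProduct_mulVec_eq_sum (pos_of_gt hu.1) hl _).symm

/-- Square integrability of `y` and `Z` makes `y Z` integrable against the jumps. -/
theorem lintegral_jumpMark_smul_lt_top {a b : ℝ≥0} {Z : ℝ≥0 → Ω → (Fin N → ℝ)}
    (hQ : ∫⁻ ω, ∫⁻ u in Set.Ioc a b, ENNReal.ofReal (normSq A X u ω (Z u ω)) ∂timeMeasure ∂μ < ∞)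
    {y : ℝ≥0 → Ω → ℝ} (hym : Measurable fun p : ℝ≥0 × Ω => y p.1 p.2)
    (hy : ∫⁻ ω, ∫⁻ u in Set.Ioc a b, ‖y u ω‖ₑ ^ 2 ∂timeMeasure ∂μ < ∞) (j : Fin N) :
    ∫⁻ ω, ∫⁻ u in Set.Ioc a b, ENNReal.ofReal |jumpMark X j u ω (y u ω • Z u ω)| *
      ENNReal.ofReal (jumpRate A X j u ω) ∂timeMeasure ∂μ < ∞ := by
  obtain ⟨m, hm0, -, -, hmr⟩ := h.exists_bound
  have hinner : ∀ ω, ∫⁻ u in Set.Ioc a b, ENNReal.ofReal |jumpMark X j u ω (y u ω • Z u ω)| *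
      ENNReal.ofReal (jumpRate A X j u ω) ∂timeMeasure
      ≤ ENNReal.ofReal m * ∫⁻ u in Set.Ioc a b, ‖y u ω‖ₑ ^ 2 ∂timeMeasure
        + ∫⁻ u in Set.Ioc a b, ENNReal.ofReal (normSq A X u ω (Z u ω)) ∂timeMeasure := by
    intro ω
    have hyω : Measurable fun u => ‖y u ω‖ₑ ^ 2 :=
      ((hym.comp measurable_prodMk_right).enorm).pow_const 2
    rw [← lintegral_const_mul _ hyω, ← lintegral_add_left (hyω.const_mul _)]
    refine lintegral_mono_ae ?_
    filter_upwards [h.ae_leftX_eq a b ω, ae_restrict_mem measurableSet_Ioc] with u hl hu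
    have hr := h.jumpRate_nonneg j u ω
    have hmark : jumpMark X j u ω (y u ω • Z u ω) = y u ω * jumpMark X j u ω (Z u ω) := by
      simp only [jumpMark, Pi.smul_apply, smul_eq_mul, smul_dotProduct]
      ring
    have hterm : jumpMark X j u ω (Z u ω) ^ 2 * jumpRate A X j u ω ≤ normSq A X u ω (Z u ω) := by
      rw [h.normSq_eq_sum (pos_of_gt hu.1) hl]
      exact Finset.single_le_sum (f := fun j => jumpMark X j u ω (Z u ω) ^ 2 * jumpRate A X j u ω)
        (fun j _ => mul_nonneg (sq_nonneg _) (h.jumpRate_nonneg j u ω)) (Finset.mem_univ j)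
    have he : ‖y u ω‖ₑ ^ 2 = ENNReal.ofReal (y u ω ^ 2) := by
      rw [Real.enorm_eq_ofReal_abs, ← ENNReal.ofReal_pow (abs_nonneg _), sq_abs]
    rw [hmark, ← ENNReal.ofReal_mul (abs_nonneg _), he, ← ENNReal.ofReal_mul hm0,
      ← ENNReal.ofReal_add (mul_nonneg hm0 (sq_nonneg _)) (h.normSq_nonneg (pos_of_gt hu.1) hl _)]
    refine ENNReal.ofReal_le_ofReal ?_
    -- After multiplication by the rate, y² is controlled by the bound m on the rates and the
    -- squared mark by ‖Z‖².
    have hmul : |y u ω * jumpMark X j u ω (Z u ω)|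
        ≤ y u ω ^ 2 + jumpMark X j u ω (Z u ω) ^ 2 := by
      rw [abs_mul, ← sq_abs (y u ω), ← sq_abs (jumpMark X j u ω (Z u ω))]
      nlinarith [sq_nonneg (|y u ω| - |jumpMark X j u ω (Z u ω)|), abs_nonneg (y u ω),
        abs_nonneg (jumpMark X j u ω (Z u ω)), sq_nonneg (|y u ω|),
        sq_nonneg (|jumpMark X j u ω (Z u ω)|)]
    have h1 := mul_le_mul_of_nonneg_right hmul hr
    have h2 := mul_le_mul_of_nonneg_left ((le_abs_self _).trans (hmr u ω j)) (sq_nonneg (y u ω))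
    linarith
  refine (lintegral_mono hinner).trans_lt ?_
  have hym' : Measurable fun ω => ENNReal.ofReal m
      * ∫⁻ u in Set.Ioc a b, ‖y u ω‖ₑ ^ 2 ∂timeMeasure :=
    (Measurable.lintegral_prod_right (f := fun (ω : Ω) (u : ℝ≥0) => ‖y u ω‖ₑ ^ 2)
      (((hym.comp measurable_swap).enorm).pow_const 2)).const_mul _
  rw [lintegral_add_left hym', lintegral_const_mul']
  · exact ENNReal.add_lt_top.2 ⟨ENNReal.mul_lt_top ENNReal.ofReal_lt_top hy, hQ⟩
  · exact ENNReal.ofReal_ne_top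

end

end IsMarkovChain

/-! ### Measurable versions of the solution and of the driver -/

section Versions

variable {Ω : Type*} [mΩ : MeasurableSpace Ω] {μ : Measure Ω} {N : ℕ}
  {A : ℝ≥0 → Matrix (Fin N) (Fin N) ℝ} {X : ℝ≥0 → Ω → (Fin N → ℝ)} {hX : ∀ t, Measurable (X t)}
  {T : ℝ≥0} {ξ : Ω → ℝ} {f : ℝ≥0 → Ω → ℝ → (Fin N → ℝ) → ℝ} {Y : ℝ≥0 → Ω → ℝ}
  {Z : ℝ≥0 → Ω → (Fin N → ℝ)} {c' c'' : ℝ}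

theorem IsBSDESolution.measurable_of_le (sol : IsBSDESolution μ A X hX T ξ f Y Z) {t : ℝ≥0}
    (ht : t ≤ T) : Measurable (Y t) :=
  (sol.adapted t ht).mono ((completedFiltration μ X hX).le t) le_rfl

/-- Freezing Y at time T makes almost every path right-continuous on the whole half-line, where
sampling from the right applies. -/
theorem IsBSDESolution.exists_measurable (sol : IsBSDESolution μ A X hX T ξ f Y Z) :
    ∃ y : ℝ≥0 × Ω → ℝ, Measurable y ∧ ∀ᵐ ω ∂μ, ∀ t ≤ T, y (t, ω) = Y t ω := by
  obtain ⟨y, hy, hyY⟩ := exists_measurable_uncurry (fun t ω => Y (min t T) ω)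
    fun t => sol.measurable_of_le (min_le_right t T)
  refine ⟨y, hy, ?_⟩
  filter_upwards [sol.right_cont] with ω hω t ht
  have hc : ∀ t, ContinuousWithinAt (fun s => Y (min s T) ω) (Set.Ici t) t := by
    intro t
    rcases lt_or_ge t T with htT | htT
    · refine ((hω t htT).congr_of_eventuallyEq ?_ ?_)
      · filter_upwards [mem_nhdsWithin_of_mem_nhds (Iio_mem_nhds htT)] with s hs
        rw [min_eq_left (le_of_lt hs)]
      · rw [min_eq_left htT.le]
    · refine (continuousWithinAt_const (b := Y T ω)).congr (fun s hs => ?_) ?_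
      · rw [min_eq_right (htT.trans hs)]
      · rw [min_eq_right htT]
  rw [hyY ω hc t, min_eq_left ht]

/-- Since y is only jointly measurable, the composition is measurable for the product σ-algebra and
need not be predictable; this suffices for time integrals. -/
theorem IsDriver.measurable_comp (drv : IsDriver μ A X hX c' c'' T f)
    (hZ : IsStronglyPredictable (completedFiltration μ X hX) Z) {y : ℝ≥0 × Ω → ℝ}
    (hy : Measurable y) : Measurable fun p : ℝ≥0 × Ω => f p.1 p.2 (y p) (Z p.1 p.2) := by
  have hle := predictable_le (completedFiltration μ X hX)
  have hZm : Measurable fun p : ℝ≥0 × Ω => Z p.1 p.2 := (hZ.measurable).mono hle le_rfl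
  have hpair : @Measurable (ℝ≥0 × Ω) ((ℝ≥0 × Ω) × (ℝ × (Fin N → ℝ))) _
      ((completedFiltration μ X hX).predictable.prod inferInstance)
      fun p => (p, (y p, Z p.1 p.2)) :=
    Measurable.prodMk (measurable_id.mono le_rfl hle) (hy.prodMk hZm)
  exact drv.measurable.comp hpair

theorem IsDriver.measurable_zero (drv : IsDriver μ A X hX c' c'' T f) :
    Measurable fun p : ℝ≥0 × Ω => f p.1 p.2 0 0 := by
  have hle := predictable_le (completedFiltration μ X hX)
  have hpair : @Measurable (ℝ≥0 × Ω) ((ℝ≥0 × Ω) × (ℝ × (Fin N → ℝ))) _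
      ((completedFiltration μ X hX).predictable.prod inferInstance)
      fun p => (p, ((0 : ℝ), (0 : Fin N → ℝ))) :=
    Measurable.prodMk (measurable_id.mono le_rfl hle) measurable_const
  exact drv.measurable.comp hpair

end Versions


/-! ### Pathwise consequences of the equation -/

theorem sq_add_add_le (x y z : ℝ≥0∞) : (x + y + z) ^ 2 ≤ 4 * (x ^ 2 + y ^ 2 + z ^ 2) := by
  calc (x + y + z) ^ 2 = (x + (y + z)) ^ 2 := by rw [add_assoc]
    _ ≤ 2 * (x ^ 2 + (y + z) ^ 2) := add_sq_le_two_mul _ _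
    _ ≤ 2 * (x ^ 2 + 2 * (y ^ 2 + z ^ 2)) := by gcongr; exact add_sq_le_two_mul _ _
    _ = 4 * (y ^ 2 + z ^ 2) + 2 * x ^ 2 := by ring
    _ ≤ 4 * (y ^ 2 + z ^ 2) + 4 * x ^ 2 := by gcongr; norm_num
    _ = 4 * (x ^ 2 + y ^ 2 + z ^ 2) := by ring

theorem setLIntegral_Icc_eq (a b : ℝ≥0) (φ : ℝ≥0 → ℝ≥0∞) :
    ∫⁻ t in Set.Icc a b, φ t ∂timeMeasure = ∫⁻ t in Set.Ioc a b, φ t ∂timeMeasure :=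
  (setLIntegral_congr Ioc_ae_eq_Icc).symm

section Estimates

variable {Ω : Type*} [mΩ : MeasurableSpace Ω] {μ : Measure Ω} {N : ℕ}
  {A : ℝ≥0 → Matrix (Fin N) (Fin N) ℝ} {X : ℝ≥0 → Ω → (Fin N → ℝ)} {hX : ∀ t, Measurable (X t)}
  {T : ℝ≥0} {ξ : Ω → ℝ} {f : ℝ≥0 → Ω → ℝ → (Fin N → ℝ) → ℝ} {Y : ℝ≥0 → Ω → ℝ}
  {Z : ℝ≥0 → Ω → (Fin N → ℝ)} {c' c'' : ℝ}

/-- The Lipschitz condition compares the driver with its value at (0, 0). Squaring the three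
resulting integrals and applying Cauchy-Schwarz in time produces the factor b - a that later makes
the two Lipschitz terms small. -/
theorem sq_lintegral_driver_le (h : IsMarkovChain μ A X hX) (hc' : 0 ≤ c') (hc'' : 0 ≤ c'')
    (drv : IsDriver μ A X hX c' c'' T f)
    (hZ : IsStronglyPredictable (completedFiltration μ X hX) Z) {y : ℝ≥0 × Ω → ℝ}
    (hy : Measurable y) {a b : ℝ≥0} (hbT : b ≤ T) :
    ∀ᵐ ω ∂μ, (∫⁻ u in Set.Ioc a b, ‖f u ω (y (u, ω)) (Z u ω)‖ₑ ∂timeMeasure) ^ 2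
      ≤ 4 * ((∫⁻ u in Set.Ioc a b, ‖f u ω 0 0‖ₑ ∂timeMeasure) ^ 2
        + ENNReal.ofReal c' ^ 2 * (((b - a : ℝ≥0) : ℝ≥0∞)
          * ∫⁻ u in Set.Ioc a b, ‖y (u, ω)‖ₑ ^ 2 ∂timeMeasure)
        + ENNReal.ofReal c'' ^ 2 * (((b - a : ℝ≥0) : ℝ≥0∞)
          * ∫⁻ u in Set.Ioc a b, ENNReal.ofReal (normSq A X u ω (Z u ω)) ∂timeMeasure)) := by
  obtain ⟨Q, hQ, hQZ⟩ := h.exists_measurable_normSq T hZ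
  filter_upwards [drv.lipschitz] with ω hω
  have hsub : Set.Ioc a b ⊆ Set.Ioc 0 T := Set.Ioc_subset_Ioc zero_le hbT
  have hQω := ae_restrict_of_ae_restrict_of_subset hsub (hQZ ω)
  have hm0 : Measurable fun u => ‖f u ω 0 0‖ₑ :=
    (drv.measurable_zero.comp measurable_prodMk_right).enorm
  have hmy : Measurable fun u => ‖y (u, ω)‖ₑ := (hy.comp measurable_prodMk_right).enorm
  have hmQ : Measurable fun u => ENNReal.ofReal (√(Q (u, ω))) :=
    ENNReal.measurable_ofReal.comp ((hQ.comp measurable_prodMk_right).sqrt)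
  have hms : Measurable fun u => ‖f u ω 0 0‖ₑ + ENNReal.ofReal c' * ‖y (u, ω)‖ₑ :=
    hm0.add (hmy.const_mul _)
  have huniv : timeMeasure.restrict (Set.Ioc a b) Set.univ = ((b - a : ℝ≥0) : ℝ≥0∞) := by
    rw [Measure.restrict_apply_univ, timeMeasure_Ioc]
  have h1 : ∫⁻ u in Set.Ioc a b, ‖f u ω (y (u, ω)) (Z u ω)‖ₑ ∂timeMeasure
      ≤ ∫⁻ u in Set.Ioc a b, ‖f u ω 0 0‖ₑ ∂timeMeasure
        + ENNReal.ofReal c' * ∫⁻ u in Set.Ioc a b, ‖y (u, ω)‖ₑ ∂timeMeasure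
        + ENNReal.ofReal c'' * ∫⁻ u in Set.Ioc a b, ENNReal.ofReal (√(Q (u, ω))) ∂timeMeasure := by
    rw [← lintegral_const_mul _ hmy, ← lintegral_const_mul _ hmQ, ← lintegral_add_left hm0,
      ← lintegral_add_left hms]
    refine lintegral_mono_ae ?_
    filter_upwards [hQω, ae_restrict_mem measurableSet_Ioc] with u hu hmem
    have hL := hω u (hmem.2.trans hbT) (y (u, ω)) 0 (Z u ω) 0
    rw [sub_zero, sub_zero, seminormX, ← hu] at hL
    have hle : |f u ω (y (u, ω)) (Z u ω)|
        ≤ |f u ω 0 0| + c' * |y (u, ω)| + c'' * √(Q (u, ω)) := by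
      have := abs_sub_abs_le_abs_sub (f u ω (y (u, ω)) (Z u ω)) (f u ω 0 0)
      linarith
    simp only [Real.enorm_eq_ofReal_abs]
    rw [← ENNReal.ofReal_mul hc', ← ENNReal.ofReal_mul hc'', ← ENNReal.ofReal_add (abs_nonneg _)
      (mul_nonneg hc' (abs_nonneg _)), ← ENNReal.ofReal_add (add_nonneg (abs_nonneg _)
      (mul_nonneg hc' (abs_nonneg _))) (mul_nonneg hc'' (Real.sqrt_nonneg _))]
    exact ENNReal.ofReal_le_ofReal hle
  have h2 : (∫⁻ u in Set.Ioc a b, ‖y (u, ω)‖ₑ ∂timeMeasure) ^ 2 ≤ ((b - a : ℝ≥0) : ℝ≥0∞)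
      * ∫⁻ u in Set.Ioc a b, ‖y (u, ω)‖ₑ ^ 2 ∂timeMeasure := by
    rw [← huniv]; exact sq_lintegral_le _ hmy.aemeasurable
  have h3 : (∫⁻ u in Set.Ioc a b, ENNReal.ofReal (√(Q (u, ω))) ∂timeMeasure) ^ 2
      ≤ ((b - a : ℝ≥0) : ℝ≥0∞)
      * ∫⁻ u in Set.Ioc a b, ENNReal.ofReal (normSq A X u ω (Z u ω)) ∂timeMeasure := by
    rw [← huniv]
    refine (sq_lintegral_le _ hmQ.aemeasurable).trans ?_
    gcongr 1
    refine (lintegral_congr_ae ?_).le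
    filter_upwards [hQω, h.ae_leftX_eq a b ω, ae_restrict_mem measurableSet_Ioc] with u hu hl hmem
    rw [hu, ← ENNReal.ofReal_pow (Real.sqrt_nonneg _),
      Real.sq_sqrt (h.normSq_nonneg (pos_of_gt hmem.1) hl _)]
  calc _ ≤ _ := pow_le_pow_left' h1 2
    _ ≤ _ := sq_add_add_le _ _ _
    _ ≤ _ := by
      rw [mul_pow, mul_pow]
      gcongr

variable [IsProbabilityMeasure μ]

omit [IsProbabilityMeasure μ] in
theorem lintegral_normSq_lt_top (sol : IsBSDESolution μ A X hX T ξ f Y Z) {a b : ℝ≥0}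
    (hbT : b ≤ T) :
    ∫⁻ ω, ∫⁻ u in Set.Ioc a b, ENNReal.ofReal (normSq A X u ω (Z u ω)) ∂timeMeasure ∂μ < ∞ := by
  refine lt_of_le_of_lt (lintegral_mono fun ω => lintegral_mono_set ?_) sol.normSq_integrable
  exact fun u hu => ⟨zero_le, hu.2.trans hbT⟩

omit [IsProbabilityMeasure μ] in
theorem lintegral_sq_lt_top (sol : IsBSDESolution μ A X hX T ξ f Y Z) {y : ℝ≥0 × Ω → ℝ}
    (hyY : ∀ᵐ ω ∂μ, ∀ t ≤ T, y (t, ω) = Y t ω) {a b : ℝ≥0} (hbT : b ≤ T) :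
    ∫⁻ ω, ∫⁻ u in Set.Ioc a b, ‖y (u, ω)‖ₑ ^ 2 ∂timeMeasure ∂μ < ∞ := by
  refine (lintegral_mono_ae ?_).trans_lt sol.sq_integrable
  filter_upwards [hyY] with ω hω
  rw [setLIntegral_congr_fun (g := fun u => ‖Y u ω‖ₑ ^ 2) measurableSet_Ioc fun u hu => by
    simp only [hω u (hu.2.trans hbT)]]
  exact lintegral_mono_set fun _ hu => ⟨zero_le, hu.2.trans hbT⟩

theorem lintegral_jumpMark_lt_top (h : IsMarkovChain μ A X hX)
    (sol : IsBSDESolution μ A X hX T ξ f Y Z) {a b : ℝ≥0} (hbT : b ≤ T) (j : Fin N) :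
    ∫⁻ ω, ∫⁻ u in Set.Ioc a b, ENNReal.ofReal |IsMarkovChain.jumpMark X j u ω (Z u ω)|
      * ENNReal.ofReal (jumpRate A X j u ω) ∂timeMeasure ∂μ < ∞ := by
  have := h.lintegral_jumpMark_smul_lt_top (lintegral_normSq_lt_top sol (a := a) hbT)
    (y := fun _ _ => 1) measurable_const (by
      simp only [enorm_one, one_pow, lintegral_const, one_mul, Measure.restrict_apply_univ,
        timeMeasure_Ioc, measure_univ, mul_one]
      exact ENNReal.coe_lt_top) j
  simpa only [one_smul] using this

/-- Almost surely, all integrals of the equation exist and the equation holds between any two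
times. -/
theorem ae_equation (h : IsMarkovChain μ A X hX) (hc' : 0 ≤ c') (hc'' : 0 ≤ c'')
    (drv : IsDriver μ A X hX c' c'' T f) (sol : IsBSDESolution μ A X hX T ξ f Y Z)
    {y : ℝ≥0 × Ω → ℝ} (hy : Measurable y) (hyY : ∀ᵐ ω ∂μ, ∀ t ≤ T, y (t, ω) = Y t ω) :
    ∀ᵐ ω ∂μ, IntegrableOn (fun u => f u ω (y (u, ω)) (Z u ω)) (Set.Ioc 0 T) timeMeasure ∧
      IntegrableOn (fun u => Z u ω ⬝ᵥ (A u *ᵥ X u ω)) (Set.Ioc 0 T) timeMeasure ∧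
      Y T ω = ξ ω ∧
      ∀ s t, s ≤ t → t ≤ T → Y s ω
        = Y t ω + ∫ u in Set.Ioc s t, f u ω (y (u, ω)) (Z u ω) ∂timeMeasure
          - integralM A X Z s t ω := by
  have hQ := lintegral_normSq_lt_top sol (a := 0) le_rfl
  have hY2 := lintegral_sq_lt_top sol hyY (a := 0) le_rfl
  have hF := drv.measurable_comp sol.predictable hy
  obtain ⟨Q, hQm, hQZ⟩ := h.exists_measurable_normSq T sol.predictable
  have hQae : ∀ᵐ ω ∂μ, ∫⁻ u in Set.Ioc 0 T, ENNReal.ofReal (normSq A X u ω (Z u ω)) ∂timeMeasure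
      < ∞ := by
    have e : ∀ ω, ∫⁻ u in Set.Ioc 0 T, ENNReal.ofReal (normSq A X u ω (Z u ω)) ∂timeMeasure
        = ∫⁻ u in Set.Ioc 0 T, ENNReal.ofReal (Q (u, ω)) ∂timeMeasure := fun ω =>
      lintegral_congr_ae ((hQZ ω).mono fun u hu => by simp only [hu])
    simp only [e] at hQ ⊢
    exact ae_lt_top (Measurable.lintegral_prod_right
      (f := fun (ω : Ω) (u : ℝ≥0) => ENNReal.ofReal (Q (u, ω)))
      (ENNReal.measurable_ofReal.comp (hQm.comp measurable_swap))) hQ.ne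
  have hYae : ∀ᵐ ω ∂μ, ∫⁻ u in Set.Ioc 0 T, ‖y (u, ω)‖ₑ ^ 2 ∂timeMeasure < ∞ :=
    ae_lt_top (Measurable.lintegral_prod_right (f := fun (ω : Ω) (u : ℝ≥0) => ‖y (u, ω)‖ₑ ^ 2)
      ((hy.comp measurable_swap).enorm.pow_const 2)) hY2.ne
  have h0ae : ∀ᵐ ω ∂μ, ∫⁻ u in Set.Ioc 0 T, ‖f u ω 0 0‖ₑ ^ 2 ∂timeMeasure < ∞ := by
    have h0 := drv.sq_integrable
    simp only [setLIntegral_Icc_eq] at h0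
    exact ae_lt_top (Measurable.lintegral_prod_right
      (f := fun (ω : Ω) (u : ℝ≥0) => ‖f u ω 0 0‖ₑ ^ 2)
      ((drv.measurable_zero.comp measurable_swap).enorm.pow_const 2)) h0.ne
  have hfin := lintegral_jumpMark_lt_top h sol (a := 0) le_rfl
  have hmark := (h.setIntegral_integralM sol.predictable hfin
    (MeasurableSet.univ (α := Ω))).1
  filter_upwards [hyY, hQae, hYae, h0ae, hmark, sol.equation,
    sq_lintegral_driver_le h hc' hc'' drv sol.predictable hy (a := 0) le_rfl]
    with ω hyω hQω hYω h0ω hmarkω heq hbound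
  have hFint : IntegrableOn (fun u => f u ω (y (u, ω)) (Z u ω)) (Set.Ioc 0 T) timeMeasure := by
    refine ⟨(hF.comp measurable_prodMk_right).aestronglyMeasurable, ?_⟩
    rw [hasFiniteIntegral_iff_enorm]
    have hφ : (∫⁻ u in Set.Ioc 0 T, ‖f u ω 0 0‖ₑ ∂timeMeasure) ^ 2 < ∞ := by
      refine (sq_lintegral_le _
        (drv.measurable_zero.comp measurable_prodMk_right).enorm.aemeasurable).trans_lt ?_
      exact ENNReal.mul_lt_top (measure_lt_top _ _) h0ω
    have : (∫⁻ u in Set.Ioc 0 T, ‖f u ω (y (u, ω)) (Z u ω)‖ₑ ∂timeMeasure) ^ 2 < ∞ := by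
      refine hbound.trans_lt (ENNReal.mul_lt_top (by norm_num)
        (ENNReal.add_lt_top.2 ⟨ENNReal.add_lt_top.2 ⟨hφ, ?_⟩, ?_⟩))
      · exact ENNReal.mul_lt_top (ENNReal.pow_lt_top ENNReal.ofReal_lt_top)
          (ENNReal.mul_lt_top ENNReal.coe_lt_top hYω)
      · exact ENNReal.mul_lt_top (ENNReal.pow_lt_top ENNReal.ofReal_lt_top)
          (ENNReal.mul_lt_top ENNReal.coe_lt_top hQω)
    by_contra hcon
    rw [not_lt, top_le_iff] at hcon
    rw [hcon] at this
    simp at this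
  have hZA := h.integrableOn_dotProduct hmarkω
  have heq' : ∀ t ≤ T, Y t ω = ξ ω
      + ∫ u in Set.Ioc t T, f u ω (y (u, ω)) (Z u ω) ∂timeMeasure - integralM A X Z t T ω := by
    intro t ht
    rw [heq t ht]
    congr 2
    exact setIntegral_congr_fun measurableSet_Ioc fun u hu => by simp only [hyω u hu.2]
  refine ⟨hFint, hZA, ?_, fun s t hst htT => ?_⟩
  · have := heq' T le_rfl
    simpa [integralM] using this
  · have hsub : Set.Ioc s T ⊆ Set.Ioc 0 T := Set.Ioc_subset_Ioc_left zero_le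
    rw [heq' s (hst.trans htT), heq' t htT, setIntegral_Ioc_add hst htT (hFint.mono_set hsub),
      h.integralM_add hst htT (hZA.mono_set hsub)]
    ring

end Estimates


/-! ### The estimate on a short interval -/

/-- Boundedness makes the product of the path with any integrable density integrable, as needed to
separate the terms of Itô's formula. -/
theorem exists_bound_jumpPath {a b : ℝ≥0} (c : ℝ) {g : ℝ≥0 → ℝ} (J : ℝ≥0 → ℝ) (S : Finset ℝ≥0)
    (hg : IntegrableOn g (Set.Ioc a b) timeMeasure) :
    ∃ K, ∀ t ∈ Set.Icc a b, |jumpPath a c g J S t| ≤ K := by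
  refine ⟨|c| + ∫ s in Set.Ioc a b, ‖g s‖ ∂timeMeasure + ∑ u ∈ S, |J u|, fun t ht => ?_⟩
  unfold jumpPath
  have h1 : |∫ s in Set.Ioc a t, g s ∂timeMeasure| ≤ ∫ s in Set.Ioc a b, ‖g s‖ ∂timeMeasure :=
    (norm_integral_le_integral_norm _).trans (setIntegral_mono_set hg.norm
      (Eventually.of_forall fun _ => norm_nonneg _)
      (Set.Ioc_subset_Ioc_right ht.2).eventuallyLE)
  have h2 : |∑ u ∈ S, if u ≤ t then J u else 0| ≤ ∑ u ∈ S, |J u| := by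
    refine (Finset.abs_sum_le_sum_abs _ _).trans (Finset.sum_le_sum fun u _ => ?_)
    split_ifs
    · exact le_rfl
    · simp
  exact (abs_add_le _ _).trans (add_le_add ((abs_add_le _ _).trans (add_le_add le_rfl h1)) h2)

theorem ofReal_integral_le_lintegral {α : Type*} [MeasurableSpace α] {ν : Measure α} {φ : α → ℝ}
    (hφ : Integrable φ ν) : ENNReal.ofReal (∫ x, φ x ∂ν) ≤ ∫⁻ x, ENNReal.ofReal (φ x) ∂ν := by
  rw [integral_eq_lintegral_pos_part_sub_lintegral_neg_part hφ]
  refine (ENNReal.ofReal_le_ofReal (sub_le_self _ ENNReal.toReal_nonneg)).trans ?_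
  exact ENNReal.ofReal_toReal_le

section Estimates

variable {Ω : Type*} [mΩ : MeasurableSpace Ω] {μ : Measure Ω} {N : ℕ}
  {A : ℝ≥0 → Matrix (Fin N) (Fin N) ℝ} {X : ℝ≥0 → Ω → (Fin N → ℝ)} {hX : ∀ t, Measurable (X t)}
  {T : ℝ≥0} {ξ : Ω → ℝ} {f : ℝ≥0 → Ω → ℝ → (Fin N → ℝ) → ℝ} {Y : ℝ≥0 → Ω → ℝ}
  {Z : ℝ≥0 → Ω → (Fin N → ℝ)} {c' c'' : ℝ}

/-- One set of jumps serves all t in [a, b], which puts the integral, as a function of t, in the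
form of `jumpPath`. -/
theorem IsMarkovChain.integralM_eq_sum (h : IsMarkovChain μ A X hX) {a t b : ℝ≥0} (htb : t ≤ b)
    (ω : Ω) : integralM A X Z a t ω
      = (∑ u ∈ h.allJumps a b ω, if u ≤ t then Z u ω ⬝ᵥ (X u ω - leftX X u ω) else 0)
        - ∫ s in Set.Ioc a t, Z s ω ⬝ᵥ (A s *ᵥ X s ω) ∂timeMeasure := by
  unfold integralM
  rw [h.finsum_jumps_eq a t ω fun u => Z u ω, ← Finset.sum_filter]
  congr 1
  refine Finset.sum_congr ?_ fun _ _ => rfl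
  ext u
  simp only [Finset.mem_filter, h.mem_allJumps]
  constructor
  · rintro ⟨hu, hne⟩
    exact ⟨⟨⟨hu.1, hu.2.trans htb⟩, hne⟩, hu.2⟩
  · rintro ⟨⟨hu, hne⟩, hut⟩
    exact ⟨⟨hu.1, hut⟩, hne⟩

theorem measurable_lintegral_driver
    (drv : IsDriver μ A X hX c' c'' T f)
    (hZ : IsStronglyPredictable (completedFiltration μ X hX) Z) {y : ℝ≥0 × Ω → ℝ}
    (hy : Measurable y) (a b : ℝ≥0) :
    Measurable fun ω => ∫⁻ u in Set.Ioc a b, ‖f u ω (y (u, ω)) (Z u ω)‖ₑ ∂timeMeasure :=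
  Measurable.lintegral_prod_right (f := fun (ω : Ω) (u : ℝ≥0) => ‖f u ω (y (u, ω)) (Z u ω)‖ₑ)
    ((drv.measurable_comp hZ hy).comp measurable_swap).enorm

variable [IsProbabilityMeasure μ]

/-- The solution is dominated by a martingale. -/
theorem abs_le_condExp (h : IsMarkovChain μ A X hX) (hc' : 0 ≤ c') (hc'' : 0 ≤ c'')
    (drv : IsDriver μ A X hX c' c'' T f) (sol : IsBSDESolution μ A X hX T ξ f Y Z)
    {y : ℝ≥0 × Ω → ℝ} (hy : Measurable y) (hyY : ∀ᵐ ω ∂μ, ∀ t ≤ T, y (t, ω) = Y t ω)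
    {a t b : ℝ≥0} (hat : a ≤ t) (htb : t ≤ b) (hbT : b ≤ T)
    (hζ : Integrable (fun ω => |Y b ω|
      + (∫⁻ u in Set.Ioc a b, ‖f u ω (y (u, ω)) (Z u ω)‖ₑ ∂timeMeasure).toReal) μ) :
    ∀ᵐ ω ∂μ, |Y t ω| ≤ (μ[fun ω => |Y b ω|
      + (∫⁻ u in Set.Ioc a b, ‖f u ω (y (u, ω)) (Z u ω)‖ₑ ∂timeMeasure).toReal
        | completedFiltration μ X hX t]) ω := by
  set ζ : Ω → ℝ := fun ω => |Y b ω|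
      + (∫⁻ u in Set.Ioc a b, ‖f u ω (y (u, ω)) (Z u ω)‖ₑ ∂timeMeasure).toReal with hζdef
  set W : Ω → ℝ := fun ω => Y b ω
      + ∫ u in Set.Ioc t b, f u ω (y (u, ω)) (Z u ω) ∂timeMeasure with hW
  have hle := (completedFiltration μ X hX).le t
  have hE := ae_equation h hc' hc'' drv sol hy hyY
  have hWζ : ∀ᵐ ω ∂μ, |W ω| ≤ ζ ω := by
    filter_upwards [hE] with ω hω
    refine (abs_add_le _ _).trans (add_le_add le_rfl ?_)
    have hfin : ∫⁻ u in Set.Ioc a b, ‖f u ω (y (u, ω)) (Z u ω)‖ₑ ∂timeMeasure < ∞ :=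
      (hω.1.mono_set (Set.Ioc_subset_Ioc zero_le hbT)).2
    rw [← Real.norm_eq_abs, ← toReal_enorm]
    refine ENNReal.toReal_mono hfin.ne ((enorm_integral_le_lintegral_enorm _).trans ?_)
    exact lintegral_mono_set (Set.Ioc_subset_Ioc_left hat)
  have hWm : AEStronglyMeasurable W μ := by
    refine (sol.measurable_of_le hbT).aestronglyMeasurable.add ?_
    exact (StronglyMeasurable.integral_prod_right
      (f := fun (ω : Ω) (u : ℝ≥0) => f u ω (y (u, ω)) (Z u ω))
      ((drv.measurable_comp sol.predictable hy).comp
        measurable_swap).stronglyMeasurable).aestronglyMeasurable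
  have hWint : Integrable W μ := hζ.mono' hWm (by simpa only [Real.norm_eq_abs] using hWζ)
  have hI := fun B hB => (h.setIntegral_integralM (a := t) (b := b) (B := B) sol.predictable
    (lintegral_jumpMark_lt_top h sol hbT) hB).2
  have hIint := (hI Set.univ MeasurableSet.univ).1
  have hYW : (fun ω => Y t ω) =ᵐ[μ] fun ω => W ω - integralM A X Z t b ω := by
    filter_upwards [hE] with ω hω
    exact hω.2.2.2 t b htb hbT
  have hYint : Integrable (Y t) μ := (hWint.sub hIint).congr hYW.symm
  -- W differs from Y_t by the stochastic integral over (t, b], whose integral over every event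
  -- known at t vanishes.
  have hcond : Y t =ᵐ[μ] μ[W|completedFiltration μ X hX t] := by
    refine ae_eq_condExp_of_forall_setIntegral_eq hle hWint (fun _ _ _ => hYint.integrableOn)
      (fun B hB _ => ?_) (sol.adapted t (htb.trans hbT)).stronglyMeasurable.aestronglyMeasurable
    rw [integral_congr_ae (ae_restrict_of_ae hYW), integral_sub hWint.integrableOn
      hIint.integrableOn, (hI B hB).2, sub_zero]
  have h1 := condExp_mono (m := completedFiltration μ X hX t) hWint hζ
    (hWζ.mono fun ω hω => (le_abs_self _).trans hω)
  have h2 := condExp_mono (m := completedFiltration μ X hX t) hWint.neg hζ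
    (hWζ.mono fun ω hω => (neg_le_abs _).trans hω)
  have h3 := condExp_neg (μ := μ) W (completedFiltration μ X hX t)
  filter_upwards [hcond, h1, h2, h3] with ω e1 e2 e3 e4
  rw [abs_le, e1]
  rw [e4, Pi.neg_apply] at e3
  exact ⟨by linarith, e2⟩

/-- Doob's inequality for the solution. -/
theorem exists_sq_le_of_doob (h : IsMarkovChain μ A X hX) (hc' : 0 ≤ c') (hc'' : 0 ≤ c'')
    (drv : IsDriver μ A X hX c' c'' T f) (sol : IsBSDESolution μ A X hX T ξ f Y Z)
    {y : ℝ≥0 × Ω → ℝ} (hy : Measurable y) (hyY : ∀ᵐ ω ∂μ, ∀ t ≤ T, y (t, ω) = Y t ω)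
    {a b : ℝ≥0} (hab : a ≤ b) (hbT : b ≤ T)
    (hζ : MemLp (fun ω => |Y b ω|
      + (∫⁻ u in Set.Ioc a b, ‖f u ω (y (u, ω)) (Z u ω)‖ₑ ∂timeMeasure).toReal) 2 μ) :
    ∃ R : Ω → ℝ≥0∞, Measurable R ∧ (∀ᵐ ω ∂μ, ∀ t ∈ Set.Icc a b, ‖Y t ω‖ₑ ^ 2 ≤ R ω) ∧
      ∫⁻ ω, R ω ∂μ ≤ 4 * ∫⁻ ω, ‖|Y b ω|
      + (∫⁻ u in Set.Ioc a b, ‖f u ω (y (u, ω)) (Z u ω)‖ₑ ∂timeMeasure).toReal‖ₑ ^ 2 ∂μ := by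
  -- Maxima over finite grids are measurable and satisfy the discrete inequality with a bound
  -- independent of n. Their liminf serves as the bound R.
  set M : ℕ → Ω → ℝ≥0∞ := fun n ω => ⨆ k : ℕ, ⨆ _ : k ≤ n + 1, ‖Y (grid a b n k) ω‖ₑ ^ 2 with hM
  have hMm : ∀ n, Measurable (M n) := fun n => Measurable.iSup fun k => Measurable.iSup fun hk =>
    ((sol.measurable_of_le ((grid_le hab hk).trans hbT)).enorm).pow_const 2
  have hpath : ∀ᵐ ω ∂μ, ∀ t ∈ Set.Icc a b, ‖Y t ω‖ₑ ^ 2 ≤ liminf (fun n => M n ω) atTop := by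
    filter_upwards [sol.right_cont] with ω hω t ht
    -- The cells exclude their left endpoints, so t = a is treated as the grid point of index 0.
    rcases eq_or_lt_of_le ht.1 with rfl | hat
    · refine le_liminf_of_le (by isBoundedDefault) (Eventually.of_forall fun n => ?_)
      exact le_iSup₂_of_le (f := fun k (_ : k ≤ n + 1) => ‖Y (grid a b n k) ω‖ₑ ^ 2) 0 (Nat.zero_le _)
        (by rw [grid_zero])
    · have hmem : t ∈ Set.Ioc a b := ⟨hat, ht.2⟩
      have hc : ContinuousWithinAt (fun s => Y s ω) (Set.Icc t b) t := by
        rcases eq_or_lt_of_le ht.2 with rfl | htb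
        · rw [Set.Icc_self]; exact continuousWithinAt_singleton
        · exact (hω t (htb.trans_le hbT)).mono Set.Icc_subset_Ici_self
      have hlim := tendsto_stepFun_right hmem hc
      have hlim2 : Tendsto (fun n => ‖stepFun a b n (fun k => Y (grid a b n (k + 1)) ω) t‖ₑ ^ 2)
          atTop (𝓝 (‖Y t ω‖ₑ ^ 2)) :=
        (ENNReal.continuous_pow 2).continuousAt.tendsto.comp
          ((continuous_enorm.tendsto _).comp hlim)
      rw [← hlim2.liminf_eq]
      refine liminf_le_liminf (Eventually.of_forall fun n => ?_)
      obtain ⟨k, hk, hmemk⟩ := exists_cell n hmem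
      rw [stepFun_of_mem _ hk hmemk]
      exact le_iSup₂_of_le (f := fun k (_ : k ≤ n + 1) => ‖Y (grid a b n k) ω‖ₑ ^ 2) (k + 1) hk le_rfl
  refine ⟨_, .liminf hMm, hpath, (lintegral_liminf_le hMm).trans ?_⟩
  refine liminf_le_of_le (by isBoundedDefault) fun c hc => ?_
  obtain ⟨n, hn⟩ := hc.exists
  refine hn.trans ?_
  let G : Filtration ℕ mΩ :=
    { seq := fun k => completedFiltration μ X hX (grid a b n k)
      mono' := fun i j hij => (completedFiltration μ X hX).mono (grid_mono a b n hij)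
      le' := fun k => (completedFiltration μ X hX).le _ }
  exact lintegral_iSup_sq_le_of_le_condExp G hζ (n + 1) (fun k => Y (grid a b n k)) fun k hk =>
    abs_le_condExp h hc' hc'' drv sol hy hyY (le_grid a b n k) (grid_le hab hk) hbT
      (hζ.integrable one_le_two)

end Estimates


/-! ### Itô's formula for the solution and the energy estimate -/

section Energy

variable {Ω : Type*} [mΩ : MeasurableSpace Ω] {μ : Measure Ω} {N : ℕ}
  {A : ℝ≥0 → Matrix (Fin N) (Fin N) ℝ} {X : ℝ≥0 → Ω → (Fin N → ℝ)} {hX : ∀ t, Measurable (X t)}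
  {T : ℝ≥0} {ξ : Ω → ℝ} {f : ℝ≥0 → Ω → ℝ → (Fin N → ℝ) → ℝ} {Y : ℝ≥0 → Ω → ℝ}
  {Z : ℝ≥0 → Ω → (Fin N → ℝ)} {c' c'' : ℝ}

/-- Itô's formula for the square of a path that solves the equation. -/
theorem IsMarkovChain.sum_sq_jumps_eq (h : IsMarkovChain μ A X hX) {a b : ℝ≥0} (hab : a ≤ b)
    {F y : ℝ≥0 → ℝ} {v : ℝ≥0 → Ω → ℝ} {ω : Ω} (hF : IntegrableOn F (Set.Ioc a b) timeMeasure)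
    (hZA : IntegrableOn (fun u => Z u ω ⬝ᵥ (A u *ᵥ X u ω)) (Set.Ioc a b) timeMeasure)
    (heq : ∀ t, a ≤ t → t ≤ b →
      y a = y t + ∫ u in Set.Ioc a t, F u ∂timeMeasure - integralM A X Z a t ω)
    (hvm : Measurable fun u => v u ω)
    (hv : ∀ u ∈ Set.Ioc a b, ∀ l, Tendsto y (𝓝[<] u) (𝓝 l) → v u ω = l) :
    (∀ᵐ u ∂timeMeasure.restrict (Set.Ioc a b), v u ω = y u) ∧
      ∑ u ∈ h.allJumps a b ω, (Z u ω ⬝ᵥ (X u ω - leftX X u ω)) ^ 2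
        = y b ^ 2 - y a ^ 2 + 2 * ∫ u in Set.Ioc a b, y u * F u ∂timeMeasure
          - 2 * integralM A X (fun u ω => v u ω • Z u ω) a b ω := by
  set S := h.allJumps a b ω with hS
  set J : ℝ≥0 → ℝ := fun u => Z u ω ⬝ᵥ (X u ω - leftX X u ω) with hJ
  set D : ℝ≥0 → ℝ := fun u => Z u ω ⬝ᵥ (A u *ᵥ X u ω) with hD
  -- Run forward in time from a, the equation has density -F - Z'AX and jumps Z'ΔX.
  set g : ℝ≥0 → ℝ := fun u => -F u - D u with hg
  have hgi : IntegrableOn g (Set.Ioc a b) timeMeasure := hF.neg.sub hZA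
  set P := jumpPath a (y a) g J S with hP
  have hyP : ∀ t ∈ Set.Icc a b, y t = P t := by
    intro t ht
    have hsub : Set.Ioc a t ⊆ Set.Ioc a b := Set.Ioc_subset_Ioc_right ht.2
    have e1 := heq t ht.1 ht.2
    rw [h.integralM_eq_sum ht.2] at e1
    have e2 : ∫ s in Set.Ioc a t, g s ∂timeMeasure
        = -(∫ s in Set.Ioc a t, F s ∂timeMeasure) - ∫ s in Set.Ioc a t, D s ∂timeMeasure := by
      rw [← integral_neg]
      exact integral_sub (hF.mono_set hsub).neg (hZA.mono_set hsub)
    rw [hP, jumpPath, e2]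
    linarith
  have hvP : ∀ u ∈ Set.Ioc a b, v u ω = P u - if u ∈ S then J u else 0 := by
    intro u hu
    refine hv u hu _ ((tendsto_jumpPath_left (y a) J S hgi hu).congr' ?_)
    filter_upwards [Ioo_mem_nhdsLT hu.1] with s hs
    exact (hyP s ⟨hs.1.le, hs.2.le.trans hu.2⟩).symm
  have hae : ∀ᵐ u ∂timeMeasure.restrict (Set.Ioc a b), v u ω = P u := by
    filter_upwards [h.ae_leftX_eq a b ω, ae_restrict_mem measurableSet_Ioc] with u hl hu
    rw [hvP u hu, if_neg, sub_zero]
    intro hmem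
    exact (h.mem_allJumps.1 hmem).2 hl
  refine ⟨?_, ?_⟩
  · filter_upwards [hae, ae_restrict_mem measurableSet_Ioc] with u hu hmem
    rw [hu, hyP u (Set.Ioc_subset_Icc_self hmem)]
  · obtain ⟨K, hK⟩ := exists_bound_jumpPath (y a) J S hgi
    -- The path is measurable because it agrees almost everywhere with its measurable left limits v.
    have hPm : AEStronglyMeasurable P (timeMeasure.restrict (Set.Ioc a b)) :=
      hvm.aestronglyMeasurable.congr hae
    have hPb : ∀ᵐ u ∂timeMeasure.restrict (Set.Ioc a b), ‖P u‖ ≤ K := by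
      filter_upwards [ae_restrict_mem measurableSet_Ioc] with u hu
      exact hK u (Set.Ioc_subset_Icc_self hu)
    have hPF : IntegrableOn (fun u => P u * F u) (Set.Ioc a b) timeMeasure :=
      hF.bdd_mul hPm hPb
    have hPD : IntegrableOn (fun u => P u * D u) (Set.Ioc a b) timeMeasure :=
      hZA.bdd_mul hPm hPb
    have e1 : ∫ u in Set.Ioc a b, P u * g u ∂timeMeasure
        = -(∫ u in Set.Ioc a b, P u * F u ∂timeMeasure)
          - ∫ u in Set.Ioc a b, P u * D u ∂timeMeasure := by
      rw [← integral_neg]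
      refine Eq.trans ?_ (integral_sub hPF.neg hPD)
      congr 1
      ext u
      simp only [hg]
      ring
    have e2 := jumpPath_sq (y a) J S (fun u hu => (h.mem_allJumps.1 hu).1) hgi
    have e3 : integralM A X (fun u ω => v u ω • Z u ω) a b ω
        = ∑ u ∈ S, (P u - J u) * J u - ∫ u in Set.Ioc a b, P u * D u ∂timeMeasure := by
      unfold integralM
      rw [h.finsum_jumps_eq a b ω fun u => v u ω • Z u ω]
      congr 1
      · refine Finset.sum_congr rfl fun u hu => ?_
        rw [hvP u (h.mem_allJumps.1 hu).1, if_pos hu, smul_dotProduct, smul_eq_mul]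
      · refine integral_congr_ae ?_
        filter_upwards [hae] with u hu
        rw [hu, smul_dotProduct, smul_eq_mul]
    have e4 : ∫ u in Set.Ioc a b, y u * F u ∂timeMeasure
        = ∫ u in Set.Ioc a b, P u * F u ∂timeMeasure :=
      setIntegral_congr_fun measurableSet_Ioc fun u hu => by
        simp only [hyP u (Set.Ioc_subset_Icc_self hu)]
    rw [← hP, e1, Finset.sum_add_distrib, ← Finset.mul_sum] at e2
    rw [hyP b ⟨hab, le_rfl⟩, e3, e4]
    linarith

variable [IsProbabilityMeasure μ]

/-- By the isometry the left side is the mean sum of the squared jumps, which Itô's formula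
expresses through Y_b², Y_a², the cross term 2 ∫ Y f ds and an integral against M. The last has mean
zero, Y_a² enters with a minus sign, and the cross term is at most 2 sup|Y| ∫ |f| ds ≤ R + (∫ |f|
ds)². -/
theorem lintegral_normSq_le (h : IsMarkovChain μ A X hX) (hc' : 0 ≤ c') (hc'' : 0 ≤ c'')
    (drv : IsDriver μ A X hX c' c'' T f) (sol : IsBSDESolution μ A X hX T ξ f Y Z)
    {y : ℝ≥0 × Ω → ℝ} (hy : Measurable y) (hyY : ∀ᵐ ω ∂μ, ∀ t ≤ T, y (t, ω) = Y t ω)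
    {a b : ℝ≥0} (hab : a ≤ b) (hbT : b ≤ T) {R : Ω → ℝ≥0∞} (hR : Measurable R)
    (hYR : ∀ᵐ ω ∂μ, ∀ t ∈ Set.Icc a b, ‖Y t ω‖ₑ ^ 2 ≤ R ω) (hRfin : ∫⁻ ω, R ω ∂μ < ∞)
    (hFfin : ∫⁻ ω, (∫⁻ u in Set.Ioc a b, ‖f u ω (y (u, ω)) (Z u ω)‖ₑ ∂timeMeasure) ^ 2 ∂μ < ∞) :
    ∫⁻ ω, ∫⁻ u in Set.Ioc a b, ENNReal.ofReal (normSq A X u ω (Z u ω)) ∂timeMeasure ∂μ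
      ≤ ∫⁻ ω, ‖Y b ω‖ₑ ^ 2 ∂μ + ∫⁻ ω, R ω ∂μ
        + ∫⁻ ω, (∫⁻ u in Set.Ioc a b, ‖f u ω (y (u, ω)) (Z u ω)‖ₑ ∂timeMeasure) ^ 2 ∂μ := by
  set G : Ω → ℝ≥0∞ :=
    fun ω => ∫⁻ u in Set.Ioc a b, ‖f u ω (y (u, ω)) (Z u ω)‖ₑ ∂timeMeasure with hG
  have hGm : Measurable G := measurable_lintegral_driver drv sol.predictable hy a b
  set 𝓕 := completedFiltration μ X hX with h𝓕
  -- Itô's formula integrates Y_- Z against M, so a predictable version of Y_- is required for the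
  -- mean-zero property.
  obtain ⟨v, hvm, hv⟩ := exists_predictable_leftLim 𝓕 hab Y fun t ht => sol.adapted t (ht.trans hbT)
  have hE := ae_equation h hc' hc'' drv sol hy hyY
  have hsub : Set.Ioc a b ⊆ Set.Ioc 0 T := Set.Ioc_subset_Ioc zero_le hbT
  set I : Ω → ℝ := fun ω => integralM A X (fun u ω => v (u, ω) • Z u ω) a b ω with hI
  have hvm' : Measurable v := hvm.mono (predictable_le 𝓕) le_rfl
  have hIto : ∀ᵐ ω ∂μ, (∀ᵐ u ∂timeMeasure.restrict (Set.Ioc a b), v (u, ω) = Y u ω) ∧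
      ∑ u ∈ h.allJumps a b ω, (Z u ω ⬝ᵥ (X u ω - leftX X u ω)) ^ 2
        = Y b ω ^ 2 - Y a ω ^ 2
          + 2 * ∫ u in Set.Ioc a b, Y u ω * f u ω (y (u, ω)) (Z u ω) ∂timeMeasure - 2 * I ω := by
    filter_upwards [hE] with ω hω
    exact h.sum_sq_jumps_eq (v := fun u ω => v (u, ω)) hab (hω.1.mono_set hsub)
      (hω.2.1.mono_set hsub) (fun t hat htb => hω.2.2.2 a t hat (htb.trans hbT))
      (hvm'.comp measurable_prodMk_right) (hv ω)
  have hZ' : IsStronglyPredictable 𝓕 fun u ω => v (u, ω) • Z u ω :=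
    StronglyMeasurable.smul (Measurable.stronglyMeasurable hvm) sol.predictable
  have hv2 : ∫⁻ ω, ∫⁻ u in Set.Ioc a b, ‖v (u, ω)‖ₑ ^ 2 ∂timeMeasure ∂μ < ∞ := by
    refine (lintegral_congr_ae ?_).trans_lt (lintegral_sq_lt_top sol hyY (a := a) hbT)
    filter_upwards [hIto, hyY] with ω hω hyω
    refine lintegral_congr_ae ?_
    filter_upwards [hω.1, ae_restrict_mem measurableSet_Ioc] with u hu hmem
    rw [hu, hyω u (hmem.2.trans hbT)]
  obtain ⟨-, hIint, hI0⟩ := h.setIntegral_integralM hZ'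
    (h.lintegral_jumpMark_smul_lt_top (lintegral_normSq_lt_top sol (a := a) hbT)
      (y := fun u ω => v (u, ω)) hvm' hv2) (MeasurableSet.univ (α := Ω))
  rw [setIntegral_univ] at hI0
  set V : Ω → ℝ := fun ω => Y b ω ^ 2 - Y a ω ^ 2
      + 2 * ∫ u in Set.Ioc a b, y (u, ω) * f u ω (y (u, ω)) (Z u ω) ∂timeMeasure with hV
  have hVm : Measurable V := by
    refine (((sol.measurable_of_le hbT).pow_const 2).sub
      ((sol.measurable_of_le (hab.trans hbT)).pow_const 2)).add (Measurable.const_mul ?_ 2)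
    exact (StronglyMeasurable.integral_prod_right
      (f := fun (ω : Ω) (u : ℝ≥0) => y (u, ω) * f u ω (y (u, ω)) (Z u ω))
      (((hy.mul (drv.measurable_comp sol.predictable hy)).comp
        measurable_swap).stronglyMeasurable)).measurable
  have hcross : ∀ᵐ ω ∂μ,
      ‖2 * ∫ u in Set.Ioc a b, y (u, ω) * f u ω (y (u, ω)) (Z u ω) ∂timeMeasure‖ₑ
        ≤ R ω + G ω ^ 2 := by
    filter_upwards [hyY, hYR] with ω hyω hRω
    -- The square root of R is a bound for |Y| on [a, b] that does not depend on time, so it leaves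
    -- the time integral.
    have hr : (R ω ^ (1 / 2 : ℝ)) ^ 2 = R ω := by
      rw [← ENNReal.rpow_natCast, ← ENNReal.rpow_mul]; norm_num
    have hyr : ∀ u ∈ Set.Ioc a b, ‖y (u, ω)‖ₑ ≤ R ω ^ (1 / 2 : ℝ) := by
      intro u hu
      rw [hyω u (hu.2.trans hbT), ← ENNReal.pow_le_pow_left_iff two_ne_zero, hr]
      exact hRω u (Set.Ioc_subset_Icc_self hu)
    have hm : Measurable fun u => ‖f u ω (y (u, ω)) (Z u ω)‖ₑ :=
      ((drv.measurable_comp sol.predictable hy).comp measurable_prodMk_right).enorm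
    have hi : ‖∫ u in Set.Ioc a b, y (u, ω) * f u ω (y (u, ω)) (Z u ω) ∂timeMeasure‖ₑ
        ≤ R ω ^ (1 / 2 : ℝ) * G ω := by
      refine (enorm_integral_le_lintegral_enorm _).trans ?_
      rw [hG, ← lintegral_const_mul _ hm]
      refine setLIntegral_mono (hm.const_mul _) fun u hu => ?_
      rw [enorm_mul]
      gcongr
      exact hyr u hu
    calc _ = 2 * ‖∫ u in Set.Ioc a b, y (u, ω) * f u ω (y (u, ω)) (Z u ω) ∂timeMeasure‖ₑ := by
          rw [enorm_mul]; congr 1; simp [Real.enorm_eq_ofReal_abs]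
      _ ≤ 2 * (R ω ^ (1 / 2 : ℝ) * G ω) := by gcongr
      _ ≤ (R ω ^ (1 / 2 : ℝ)) ^ 2 + G ω ^ 2 := two_mul_mul_le_sq_add_sq _ _
      _ = _ := by rw [hr]
  have hVint : Integrable V μ := by
    refine ⟨hVm.aestronglyMeasurable, ?_⟩
    rw [hasFiniteIntegral_iff_enorm]
    have : ∫⁻ ω, (R ω + R ω + (R ω + G ω ^ 2)) ∂μ < ∞ := by
      have hRR : Measurable fun ω => R ω + R ω := hR.add hR
      rw [lintegral_add_left hRR, lintegral_add_left hR, lintegral_add_left hR]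
      simp only [ENNReal.add_lt_top]
      exact ⟨⟨hRfin, hRfin⟩, hRfin, hFfin⟩
    refine (lintegral_mono_ae ?_).trans_lt this
    filter_upwards [hcross, hYR] with ω hω hRω
    refine (enorm_add_le _ _).trans (add_le_add ((enorm_sub_le).trans ?_) hω)
    rw [enorm_pow, enorm_pow]
    exact add_le_add (hRω b ⟨hab, le_rfl⟩) (hRω a ⟨le_rfl, hab⟩)
  have hsum : ∀ᵐ ω ∂μ, ∑ u ∈ h.allJumps a b ω, (Z u ω ⬝ᵥ (X u ω - leftX X u ω)) ^ 2
      = V ω - 2 * I ω := by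
    filter_upwards [hIto, hyY] with ω hω hyω
    rw [hω.2, hV]
    congr 3
    exact setIntegral_congr_fun measurableSet_Ioc fun u hu => by
      simp only [hyω u (hu.2.trans hbT)]
  -- V - 2I is almost surely a sum of squares. Being nonnegative and integrable, its lower integral
  -- is an ordinary one, in which I contributes nothing.
  have hVI : Integrable (fun ω => V ω - 2 * I ω) μ := hVint.sub (hIint.const_mul 2)
  rw [← h.lintegral_sum_sq_jumps a b sol.predictable]
  calc ∫⁻ ω, ∑ u ∈ h.allJumps a b ω, ENNReal.ofReal ((Z u ω ⬝ᵥ (X u ω - leftX X u ω)) ^ 2) ∂μ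
      = ∫⁻ ω, ENNReal.ofReal (V ω - 2 * I ω) ∂μ := by
        refine lintegral_congr_ae ?_
        filter_upwards [hsum] with ω hω
        rw [← hω, ENNReal.ofReal_sum_of_nonneg fun _ _ => sq_nonneg _]
    _ = ENNReal.ofReal (∫ ω, (V ω - 2 * I ω) ∂μ) := by
        refine (ofReal_integral_eq_lintegral_ofReal hVI ?_).symm
        filter_upwards [hsum] with ω hω
        rw [Pi.zero_apply, ← hω]
        exact Finset.sum_nonneg fun _ _ => sq_nonneg _
    _ = ENNReal.ofReal (∫ ω, V ω ∂μ) := by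
        rw [integral_sub hVint (hIint.const_mul 2), integral_const_mul, hI0, mul_zero, sub_zero]
    _ ≤ ∫⁻ ω, ENNReal.ofReal (V ω) ∂μ := ofReal_integral_le_lintegral hVint
    _ ≤ ∫⁻ ω, (‖Y b ω‖ₑ ^ 2 + (R ω + G ω ^ 2)) ∂μ := by
        refine lintegral_mono_ae ?_
        filter_upwards [hcross] with ω hω
        -- The term -Y_a² is dropped.
        refine (ENNReal.ofReal_le_ofReal (add_le_add (sub_le_self _ (sq_nonneg _)) le_rfl)).trans ?_
        refine ENNReal.ofReal_add_le.trans (add_le_add ?_ ?_)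
        · rw [← enorm_pow, Real.enorm_eq_ofReal (sq_nonneg _)]
        · refine le_trans ?_ hω
          rw [Real.enorm_eq_ofReal_abs]
          exact ENNReal.ofReal_le_ofReal (le_abs_self _)
    _ = _ := by
        rw [lintegral_add_left ((sol.measurable_of_le hbT).enorm.pow_const 2),
          lintegral_add_left hR, add_assoc]

end Energy


/-! ### Absorption on short intervals and backward iteration -/

theorem add_le_of_short {E Φ G S q : ℝ≥0∞} {k : ℝ≥0} (hk : 136 * k ≤ 1) (hE : E ≠ ∞) (hΦ : Φ ≠ ∞)
    (hG : G ≠ ∞) (hS : S ≠ ∞) (hq : q ≠ ∞) (h1 : G ≤ 4 * (Φ + k * S + k * q))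
    (h2 : S ≤ 8 * (E + G)) (h3 : q ≤ E + S + G) : S + q ≤ 136 * (E + Φ) := by
  lift E to ℝ≥0 using hE
  lift Φ to ℝ≥0 using hΦ
  lift G to ℝ≥0 using hG
  lift S to ℝ≥0 using hS
  lift q to ℝ≥0 using hq
  norm_cast at h1 h2 h3 ⊢
  rw [← NNReal.coe_le_coe] at hk h1 h2 h3 ⊢
  push_cast at hk h1 h2 h3 ⊢
  -- The hypotheses give S + q ≤ 17 (E + G) and G ≤ 4Φ + (S + q)/34, so half of S + q is absorbed
  -- and S + q ≤ 34 E + 136 Φ. Finiteness of all quantities permits the subtraction.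
  have hkS : 136 * ((k : ℝ) * S) ≤ S := by
    nlinarith [mul_le_mul_of_nonneg_right hk S.coe_nonneg]
  have hkq : 136 * ((k : ℝ) * q) ≤ q := by
    nlinarith [mul_le_mul_of_nonneg_right hk q.coe_nonneg]
  have := E.coe_nonneg
  have := Φ.coe_nonneg
  linarith

section Estimates

variable {Ω : Type*} [mΩ : MeasurableSpace Ω] {μ : Measure Ω} {N : ℕ}
  {A : ℝ≥0 → Matrix (Fin N) (Fin N) ℝ} {X : ℝ≥0 → Ω → (Fin N → ℝ)} {hX : ∀ t, Measurable (X t)}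
  {T : ℝ≥0} {ξ : Ω → ℝ} {f : ℝ≥0 → Ω → ℝ → (Fin N → ℝ) → ℝ} {Y : ℝ≥0 → Ω → ℝ}
  {Z : ℝ≥0 → Ω → (Fin N → ℝ)} {c' c'' : ℝ}

theorem IsDriver.measurable_lintegral_zero (drv : IsDriver μ A X hX c' c'' T f) (a b : ℝ≥0) :
    Measurable fun ω => ∫⁻ u in Set.Ioc a b, ‖f u ω 0 0‖ₑ ∂timeMeasure :=
  Measurable.lintegral_prod_right (f := fun (ω : Ω) (u : ℝ≥0) => ‖f u ω 0 0‖ₑ)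
    (drv.measurable_zero.comp measurable_swap).enorm

theorem IsDriver.lintegral_sq_zero_lt_top (drv : IsDriver μ A X hX c' c'' T f) :
    ∫⁻ ω, (∫⁻ u in Set.Ioc 0 T, ‖f u ω 0 0‖ₑ ∂timeMeasure) ^ 2 ∂μ < ∞ := by
  have h0 := drv.sq_integrable
  simp only [setLIntegral_Icc_eq] at h0
  calc ∫⁻ ω, (∫⁻ u in Set.Ioc 0 T, ‖f u ω 0 0‖ₑ ∂timeMeasure) ^ 2 ∂μ
      ≤ ∫⁻ ω, timeMeasure.restrict (Set.Ioc 0 T) Set.univ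
        * ∫⁻ u in Set.Ioc 0 T, ‖f u ω 0 0‖ₑ ^ 2 ∂timeMeasure ∂μ :=
        lintegral_mono fun ω => sq_lintegral_le _
          (drv.measurable_zero.comp measurable_prodMk_right).enorm.aemeasurable
    _ = timeMeasure.restrict (Set.Ioc 0 T) Set.univ
        * ∫⁻ ω, ∫⁻ u in Set.Ioc 0 T, ‖f u ω 0 0‖ₑ ^ 2 ∂timeMeasure ∂μ :=
        lintegral_const_mul' _ _ (measure_ne_top _ _)
    _ < ∞ := ENNReal.mul_lt_top (measure_lt_top _ _) h0

theorem IsMarkovChain.lintegral_normSq_add (h : IsMarkovChain μ A X hX)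
    (hZ : IsStronglyPredictable (completedFiltration μ X hX) Z) {a b c : ℝ≥0} (hab : a ≤ b)
    (hbc : b ≤ c) :
    ∫⁻ ω, ∫⁻ u in Set.Ioc a c, ENNReal.ofReal (normSq A X u ω (Z u ω)) ∂timeMeasure ∂μ
      = ∫⁻ ω, ∫⁻ u in Set.Ioc a b, ENNReal.ofReal (normSq A X u ω (Z u ω)) ∂timeMeasure ∂μ
        + ∫⁻ ω, ∫⁻ u in Set.Ioc b c, ENNReal.ofReal (normSq A X u ω (Z u ω)) ∂timeMeasure ∂μ := by
  obtain ⟨Q, hQ, hQZ⟩ := h.exists_measurable_normSq b hZ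
  have hm : Measurable fun ω => ∫⁻ u in Set.Ioc a b,
      ENNReal.ofReal (normSq A X u ω (Z u ω)) ∂timeMeasure := by
    have e : ∀ ω, ∫⁻ u in Set.Ioc a b, ENNReal.ofReal (normSq A X u ω (Z u ω)) ∂timeMeasure
        = ∫⁻ u in Set.Ioc a b, ENNReal.ofReal (Q (u, ω)) ∂timeMeasure := fun ω =>
      lintegral_congr_ae ((ae_restrict_of_ae_restrict_of_subset
        (Set.Ioc_subset_Ioc_left zero_le) (hQZ ω)).mono fun u hu => by simp only [hu])
    simp only [e]
    exact Measurable.lintegral_prod_right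
      (f := fun (ω : Ω) (u : ℝ≥0) => ENNReal.ofReal (Q (u, ω)))
      (ENNReal.measurable_ofReal.comp (hQ.comp measurable_swap))
  rw [← lintegral_add_left hm]
  refine lintegral_congr fun ω => ?_
  rw [← Set.Ioc_union_Ioc_eq_Ioc hab hbc, lintegral_union measurableSet_Ioc
    (Set.Ioc_disjoint_Ioc_of_le le_rfl)]

variable [IsProbabilityMeasure μ]

/-- The estimate on an interval whose length is small in terms of the Lipschitz constants. -/
theorem exists_estimate_of_short (h : IsMarkovChain μ A X hX) (hc' : 0 ≤ c') (hc'' : 0 ≤ c'')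
    (drv : IsDriver μ A X hX c' c'' T f) (sol : IsBSDESolution μ A X hX T ξ f Y Z)
    {a b δ : ℝ≥0} (hab : a ≤ b) (hbT : b ≤ T) (hδ : b - a ≤ δ)
    (hδ' : 136 * (c' ^ 2 * (δ * δ)) ≤ 1) (hδ'' : 136 * (c'' ^ 2 * δ) ≤ 1)
    (hb : ∫⁻ ω, ‖Y b ω‖ₑ ^ 2 ∂μ < ∞) :
    ∃ R : Ω → ℝ≥0∞, Measurable R ∧ (∀ᵐ ω ∂μ, ∀ t ∈ Set.Icc a b, ‖Y t ω‖ₑ ^ 2 ≤ R ω) ∧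
      ∫⁻ ω, R ω ∂μ
        + ∫⁻ ω, ∫⁻ u in Set.Ioc a b, ENNReal.ofReal (normSq A X u ω (Z u ω)) ∂timeMeasure ∂μ
      ≤ 136 * (∫⁻ ω, ‖Y b ω‖ₑ ^ 2 ∂μ
        + ∫⁻ ω, (∫⁻ u in Set.Ioc a b, ‖f u ω 0 0‖ₑ ∂timeMeasure) ^ 2 ∂μ) := by
  obtain ⟨y, hy, hyY⟩ := sol.exists_measurable
  set G : Ω → ℝ≥0∞ :=
    fun ω => ∫⁻ u in Set.Ioc a b, ‖f u ω (y (u, ω)) (Z u ω)‖ₑ ∂timeMeasure with hG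
  have hGm : Measurable G := measurable_lintegral_driver drv sol.predictable hy a b
  set φ : Ω → ℝ≥0∞ := fun ω => ∫⁻ u in Set.Ioc a b, ‖f u ω 0 0‖ₑ ∂timeMeasure with hφ
  have hφm : Measurable φ := drv.measurable_lintegral_zero a b
  set q := ∫⁻ ω, ∫⁻ u in Set.Ioc a b, ENNReal.ofReal (normSq A X u ω (Z u ω)) ∂timeMeasure ∂μ
    with hq
  have hqfin : q < ∞ := lintegral_normSq_lt_top sol hbT
  set y2 := ∫⁻ ω, ∫⁻ u in Set.Ioc a b, ‖y (u, ω)‖ₑ ^ 2 ∂timeMeasure ∂μ with hy2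
  have hy2fin : y2 < ∞ := lintegral_sq_lt_top sol hyY hbT
  have hy2m : Measurable fun ω => ∫⁻ u in Set.Ioc a b, ‖y (u, ω)‖ₑ ^ 2 ∂timeMeasure :=
    Measurable.lintegral_prod_right (f := fun (ω : Ω) (u : ℝ≥0) => ‖y (u, ω)‖ₑ ^ 2)
      ((hy.comp measurable_swap).enorm.pow_const 2)
  have hYbm : Measurable fun ω => ‖Y b ω‖ₑ ^ 2 := (sol.measurable_of_le hbT).enorm.pow_const 2
  set κ' := ENNReal.ofReal c' ^ 2 * ((b - a : ℝ≥0) : ℝ≥0∞) with hκ'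
  set κ'' := ENNReal.ofReal c'' ^ 2 * ((b - a : ℝ≥0) : ℝ≥0∞) with hκ''
  have hκ'fin : κ' ≠ ∞ := by finiteness
  have hκ''fin : κ'' ≠ ∞ := by finiteness
  have hΦfin : ∫⁻ ω, φ ω ^ 2 ∂μ < ∞ := by
    refine (lintegral_mono fun ω => ?_).trans_lt drv.lintegral_sq_zero_lt_top
    gcongr
    exact lintegral_mono_set (Set.Ioc_subset_Ioc zero_le hbT)
  have hGle : ∫⁻ ω, G ω ^ 2 ∂μ ≤ 4 * (∫⁻ ω, φ ω ^ 2 ∂μ + κ' * y2 + κ'' * q) := by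
    have hsum : Measurable fun ω =>
        φ ω ^ 2 + κ' * ∫⁻ u in Set.Ioc a b, ‖y (u, ω)‖ₑ ^ 2 ∂timeMeasure :=
      (hφm.pow_const 2).add (hy2m.const_mul _)
    refine (lintegral_mono_ae
      (sq_lintegral_driver_le h hc' hc'' drv sol.predictable hy (a := a) hbT)).trans ?_
    rw [lintegral_const_mul' _ _ (by norm_num), hy2, hq, ← lintegral_const_mul' _ _ hκ'fin,
      ← lintegral_const_mul' _ _ hκ''fin, ← lintegral_add_left (hφm.pow_const 2),
      ← lintegral_add_left hsum]
    simp only [hκ', hκ'', mul_assoc]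
    exact le_rfl
  have hGfin : ∫⁻ ω, G ω ^ 2 ∂μ < ∞ := by
    refine hGle.trans_lt ?_
    finiteness
  have hζle : ∫⁻ ω, ‖|Y b ω| + (G ω).toReal‖ₑ ^ 2 ∂μ
      ≤ 2 * (∫⁻ ω, ‖Y b ω‖ₑ ^ 2 ∂μ + ∫⁻ ω, G ω ^ 2 ∂μ) := by
    rw [← lintegral_add_left hYbm, ← lintegral_const_mul' _ _ (by norm_num)]
    refine lintegral_mono fun ω => ?_
    calc ‖|Y b ω| + (G ω).toReal‖ₑ ^ 2 ≤ (‖Y b ω‖ₑ + G ω) ^ 2 := by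
          gcongr
          refine (enorm_add_le _ _).trans (add_le_add (Real.enorm_abs _).le ?_)
          rw [Real.enorm_eq_ofReal ENNReal.toReal_nonneg]
          exact ENNReal.ofReal_toReal_le
      _ ≤ _ := add_sq_le_two_mul _ _
  have hζ : MemLp (fun ω => |Y b ω| + (G ω).toReal) 2 μ := by
    refine ⟨((sol.measurable_of_le hbT).abs.add hGm.ennreal_toReal).aestronglyMeasurable, ?_⟩
    rw [eLpNorm_lt_top_iff_lintegral_rpow_enorm_lt_top two_ne_zero ENNReal.ofNat_ne_top]
    simp only [ENNReal.toReal_ofNat, ENNReal.rpow_ofNat]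
    exact hζle.trans_lt (by finiteness)
  obtain ⟨R, hR, hYR, hRle⟩ := exists_sq_le_of_doob h hc' hc'' drv sol hy hyY hab hbT hζ
  have hSle : ∫⁻ ω, R ω ∂μ ≤ 8 * (∫⁻ ω, ‖Y b ω‖ₑ ^ 2 ∂μ + ∫⁻ ω, G ω ^ 2 ∂μ) := by
    refine hRle.trans ((mul_le_mul_right hζle 4).trans_eq ?_)
    rw [← mul_assoc]
    norm_num
  have hSfin : ∫⁻ ω, R ω ∂μ < ∞ := hSle.trans_lt (by finiteness)
  have hqle := lintegral_normSq_le h hc' hc'' drv sol hy hyY hab hbT hR hYR hSfin hGfin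
  -- Bounding the time integral of Y² by its supremum gains a second factor b - a, whence the
  -- condition on c'² δ² rather than on c'² δ.
  have hy2le : y2 ≤ ((b - a : ℝ≥0) : ℝ≥0∞) * ∫⁻ ω, R ω ∂μ := by
    rw [← lintegral_const_mul' _ _ ENNReal.coe_ne_top]
    refine lintegral_mono_ae ?_
    filter_upwards [hYR, hyY] with ω hω hyω
    calc ∫⁻ u in Set.Ioc a b, ‖y (u, ω)‖ₑ ^ 2 ∂timeMeasure
        ≤ ∫⁻ _ in Set.Ioc a b, R ω ∂timeMeasure := by
          refine setLIntegral_mono measurable_const fun u hu => ?_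
          rw [hyω u (hu.2.trans hbT)]
          exact hω u (Set.Ioc_subset_Icc_self hu)
      _ = _ := by rw [setLIntegral_const, timeMeasure_Ioc, mul_comm]
  refine ⟨R, hR, hYR, ?_⟩
  have hconv : ∀ (c r : ℝ), 0 ≤ c → 136 * (c ^ 2 * r) ≤ 1 → ENNReal.ofReal c ^ 2 * ENNReal.ofReal r
      ≤ ((1 / 136 : ℝ≥0) : ℝ≥0∞) := by
    intro c r hc hr
    rw [← ENNReal.ofReal_pow hc, ← ENNReal.ofReal_mul (sq_nonneg c), ENNReal.ofReal_le_coe]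
    push_cast
    linarith
  have hδe : ((b - a : ℝ≥0) : ℝ≥0∞) ≤ ENNReal.ofReal δ := by
    rw [ENNReal.ofReal_coe_nnreal]; exact_mod_cast hδ
  refine add_le_of_short (k := 1 / 136) (by norm_num) hb.ne hΦfin.ne hGfin.ne hSfin.ne hqfin.ne
    (hGle.trans ?_) hSle hqle
  refine mul_le_mul_right (add_le_add (add_le_add le_rfl ?_) (mul_le_mul_left ?_ q)) 4
  · calc κ' * y2 ≤ κ' * (((b - a : ℝ≥0) : ℝ≥0∞) * ∫⁻ ω, R ω ∂μ) := by gcongr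
      _ = ENNReal.ofReal c' ^ 2 * (((b - a : ℝ≥0) : ℝ≥0∞) * ((b - a : ℝ≥0) : ℝ≥0∞))
          * ∫⁻ ω, R ω ∂μ := by rw [hκ']; ring
      _ ≤ ENNReal.ofReal c' ^ 2 * (ENNReal.ofReal δ * ENNReal.ofReal δ) * ∫⁻ ω, R ω ∂μ := by
          gcongr
      _ ≤ _ := by
          rw [← ENNReal.ofReal_mul δ.coe_nonneg]
          gcongr
          exact hconv c' _ hc' hδ'
  · calc κ'' ≤ ENNReal.ofReal c'' ^ 2 * ENNReal.ofReal δ := by rw [hκ'']; gcongr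
      _ ≤ _ := hconv c'' _ hc'' hδ''

/-- Backward iteration of the estimate over `k` intervals of length `δ`. -/
theorem exists_estimate_iterate (h : IsMarkovChain μ A X hX) (hc' : 0 ≤ c') (hc'' : 0 ≤ c'')
    (drv : IsDriver μ A X hX c' c'' T f) (sol : IsBSDESolution μ A X hX T ξ f Y Z)
    (hξ : MemLp ξ 2 μ) {δ : ℝ≥0} (hδ' : 136 * (c' ^ 2 * (δ * δ)) ≤ 1)
    (hδ'' : 136 * (c'' ^ 2 * δ) ≤ 1) (k : ℕ) :
    ∃ R : Ω → ℝ≥0∞, Measurable R ∧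
      (∀ᵐ ω ∂μ, ∀ t ∈ Set.Icc (T - k * δ) T, ‖Y t ω‖ₑ ^ 2 ≤ R ω) ∧
      ∫⁻ ω, R ω ∂μ + ∫⁻ ω, ∫⁻ u in Set.Ioc (T - k * δ) T,
          ENNReal.ofReal (normSq A X u ω (Z u ω)) ∂timeMeasure ∂μ
      ≤ 273 ^ k * (∫⁻ ω, ‖ξ ω‖ₑ ^ 2 ∂μ
        + ∫⁻ ω, (∫⁻ u in Set.Ioc 0 T, ‖f u ω 0 0‖ₑ ∂timeMeasure) ^ 2 ∂μ) := by
  have hξfin : ∫⁻ ω, ‖ξ ω‖ₑ ^ 2 ∂μ < ∞ := by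
    have := hξ.2
    rw [eLpNorm_lt_top_iff_lintegral_rpow_enorm_lt_top two_ne_zero ENNReal.ofNat_ne_top] at this
    simpa only [ENNReal.toReal_ofNat, ENNReal.rpow_ofNat] using this
  have hΦfin := drv.lintegral_sq_zero_lt_top
  obtain ⟨y, hy, hyY⟩ := sol.exists_measurable
  have hE := ae_equation h hc' hc'' drv sol hy hyY
  have hYT : ∫⁻ ω, ‖Y T ω‖ₑ ^ 2 ∂μ = ∫⁻ ω, ‖ξ ω‖ₑ ^ 2 ∂μ :=
    lintegral_congr_ae (hE.mono fun ω hω => by simp only [hω.2.2.1])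
  set B := ∫⁻ ω, ‖ξ ω‖ₑ ^ 2 ∂μ
        + ∫⁻ ω, (∫⁻ u in Set.Ioc 0 T, ‖f u ω 0 0‖ₑ ∂timeMeasure) ^ 2 ∂μ with hB
  have hBfin : B < ∞ := ENNReal.add_lt_top.2 ⟨hξfin, hΦfin⟩
  induction k with
  | zero =>
    refine ⟨fun ω => ‖Y T ω‖ₑ ^ 2, (sol.measurable_of_le le_rfl).enorm.pow_const 2, ?_, ?_⟩
    · refine Eventually.of_forall fun ω t ht => ?_
      simp only [Nat.cast_zero, zero_mul, tsub_zero, Set.Icc_self, Set.mem_singleton_iff] at ht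
      rw [ht]
    · simp only [Nat.cast_zero, zero_mul, tsub_zero, Set.Ioc_self, Measure.restrict_empty,
        lintegral_zero_measure, lintegral_zero, add_zero, pow_zero, one_mul, hYT]
      exact le_self_add
  | succ k ih =>
    obtain ⟨R, hR, hYR, hle⟩ := ih
    set b := T - k * δ with hb
    -- Subtraction is truncated at 0, so a stays in [0, T] for every k; the interval is then only
    -- shorter, and b - a ≤ δ still holds.
    set a := T - ((k + 1 : ℕ) : ℝ≥0) * δ with ha
    have hbT : b ≤ T := tsub_le_self
    have hab : a ≤ b := tsub_le_tsub_left (by gcongr; exact k.le_succ) T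
    have haδ : b - a ≤ δ := by
      rw [tsub_le_iff_left, hb, tsub_le_iff_right, ha]
      have : T ≤ (T - ((k + 1 : ℕ) : ℝ≥0) * δ) + ((k + 1 : ℕ) : ℝ≥0) * δ := le_tsub_add
      refine this.trans_eq ?_
      push_cast
      ring
    have hEb : ∫⁻ ω, ‖Y b ω‖ₑ ^ 2 ∂μ ≤ 273 ^ k * B :=
      (lintegral_mono_ae (hYR.mono fun ω hω => hω b ⟨le_rfl, hbT⟩)).trans
        (le_self_add.trans hle)
    obtain ⟨R', hR', hYR', hle'⟩ := exists_estimate_of_short h hc' hc'' drv sol hab hbT haδ hδ' hδ''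
      (hEb.trans_lt (by finiteness))
    -- The sum dominates both bounds, hence the supremum over the union of the two intervals.
    refine ⟨fun ω => R' ω + R ω, hR'.add hR, ?_, ?_⟩
    · filter_upwards [hYR, hYR'] with ω hω hω' t ht
      rcases le_total t b with htb | htb
      · exact (hω' t ⟨ht.1, htb⟩).trans le_self_add
      · exact (hω t ⟨htb, ht.2⟩).trans le_add_self
    · rw [lintegral_add_left hR', h.lintegral_normSq_add sol.predictable hab hbT]
      have hφ : ∫⁻ ω, (∫⁻ u in Set.Ioc a b, ‖f u ω 0 0‖ₑ ∂timeMeasure) ^ 2 ∂μ ≤ B := by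
        refine le_trans (lintegral_mono fun ω => ?_) le_add_self
        exact pow_le_pow_left' (lintegral_mono_set (Set.Ioc_subset_Ioc zero_le hbT)) 2
      have h1 : (1 : ℝ≥0∞) ≤ 273 ^ k := one_le_pow₀ (by norm_num)
      calc _ = (∫⁻ ω, R' ω ∂μ + ∫⁻ ω, ∫⁻ u in Set.Ioc a b,
              ENNReal.ofReal (normSq A X u ω (Z u ω)) ∂timeMeasure ∂μ)
            + (∫⁻ ω, R ω ∂μ + ∫⁻ ω, ∫⁻ u in Set.Ioc b T,
              ENNReal.ofReal (normSq A X u ω (Z u ω)) ∂timeMeasure ∂μ) := by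
            rw [add_add_add_comm]
        -- Both the terminal value at b and the driver term are at most 273^k B, and 2 · 136 + 1 =
        -- 273.
        _ ≤ 136 * (273 ^ k * B + 273 ^ k * B) + 273 ^ k * B := by
            refine add_le_add (hle'.trans ?_) hle
            gcongr
            exact hφ.trans (le_mul_of_one_le_left zero_le h1)
        _ = 273 ^ (k + 1) * B := by ring

end Estimates

end MarkovBSDE

end

/-! ### The a priori estimate on the whole interval -/

theorem proposition3p2 (c' c'' : ℝ) (hc' : 0 ≤ c') (hc'' : 0 ≤ c'') (T : ℝ≥0) :
    ∃ C' : ℝ, 0 < C' ∧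
      ∀ {N : ℕ} {Ω : Type*} [MeasurableSpace Ω] (μ : Measure Ω) [IsProbabilityMeasure μ]
        (A : ℝ≥0 → Matrix (Fin N) (Fin N) ℝ) (X : ℝ≥0 → Ω → (Fin N → ℝ))
        (hX : ∀ t, Measurable (X t)) (_ : MarkovBSDE.IsMarkovChain μ A X hX)
        (ξ : Ω → ℝ) (_ : Measurable[MarkovBSDE.completedFiltration μ X hX T] ξ)
        (_ : MemLp ξ 2 μ)
        (f : ℝ≥0 → Ω → ℝ → (Fin N → ℝ) → ℝ)
        (_ : MarkovBSDE.IsDriver μ A X hX c' c'' T f)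
        (Y : ℝ≥0 → Ω → ℝ) (Z : ℝ≥0 → Ω → (Fin N → ℝ))
        (_ : MarkovBSDE.IsBSDESolution μ A X hX T ξ f Y Z),
        (∫⁻ ω, ⨆ t : ℝ≥0, ⨆ _ : t ≤ T, ‖Y t ω‖ₑ ^ 2 ∂μ)
          + ∫⁻ ω, ∫⁻ t in Set.Icc 0 T,
              ENNReal.ofReal (MarkovBSDE.normSq A X t ω (Z t ω)) ∂MarkovBSDE.timeMeasure ∂μ
        ≤ ENNReal.ofReal C' *
            ∫⁻ ω, (‖ξ ω‖ₑ ^ 2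
              + (∫⁻ s in Set.Icc 0 T, ‖f s ω 0 0‖ₑ ∂MarkovBSDE.timeMeasure) ^ 2) ∂μ := by
  -- With n = m + 1 intervals of length T/n both smallness conditions hold. Since n ≥ 1, also n² ≥
  -- m, which covers the condition quadratic in the length; and T/n is defined even if m = 0.
  obtain ⟨m, hm⟩ := exists_nat_ge (136 * (c' ^ 2 * (T * T)) + 136 * (c'' ^ 2 * T))
  have hT : (0 : ℝ) ≤ T := T.coe_nonneg
  have hn : (0 : ℝ) < (m + 1 : ℕ) := by positivity
  have hn1 : (1 : ℝ) ≤ (m + 1 : ℕ) := by exact_mod_cast Nat.le_add_left 1 m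
  have hmn : (m : ℝ) ≤ (m + 1 : ℕ) := by exact_mod_cast m.le_succ
  set n := m + 1
  set δ : ℝ≥0 := T / n with hδ
  have hp' : 0 ≤ c' ^ 2 * ((T : ℝ) * T) := by positivity
  have hp'' : 0 ≤ c'' ^ 2 * (T : ℝ) := by positivity
  have hδ' : 136 * (c' ^ 2 * ((δ : ℝ) * δ)) ≤ 1 := by
    have e : 136 * (c' ^ 2 * ((δ : ℝ) * δ)) = 136 * (c' ^ 2 * (T * T)) / (n * n) := by
      rw [hδ]; push_cast; field_simp
    rw [e, div_le_one (by positivity)]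
    nlinarith
  have hδ'' : 136 * (c'' ^ 2 * (δ : ℝ)) ≤ 1 := by
    have e : 136 * (c'' ^ 2 * (δ : ℝ)) = 136 * (c'' ^ 2 * T) / n := by
      rw [hδ]; push_cast; field_simp
    rw [e, div_le_one hn]
    linarith
  refine ⟨273 ^ n, by positivity, ?_⟩
  intro N Ω _ μ _ A X hX h ξ hξm hξ f drv Y Z sol
  obtain ⟨R, hR, hYR, hle⟩ :=
    MarkovBSDE.exists_estimate_iterate h hc' hc'' drv sol hξ hδ' hδ'' n
  have hnδ : T - n * δ = 0 := by
    rw [hδ, mul_div_cancel₀ _ (by exact_mod_cast hn.ne'), tsub_self]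
  rw [hnδ] at hYR hle
  have e : ENNReal.ofReal (273 ^ n) = 273 ^ n := by
    rw [ENNReal.ofReal_pow (by norm_num), ENNReal.ofReal_ofNat]
  have hξ2 : Measurable fun ω => ‖ξ ω‖ₑ ^ 2 :=
    ((hξm.mono ((MarkovBSDE.completedFiltration μ X hX).le T) le_rfl).enorm).pow_const 2
  simp only [MarkovBSDE.setLIntegral_Icc_eq]
  rw [e, lintegral_add_left hξ2]
  -- The supremum over uncountably many times need not be known to be measurable: the lower integral
  -- is monotone for arbitrary functions, and R is a measurable almost sure bound.
  refine le_trans (add_le_add (lintegral_mono_ae ?_) le_rfl) hle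
  filter_upwards [hYR] with ω hω
  exact iSup₂_le fun t ht => hω t ⟨zero_le, ht⟩
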